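/- **Conventions.** All groups are abelian and written additively, and all vector spaces are real. For symmetric convex subsets $X,Y$ of a vector space $E$ and $k\ge 1$ put $$d_k(X,Y)=\inf\{t>0 : \exists\, L\le E,\ \dim L<k,\ X\subseteq tY+L\}\in[0,\infty].$$ For subsets $A,B$ of a group $G$ and $(s_k)\in[0,\infty]^{\mathbb N}$, write $(d_k(A,B))\le (s_k)$ if there are a vector space $E$, symmetric convex sets $X,Y\subseteq E$ with $d_k(X,Y)\le s_k$ for all $k\ge1$, a subgroup $H\le E$ and a homomorphism $\varphi:H\to G$ with $A\subseteq\varphi(X\cap H)$ and $\varphi(Y\cap H)\subseteq B$. A Hausdorff topological group $G$ is *nuclear* if for all $m\in\mathbb N$, $c>0$ and every neighborhood $U$ of $0$ there is a neighborhood $W$ of $0$ with $(d_k(W,U))\le(ck^{-m})$. A set $A\subseteq G$ is *quasi-convex* if $A$ is the set of all $x\in G$ such that $\operatorname{Re}\chi(x)\ge0$ for every continuous character $\chi:G\to\mathbb T$ with $\operatorname{Re}\chi\ge 0$ on $A$; and $G$ is *locally quasi-convex* if $0$ has a neighborhood basis of quasi-convex sets. For $m\in\mathbb N$, call a real number $C>0$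 *admissible for $m$* if for all nonempty symmetric convex subsets $X,Y$ of a vector space and all $c>0$ with $d_k(X,Y)\le ck^{-m}$ for all $k\ge 1$, there are seminorms $p,q$ on the linear span $\langle X\rangle$ satisfying the parallelogram law such that $X\subseteq B_p$, $B_q\subseteq Y$ and $d_k(B_p,B_q)\le c\,C\,k^{-m+2}$ for all $k\ge 1$, where $B_p=\{p\le 1\}$ and $B_q=\{q\le1\}$. **Theorem.** Let $G$ be a metrizable, locally quasi-convex Hausdorff abelian topological group which is not nuclear. Admissible constants for $m=5$ and for $m=9$ exist, and there are a sequence $(g_n)$ in $G$ converging to $0$ and a quasi-convex neighborhood $U$ of $0$ such that, for all constants $c_5$ admissible for $5$ and $c_9$ admissible for $9$, all real $c$ with $$0\le c<\frac{\sqrt[4]{945}}{32\,\pi^4\,c_5\,c_9},$$ and all $n_0\in\mathbb N$, the estimate $$(d_k(\{\pm g_n : n\ge n_0\}\cup\{0\},\,U))\le (c\,k^{-9})$$ does not hold. -/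

import Mathlib

open Filter Topology
open scoped Pointwise ENNReal

universe u

namespace NuclearGroups

noncomputable section

/-- A subset `X` of an additive group is symmetric if `-x ∈ X` for all `x ∈ X`. -/
def IsSymm {E : Type u} [AddCommGroup E] (X : Set E) : Prop :=
  ∀ x ∈ X, -x ∈ X

/-- The Kolmogoroff number
`d_k(X,Y) = inf {c > 0 | ∃ L ≤ E, dim L < k, X ⊆ c Y + L} ∈ [0,∞]`
(used for `k ≥ 1` and symmetric convex `X`, `Y`). -/
def kolmogorov {E : Type u} [AddCommGroup E] [Module ℝ E] (k : ℕ) (X Y : Set E) : ℝ≥0∞ :=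
  sInf {a : ℝ≥0∞ | ∃ c : ℝ, 0 < c ∧ a = ENNReal.ofReal c ∧
    ∃ L : Submodule ℝ E, Module.rank ℝ L < (k : Cardinal) ∧ X ⊆ c • Y + (L : Set E)}

/-- The sequence `(c k^{-m})_k`, for real `c ≥ 0` and an integer `m`. -/
def rate (c : ℝ) (m : ℤ) (k : ℕ) : ℝ≥0∞ :=
  ENNReal.ofReal (c * (k : ℝ) ^ (-m))

/-- `(d_k(A,B)) ≤ (c_k)` for subsets `A`, `B` of an abelian group `G`: there are a real vector
space `E`, symmetric convex `X, Y ⊆ E` with `d_k(X,Y) ≤ c_k` for all `k ≥ 1`, a subgroup `H` of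
`E` and a homomorphism `φ : H → G` with `A ⊆ φ(X ∩ H)` and `φ(Y ∩ H) ⊆ B`.
Taking `E` in the universe of `G` is no restriction: closing up countably often inside a given
`E`, one may always pass to a subspace of cardinality at most `max (#G) 2^ℵ₀`. -/
def DiamLE {G : Type u} [AddCommGroup G] (A B : Set G) (s : ℕ → ℝ≥0∞) : Prop :=
  ∃ (E : Type u) (_ : AddCommGroup E) (_ : Module ℝ E) (X Y : Set E),
    IsSymm X ∧ Convex ℝ X ∧ IsSymm Y ∧ Convex ℝ Y ∧
    (∀ k : ℕ, 1 ≤ k → kolmogorov k X Y ≤ s k) ∧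
    ∃ (H : AddSubgroup E) (φ : H →+ G),
      A ⊆ φ '' {h : H | (h : E) ∈ X} ∧ φ '' {h : H | (h : E) ∈ Y} ⊆ B

/-- An abelian topological group is nuclear if it is Hausdorff and for every `m`, every `c > 0`
and every neighbourhood `U` of `0` there is a neighbourhood `W` of `0` with
`(d_k(W,U)) ≤ (c k^{-m})`. -/
def IsNuclearGroup (G : Type u) [AddCommGroup G] [TopologicalSpace G] : Prop :=
  T2Space G ∧ ∀ (m : ℕ) (c : ℝ), 0 < c → ∀ U ∈ 𝓝 (0 : G), ∃ W ∈ 𝓝 (0 : G),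
    DiamLE W U (rate c m)

/-- The set of continuous characters of `G` with values in the circle group. -/
abbrev DualGroup (G : Type u) [AddCommGroup G] [TopologicalSpace G] : Type u :=
  {χ : AddChar G Circle // Continuous χ}

/-- The polar of `A ⊆ G`: all continuous characters `χ` with `Re χ ≥ 0` on `A`. -/
def polar {G : Type u} [AddCommGroup G] [TopologicalSpace G] (A : Set G) : Set (DualGroup G) :=
  {χ | ∀ x ∈ A, 0 ≤ ((χ.1 x : Circle) : ℂ).re}

/-- The polar in `G` of a set `B` of continuous characters. -/
def prepolar {G : Type u} [AddCommGroup G] [TopologicalSpace G] (B : Set (DualGroup G)) : Set G :=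
  {x | ∀ χ ∈ B, 0 ≤ ((χ.1 x : Circle) : ℂ).re}

/-- A subset of `G` is quasi-convex if it equals its bipolar. -/
def IsQuasiConvex {G : Type u} [AddCommGroup G] [TopologicalSpace G] (A : Set G) : Prop :=
  A = prepolar (polar A)

/-- `G` is locally quasi-convex: `0` has a neighbourhood basis of quasi-convex sets. -/
def IsLocallyQuasiConvex (G : Type u) [AddCommGroup G] [TopologicalSpace G] : Prop :=
  ∀ U ∈ 𝓝 (0 : G), ∃ V ∈ 𝓝 (0 : G), V ⊆ U ∧ IsQuasiConvex V

/-- A pre-Hilbert seminorm is one that satisfies the parallelogram law. -/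
def IsPreHilbert {E : Type u} [AddCommGroup E] [Module ℝ E] (p : Seminorm ℝ E) : Prop :=
  ∀ x y : E, p (x + y) ^ 2 + p (x - y) ^ 2 = 2 * (p x ^ 2 + p y ^ 2)

/-- `C` is an admissible value of the constant `c_m`: for all nonempty symmetric convex subsets
`X`, `Y` of a real vector space and all `c > 0` with `d_k(X,Y) ≤ c k^{-m}` for all `k ≥ 1`, there
are pre-Hilbert seminorms `p`, `q` on the span of `X` such that `X ⊆ B_p`, `B_q ⊆ Y` and
`d_k(B_p,B_q) ≤ c C k^{-m+2}` for all `k ≥ 1`; here `B_p`, `B_q` are the closed unit balls. -/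
def IsHilbertConst (m : ℕ) (C : ℝ) : Prop :=
  0 < C ∧ ∀ (E : Type u) [AddCommGroup E] [Module ℝ E] (X Y : Set E),
    X.Nonempty → Y.Nonempty → IsSymm X → Convex ℝ X → IsSymm Y → Convex ℝ Y →
    ∀ c : ℝ, 0 < c → (∀ k : ℕ, 1 ≤ k → kolmogorov k X Y ≤ rate c m k) →
      ∃ p q : Seminorm ℝ (Submodule.span ℝ X), IsPreHilbert p ∧ IsPreHilbert q ∧
        X ⊆ Subtype.val '' p.closedBall 0 1 ∧
        Subtype.val '' q.closedBall 0 1 ⊆ Y ∧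
        ∀ k : ℕ, 1 ≤ k →
          kolmogorov k (p.closedBall 0 1) (q.closedBall 0 1) ≤ rate (c * C) ((m : ℤ) - 2) k

/-- The set `{± g_n : n ≥ n₀} ∪ {0}`. -/
def symmTail {G : Type u} [AddCommGroup G] (g : ℕ → G) (n₀ : ℕ) : Set G :=
  {x | ∃ n : ℕ, n₀ ≤ n ∧ (x = g n ∨ x = -g n)} ∪ {0}

end

end NuclearGroups

/-! The core is a criterion (`isNuclearGroup_of_finite_sets`): a locally quasi-convex Hausdorff
group is nuclear as soon as every quasi-convex neighbourhood U has a neighbourhood W and one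
constant c such that all finite F ⊆ W satisfy (d_k(F,U)) ≤ (c k⁻⁹). In a non-nuclear group some U
violates this, so the n-th member of a countable base at 0 contains a finite set F n that fails for
the constant n. Listing all the F n gives a null sequence, each tail of which contains F n for all
large n; hence the estimate fails for every real c (`exists_null_sequence`).

For the criterion, lift w_1, …, w_k ∈ W to vectors x_j and expand these in rapidly converging
series. A character χ in the polar of U has phases θ_j at the w_j and nonnegative real part at
integer combinations with small expansion. Gaussian measures on a lattice and its dual, in the
manner of Banaszczyk, allow the θ_j to be changed by integers z_j so that u ↦ ∑ (θ_j + z_j) u_j is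
bounded by a quadratic form independent of χ (`exists_short_coset_vector`, `exists_bounded_lift`).

The pigeonhole principle is then used twice. A positive proportion of the indices form a class I on
which the form is small at differences, which forces z_j to be constant on I (`exists_large_class`).
Two subsets of I of equal size with nearly equal sums differ by some n ∈ {-1,0,1}^k of sum zero at
which the form is O(k⁻²) (`exists_small_combination`). The constant z cancels, so |∑ n_j θ_j| =
O(1/k) for all χ at once (`exists_almost_dependent`). Solving for the last w_j with n_j ≠ 0 gives
Kolmogoroff numbers O(1/k) between convex hulls of angle vectors (`decaysTo_angleHull`). Iterating
along a chain of neighbourhoods gives every power of 1/k (`exists_chain`), and a neighbourhood whose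
multiples stay in W makes the constant small.

Admissible constants exist (`isHilbertConst`) because decay k⁻ᵐ gives expansions with coefficients
O(i⁻ᵐ). These factor through a diagonal operator on ℓ²; one power of i makes the coefficients square
summable, a second restores absolute convergence. -/

namespace NuclearGroups
open MeasureTheory

/-! ### Poisson summation on ℤᵈ -/

section Poisson

variable {d : Type*}

/-- The vector of real numbers with the given integer coordinates. -/
def intVec {d : Type*} (z : d → ℤ) : d → ℝ := fun i => (z i : ℝ)

lemma intVec_add {d : Type*} (z w : d → ℤ) : intVec (z + w) = intVec z + intVec w := by
  ext i; simp [intVec]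

lemma isOpenQuotientMap_torus :
    IsOpenQuotientMap (fun (x : d → ℝ) => ((fun i => (x i : UnitAddCircle)) : UnitAddTorus d)) := by
  have : ∀ i : d, IsOpenQuotientMap (fun x : ℝ => (x : UnitAddCircle)) := fun i =>
    QuotientAddGroup.isOpenQuotientMap_mk
  exact IsOpenQuotientMap.piMap this

lemma exists_intVec_of_torus_eq {x y : d → ℝ}
    (h : (fun i => (x i : UnitAddCircle)) = fun i => (y i : UnitAddCircle)) :
    ∃ z : d → ℤ, x = y + intVec z := by
  have : ∀ i, ∃ n : ℤ, x i = y i + n := by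
    intro i
    have := congrFun h i
    rw [QuotientAddGroup.eq] at this
    obtain ⟨n, hn⟩ := AddSubgroup.mem_zmultiples_iff.1 this
    exact ⟨-n, by simp at hn; push_cast; linarith⟩
  choose z hz using this
  exact ⟨z, funext hz⟩

variable [Fintype d]

/-- The integral of a function over `ℝᵈ` is the sum of its integrals over the unit cube of its
integer translates. -/
lemma hasSum_integral_cube {f : (d → ℝ) → ℂ} (hf : Integrable f) :
    HasSum (fun z : d → ℤ => ∫ x in {x : d → ℝ | ∀ i, x i ∈ Set.Ioc (0 : ℝ) (0 + 1)},
      f (x + intVec z)) (∫ x, f x) := by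
  set box : (d → ℤ) → Set (d → ℝ) := fun z => {x | ∀ i, x i ∈ Set.Ioc (z i : ℝ) (z i + 1)}
  have hm : ∀ z, MeasurableSet (box z) := fun z =>
    MeasurableSet.univ_pi' (fun i => measurableSet_Ioc)
  have hU : (⋃ z, box z) = Set.univ := by
    refine Set.eq_univ_of_forall fun x => Set.mem_iUnion.2 ⟨fun i => ⌈x i⌉ - 1, fun i => ?_⟩
    have h1 := Int.le_ceil (x i)
    have h2 := Int.ceil_lt_add_one (x i)
    constructor <;> push_cast <;> linarith
  have hd : Pairwise (Function.onFun Disjoint box) := by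
    intro z w hzw
    refine Set.disjoint_left.2 fun x hx hy => hzw (funext fun i => ?_)
    obtain ⟨h1, h2⟩ := hx i
    obtain ⟨h3, h4⟩ := hy i
    have h5 : (z i : ℝ) < w i + 1 := by linarith
    have h6 : (w i : ℝ) < z i + 1 := by linarith
    have h7 : z i < w i + 1 := by exact_mod_cast h5
    have h8 : w i < z i + 1 := by exact_mod_cast h6
    omega
  have key := hasSum_integral_iUnion hm hd (f := f) (μ := volume) hf.integrableOn
  rw [hU, Measure.restrict_univ] at key
  refine key.congr_fun fun z => ?_
  have h := (measurePreserving_add_right (volume : Measure (d → ℝ)) (intVec z)).setIntegral_preimage_emb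
    (measurableEmbedding_addRight (intVec z)) f (box z)
  rw [← h]
  congr 2
  ext x
  simp only [Set.mem_ofPred_eq, Set.mem_preimage, box, Pi.add_apply, intVec, Set.mem_Ioc]
  refine forall_congr' fun i => ?_
  constructor <;> rintro ⟨h1, h2⟩ <;> constructor <;> linarith

lemma mFourier_coe (n : d → ℤ) (x : d → ℝ) :
    UnitAddTorus.mFourier n (fun i => (x i : UnitAddCircle)) =
      Complex.exp (2 * Real.pi * Complex.I * (∑ i, (n i : ℝ) * x i : ℝ)) := by
  simp only [UnitAddTorus.mFourier, ContinuousMap.coe_mk, fourier_coe_apply]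
  rw [← Complex.exp_sum]
  congr 1
  push_cast
  rw [Finset.mul_sum]
  refine Finset.sum_congr rfl fun i _ => ?_
  ring

lemma isBounded_unitCube :
    {x : d → ℝ | ∀ i, x i ∈ Set.Ioc (0 : ℝ) (0 + 1)} ⊆ Metric.closedBall 0 1 := by
  intro x hx
  rw [mem_closedBall_zero_iff, pi_norm_le_iff_of_nonneg zero_le_one]
  intro i
  obtain ⟨h1, h2⟩ := hx i
  rw [Real.norm_eq_abs, abs_le]
  constructor <;> linarith

/-- Poisson summation over `ℤᵈ`. -/
theorem poisson_pi {f : (d → ℝ) → ℂ} (hc : Continuous f) (hi : Integrable f)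
    (hb : ∀ R : ℝ, ∃ u : (d → ℤ) → ℝ, Summable u ∧ ∀ x, ‖x‖ ≤ R → ∀ z, ‖f (x + intVec z)‖ ≤ u z)
    (hs : Summable fun n : d → ℤ =>
      ∫ x, Complex.exp (-(2 * Real.pi * Complex.I * (∑ i, (n i : ℝ) * x i : ℝ))) * f x)
    (x : d → ℝ) :
    HasSum (fun n : d → ℤ =>
      (∫ y, Complex.exp (-(2 * Real.pi * Complex.I * (∑ i, (n i : ℝ) * y i : ℝ))) * f y) *
        Complex.exp (2 * Real.pi * Complex.I * (∑ i, (n i : ℝ) * x i : ℝ)))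
      (∑' z : d → ℤ, f (x + intVec z)) := by
  set F0 : (d → ℝ) → ℂ := fun x => ∑' z : d → ℤ, f (x + intVec z) with hF0
  set q : (d → ℝ) → UnitAddTorus d := fun x i => (x i : UnitAddCircle) with hq
  have hqq : IsOpenQuotientMap q := isOpenQuotientMap_torus
  have hF0c : Continuous F0 := by
    rw [continuous_iff_continuousAt]
    intro x
    obtain ⟨u, hu, hu2⟩ := hb (‖x‖ + 1)
    have : ContinuousOn F0 (Metric.ball 0 (‖x‖ + 1)) := by
      refine continuousOn_tsum (fun z => ?_) hu fun z y hy => hu2 y ?_ z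
      · exact (hc.comp (continuous_id.add continuous_const)).continuousOn
      · exact (mem_ball_zero_iff.1 hy).le
    exact this.continuousAt (Metric.isOpen_ball.mem_nhds (by simp))
  have hF0p : ∀ x w, F0 (x + intVec w) = F0 x := by
    intro x w
    simp only [hF0]
    rw [← (Equiv.addLeft w).tsum_eq (fun z => f (x + intVec z))]
    refine tsum_congr fun z => ?_
    simp [intVec_add, add_assoc]
  -- Periodicity of `F0` makes the choice of preimage harmless, and the open quotient map transfers
  -- continuity to the torus.
  set F : UnitAddTorus d → ℂ := fun t => F0 (Function.surjInv hqq.surjective t) with hF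
  have hFq : ∀ x, F (q x) = F0 x := by
    intro x
    obtain ⟨z, hz⟩ := exists_intVec_of_torus_eq (Function.surjInv_eq hqq.surjective (q x))
    simp only [hF]
    rw [hz, hF0p]
  have hFc : Continuous F := by
    rw [hqq.isQuotientMap.continuous_iff]
    convert hF0c using 1
    exact funext hFq
  have hcoef : ∀ n : d → ℤ, UnitAddTorus.mFourierCoeff F n =
      ∫ y, Complex.exp (-(2 * Real.pi * Complex.I * (∑ i, (n i : ℝ) * y i : ℝ))) * f y := by
    intro n
    set e : (d → ℝ) → ℂ := fun y => Complex.exp (-(2 * Real.pi * Complex.I * (∑ i, (n i : ℝ) * y i : ℝ))) with he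
    have he1 : ∀ y, ‖e y‖ = 1 := by
      intro y
      simp only [he, Complex.norm_exp]
      simp
    have hec : Continuous e := by fun_prop
    have hep : ∀ y w, e (y + intVec w) = e y := by
      intro y w
      simp only [he]
      rw [Complex.exp_eq_exp_iff_exists_int]
      refine ⟨-∑ i, n i * w i, ?_⟩
      simp only [Pi.add_apply, intVec, mul_add, Finset.sum_add_distrib]
      push_cast
      ring
    have hef : Integrable (fun y => e y * f y) := by
      refine hi.norm.mono' (hec.mul hc).aestronglyMeasurable (Filter.Eventually.of_forall fun y => ?_)
      rw [norm_mul, he1, one_mul]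
    rw [UnitAddTorus.mFourierCoeff_eq_integral F n 0]
    rw [← (hasSum_integral_cube hef).tsum_eq]
    have h1 : ∀ y : d → ℝ, UnitAddTorus.mFourier (-n) (fun i => (y i : UnitAddCircle)) •
        F (fun i => (y i : UnitAddCircle)) = ∑' z, e (y + intVec z) * f (y + intVec z) := by
      intro y
      rw [mFourier_coe, show F (fun i => (y i : UnitAddCircle)) = F0 y from hFq y, smul_eq_mul]
      simp only [hep, hF0]
      rw [tsum_mul_left]
      congr 2
      simp [Finset.sum_neg_distrib]
    simp only [h1]
    -- The unit cube lies in the ball of radius 1, so this majorant justifies exchanging sum and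
    -- integral.
    obtain ⟨u, hu, hu2⟩ := hb 1
    have hfin : volume {x : d → ℝ | ∀ i, x i ∈ Set.Ioc (0 : ℝ) (0 + 1)} < ⊤ :=
      (measure_mono isBounded_unitCube).trans_lt (isCompact_closedBall _ _).measure_lt_top
    have hms : MeasurableSet {x : d → ℝ | ∀ i, x i ∈ Set.Ioc (0 : ℝ) (0 + 1)} :=
      MeasurableSet.univ_pi' (fun i => measurableSet_Ioc)
    have hint : ∀ z, IntegrableOn (fun y => e (y + intVec z) * f (y + intVec z))
        {x : d → ℝ | ∀ i, x i ∈ Set.Ioc (0 : ℝ) (0 + 1)} := fun z =>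
      (hef.comp_add_right (intVec z)).integrableOn
    refine (integral_tsum_of_summable_integral_norm hint ?_).symm
    refine Summable.of_nonneg_of_le (fun z => integral_nonneg fun y => norm_nonneg _) (fun z => ?_)
      (hu.mul_left (volume.real {x : d → ℝ | ∀ i, x i ∈ Set.Ioc (0 : ℝ) (0 + 1)}))
    have h2 : ∫ y in {x : d → ℝ | ∀ i, x i ∈ Set.Ioc (0 : ℝ) (0 + 1)}, ‖e (y + intVec z) * f (y + intVec z)‖
        ≤ ∫ y in {x : d → ℝ | ∀ i, x i ∈ Set.Ioc (0 : ℝ) (0 + 1)}, u z := by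
      refine setIntegral_mono_on (hint z).norm (integrableOn_const hfin.ne) hms fun y hy => ?_
      rw [norm_mul, he1, one_mul]
      exact hu2 y (mem_closedBall_zero_iff.1 (isBounded_unitCube hy)) z
    simpa using h2
  have := UnitAddTorus.hasSum_mFourier_series_apply_of_summable (f := ⟨F, hFc⟩)
    (by simpa only [ContinuousMap.coe_mk, funext hcoef] using hs) (q x)
  simp only [ContinuousMap.coe_mk, hcoef, hFq, smul_eq_mul] at this
  simpa only [hq, mFourier_coe] using this

end Poisson

/-! ### Gaussian measures on lattices and their cosets -/

section Gauss

lemma norm_sq_le_two_mul_add {F : Type*} [NormedAddCommGroup F] (x y : F) : ‖x‖ ^ 2 ≤ 2 * ‖y + x‖ ^ 2 + 2 * ‖y‖ ^ 2 := by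
  have h := norm_sub_le (y + x) y
  rw [add_sub_cancel_left] at h
  nlinarith [sq_nonneg (‖y + x‖ - ‖y‖), norm_nonneg x, norm_nonneg y, norm_nonneg (y + x)]

variable {ι F : Type*} [Fintype ι] [NormedAddCommGroup F] [InnerProductSpace ℝ F]

/-- The vector with coordinates `x` in the basis `b`. -/
noncomputable abbrev cvec (b : Module.Basis ι ℝ F) : (ι → ℝ) ≃ₗ[ℝ] F := b.equivFun.symm

/-- The Gaussian decays faster than ‖v‖^(-2n), which is summable over the lattice when 2n exceeds
its rank; the factor n!/cⁿ comes from tⁿ/n! ≤ exp t at t = c‖v‖². The vector 0 is excluded, since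
its inverse norm is 0 by convention. -/
lemma summable_gauss (b : Module.Basis ι ℝ F) {c : ℝ} (hc : 0 < c) :
    Summable fun z : ι → ℤ => Real.exp (-c * ‖cvec b (intVec z)‖ ^ 2) := by
  have := Module.Basis.finiteDimensional_of_finite b
  set L := Submodule.span ℤ (Set.range b)
  set g : (ι → ℤ) → L := fun z => ⟨cvec b (intVec z), by
    rw [Module.Basis.equivFun_symm_apply]
    refine Submodule.sum_mem _ fun i _ => ?_
    have := Submodule.smul_mem L (z i) (Submodule.subset_span (Set.mem_range_self i))
    rwa [← Int.cast_smul_eq_zsmul ℝ] at this⟩ with hg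
  have hinj : Function.Injective g := by
    intro z w h
    have h1 := (cvec b).injective (congrArg Subtype.val h)
    funext i
    have := congrFun h1 i
    simpa [intVec] using this
  set n := Module.finrank ℤ L + 1 with hn
  have hs : Summable fun z : L => ‖z‖⁻¹ ^ (2 * n) :=
    ZLattice.summable_norm_pow_inv L (2 * n) (by omega)
  have hs2 := (hs.comp_injective hinj).mul_left ((n.factorial : ℝ) / c ^ n)
  refine Summable.of_norm_bounded_eventually hs2 ?_
  refine (Set.finite_singleton (0 : ι → ℤ)).subset fun z hz => ?_
  by_contra h0
  refine hz ?_
  have hgz : cvec b (intVec z) ≠ 0 := by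
    intro h
    refine h0 (hinj (Subtype.ext ?_))
    simp only [hg, h]
    have : intVec (0 : ι → ℤ) = 0 := by ext i; simp [intVec]
    rw [this, map_zero]
  have hpos : 0 < ‖cvec b (intVec z)‖ := norm_pos_iff.2 hgz
  have h1 := Real.pow_div_factorial_le_exp (c * ‖cvec b (intVec z)‖ ^ 2) (by positivity) n
  have h2 : ‖g z‖ = ‖cvec b (intVec z)‖ := rfl
  change ‖Real.exp (-c * ‖cvec b (intVec z)‖ ^ 2)‖ ≤ n.factorial / c ^ n * ‖g z‖⁻¹ ^ (2 * n)
  rw [Real.norm_of_nonneg (Real.exp_pos _).le, h2, neg_mul, Real.exp_neg]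
  rw [inv_le_comm₀ (Real.exp_pos _) (by positivity)]
  refine le_trans (le_of_eq ?_) h1
  rw [mul_inv, inv_div, inv_pow, inv_inv, mul_pow, ← pow_mul]
  ring

lemma inner_cvec [DecidableEq ι] {b b' : Module.Basis ι ℝ F}
    (hd : ∀ i j, inner ℝ (b i) (b' j) = if i = j then (1 : ℝ) else 0) (x y : ι → ℝ) :
    inner ℝ (cvec b x) (cvec b' y) = ∑ i, y i * x i := by
  rw [Module.Basis.equivFun_symm_apply, Module.Basis.equivFun_symm_apply, sum_inner]
  refine Finset.sum_congr rfl fun i _ => ?_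
  rw [inner_sum]
  simp [inner_smul_left, inner_smul_right, hd, mul_comm]

/-- Poisson summation for the Gaussian of a lattice. -/
theorem gaussian_poisson [DecidableEq ι] {b b' : Module.Basis ι ℝ F}
    (hd : ∀ i j, inner ℝ (b i) (b' j) = if i = j then (1 : ℝ) else 0) :
    ∃ C : ℝ, 0 ≤ C ∧ ∀ x : ι → ℝ,
      HasSum (fun z : ι → ℤ => C * Real.exp (-Real.pi * ‖cvec b' (intVec z)‖ ^ 2) *
        Real.cos (2 * Real.pi * ∑ i, (z i : ℝ) * x i))
      (∑' z : ι → ℤ, Real.exp (-Real.pi * ‖cvec b (x + intVec z)‖ ^ 2)) := by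
  have := Module.Basis.finiteDimensional_of_finite b
  let _ : MeasurableSpace F := borel F
  have : BorelSpace F := ⟨rfl⟩
  set e : (ι → ℝ) ≃L[ℝ] F := (cvec b).toContinuousLinearEquiv with he
  have hee : ∀ x, e x = cvec b x := fun x => rfl
  -- Uniqueness of Haar measure. Only the nonnegativity of this factor is recorded in the
  -- conclusion.
  obtain ⟨c, hc⟩ : ∃ c : NNReal, Measure.map e (volume : Measure (ι → ℝ)) = c • volume :=
    ⟨_, Measure.isAddLeftInvariant_eq_smul _ _⟩
  set G : F → ℂ := fun v => Complex.exp (-(Real.pi : ℂ) * ‖v‖ ^ 2) with hG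
  have hπ : 0 < (Real.pi : ℂ).re := by simpa using Real.pi_pos
  have hGi : Integrable G := by
    have := GaussianFourier.integrable_cexp_neg_mul_sq_norm_add hπ 0 (0 : F)
    simpa only [zero_mul, add_zero] using this
  have hGe : ∀ v, G v = (Real.exp (-Real.pi * ‖v‖ ^ 2) : ℝ) := by
    intro v; simp [hG]
  have hint : ∀ g : F → ℂ, ∫ x, g (e x) = (c : ℝ) • ∫ v, g v := by
    intro g
    have := integral_map_equiv (μ := volume) e.toHomeomorph.toMeasurableEquiv g
    rw [show (e.toHomeomorph.toMeasurableEquiv : (ι → ℝ) → F) = e from rfl] at this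
    rw [← this, hc, integral_smul_nnreal_measure]
    rfl
  have hfi : Integrable fun x => G (e x) := by
    have h1 : Integrable G (Measure.map e volume) := by
      rw [hc]; exact hGi.smul_measure_nnreal
    exact h1.comp_measurable e.continuous.measurable
  have hfour : ∀ n : ι → ℤ,
      ∫ x, Complex.exp (-(2 * Real.pi * Complex.I * (∑ i, (n i : ℝ) * x i : ℝ))) * G (e x) =
        ((c * Real.exp (-Real.pi * ‖cvec b' (intVec n)‖ ^ 2) : ℝ) : ℂ) := by
    intro n
    have h1 := Real.fourier_eq' G (cvec b' (intVec n))
    have h2 := fourier_gaussian_innerProductSpace hπ (cvec b' (intVec n))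
    have h3 : ∀ x : ι → ℝ, Complex.exp (-(2 * Real.pi * Complex.I * (∑ i, (n i : ℝ) * x i : ℝ))) * G (e x)
        = (fun v => Complex.exp (↑(-2 * Real.pi * inner ℝ v (cvec b' (intVec n))) * Complex.I) • G v) (e x) := by
      intro x
      simp only [hee, inner_cvec hd, smul_eq_mul, intVec]
      congr 2
      push_cast
      ring
    simp only [h3]
    rw [hint (fun v => Complex.exp (↑(-2 * Real.pi * inner ℝ v (cvec b' (intVec n))) * Complex.I) • G v),
      ← h1, h2]
    have hπ0 : (Real.pi : ℂ) ≠ 0 := by exact_mod_cast Real.pi_ne_zero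
    rw [div_self hπ0, Complex.one_cpow, one_mul, Complex.real_smul]
    push_cast
    congr 2
    field_simp
  refine ⟨c, c.2, fun x => ?_⟩
  have hex : ∀ z, G (e (x + intVec z)) = (Real.exp (-Real.pi * ‖cvec b (x + intVec z)‖ ^ 2) : ℝ) :=
    fun z => hGe _
  have hb : ∀ R : ℝ, ∃ u : (ι → ℤ) → ℝ, Summable u ∧
      ∀ x, ‖x‖ ≤ R → ∀ z, ‖G (e (x + intVec z))‖ ≤ u z := by
    intro R
    obtain ⟨M, hM⟩ := (isCompact_closedBall (0 : ι → ℝ) R).exists_bound_of_continuousOn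
      e.continuous.continuousOn
    refine ⟨fun z => Real.exp (Real.pi * M ^ 2) * Real.exp (-(Real.pi / 2) * ‖cvec b (intVec z)‖ ^ 2),
      (summable_gauss b (by positivity)).mul_left _, fun y hy z => ?_⟩
    rw [hGe, Complex.norm_real, Real.norm_of_nonneg (Real.exp_pos _).le]
    dsimp only
    rw [← Real.exp_add]
    refine Real.exp_le_exp.2 ?_
    have h1 := norm_sq_le_two_mul_add (cvec b (intVec z)) (cvec b y)
    have h2 := hM y (mem_closedBall_zero_iff.2 hy)
    rw [hee] at h2
    have h3 : ‖cvec b y‖ ^ 2 ≤ M ^ 2 := by gcongr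
    rw [hee, map_add]
    nlinarith [Real.pi_pos]
  have key := poisson_pi (f := fun x => G (e x)) (by fun_prop) hfi hb ?_ x
  · have h5 := Complex.hasSum_re key
    simp only [hfour, hex] at h5
    rw [← Complex.ofReal_tsum, Complex.ofReal_re] at h5
    convert h5 using 2 with z
    rw [Complex.re_ofReal_mul]
    congr 1
    rw [show (2 * Real.pi * Complex.I * ((∑ i, (z i : ℝ) * x i : ℝ) : ℂ)) =
      ((2 * Real.pi * ∑ i, (z i : ℝ) * x i : ℝ) : ℂ) * Complex.I by push_cast; ring]
    rw [Complex.exp_ofReal_mul_I_re]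
  · simp only [hfour]
    exact Complex.summable_ofReal.2 ((summable_gauss b' Real.pi_pos).mul_left _)

/-- The Gaussian mass of the translate by `x` of the lattice spanned by `b`. -/
noncomputable def gaussMass (b : Module.Basis ι ℝ F) (x : ι → ℝ) : ℝ :=
  ∑' z : ι → ℤ, Real.exp (-Real.pi * ‖cvec b (x + intVec z)‖ ^ 2)

lemma summable_gauss_shift (b : Module.Basis ι ℝ F) (v : F) :
    Summable fun z : ι → ℤ => Real.exp (-Real.pi * ‖v + cvec b (intVec z)‖ ^ 2) := by
  refine Summable.of_nonneg_of_le (fun z => (Real.exp_pos _).le) (fun z => ?_)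
    ((summable_gauss b (show 0 < Real.pi / 2 by positivity)).mul_left (Real.exp (Real.pi * ‖v‖ ^ 2)))
  rw [← Real.exp_add]
  refine Real.exp_le_exp.2 ?_
  have h1 := norm_sq_le_two_mul_add (cvec b (intVec z)) v
  nlinarith [Real.pi_pos]

lemma gaussMass_eq (b : Module.Basis ι ℝ F) (v : F) :
    ∑' z : ι → ℤ, Real.exp (-Real.pi * ‖v + cvec b (intVec z)‖ ^ 2) =
      gaussMass b (b.equivFun v) := by
  simp only [gaussMass, map_add, LinearEquiv.symm_apply_apply]

/-- By Poisson summation the mass is a cosine series with nonnegative coefficients, hence largest at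
0. -/
lemma gaussMass_le [DecidableEq ι] {b b' : Module.Basis ι ℝ F}
    (hd : ∀ i j, inner ℝ (b i) (b' j) = if i = j then (1 : ℝ) else 0) (x : ι → ℝ) :
    gaussMass b x ≤ gaussMass b 0 := by
  obtain ⟨C, hC, h⟩ := gaussian_poisson hd
  refine hasSum_le (fun z => ?_) (h x) (h 0)
  refine mul_le_mul_of_nonneg_left ?_ (mul_nonneg hC (Real.exp_pos _).le)
  simpa using Real.cos_le_one _

lemma gaussMass_zero_pos (b : Module.Basis ι ℝ F) : 0 < gaussMass b 0 := by
  have := (summable_gauss_shift b 0).tsum_pos (fun z => (Real.exp_pos _).le) 0 (Real.exp_pos _)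
  rw [gaussMass_eq] at this
  simpa using this

lemma sq_div_two_le_exp_add_exp_neg (x : ℝ) : x ^ 2 / 2 ≤ Real.exp x + Real.exp (-x) := by
  rcases le_total 0 x with h | h
  · have := Real.quadratic_le_exp_of_nonneg h
    nlinarith [Real.exp_pos (-x)]
  · have := Real.quadratic_le_exp_of_nonneg (neg_nonneg.2 h)
    nlinarith [Real.exp_pos x]

/-- This bounds a second moment by the masses of two translated lattices, which `gaussMass_le` then
compares with the mass of the lattice itself. The translates at ±y' add up to the Gaussian times a
hyperbolic cosine, which dominates the square of its argument. -/
lemma exists_gauss_sq_le (y : F) : ∃ y' : F, ∀ v : F,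
    inner ℝ v y ^ 2 * Real.exp (-Real.pi * ‖v‖ ^ 2) ≤ ‖y‖ ^ 2 / 2 *
      (Real.exp (-Real.pi * ‖v + y'‖ ^ 2) + Real.exp (-Real.pi * ‖v - y'‖ ^ 2)) := by
  rcases eq_or_ne y 0 with rfl | hy
  · exact ⟨0, fun v => by simp⟩
  have hy0 : 0 < ‖y‖ := norm_pos_iff.2 hy
  have hπ := Real.pi_pos
  -- Normalised so that π‖t y‖² = 1; translation by t y then costs exactly a factor e⁻¹.
  set t : ℝ := (Real.sqrt Real.pi * ‖y‖)⁻¹ with ht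
  have ht2 : Real.pi * (t ^ 2 * ‖y‖ ^ 2) = 1 := by
    rw [ht, inv_pow, mul_pow, Real.sq_sqrt hπ.le]
    field_simp
  refine ⟨t • y, fun v => ?_⟩
  set a := inner ℝ v y with ha
  have h1 : ‖v + t • y‖ ^ 2 = ‖v‖ ^ 2 + 2 * (t * a) + t ^ 2 * ‖y‖ ^ 2 := by
    rw [norm_add_sq_real, inner_smul_right, norm_smul, mul_pow, Real.norm_eq_abs, sq_abs]
  have h2 : ‖v - t • y‖ ^ 2 = ‖v‖ ^ 2 - 2 * (t * a) + t ^ 2 * ‖y‖ ^ 2 := by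
    rw [norm_sub_sq_real, inner_smul_right, norm_smul, mul_pow, Real.norm_eq_abs, sq_abs]
  have e1 : Real.exp (-Real.pi * ‖v + t • y‖ ^ 2) =
      Real.exp (-Real.pi * ‖v‖ ^ 2) * Real.exp (-1) * Real.exp (-(2 * Real.pi * t * a)) := by
    rw [← Real.exp_add, ← Real.exp_add, h1]
    congr 1
    linear_combination -ht2
  have e2 : Real.exp (-Real.pi * ‖v - t • y‖ ^ 2) =
      Real.exp (-Real.pi * ‖v‖ ^ 2) * Real.exp (-1) * Real.exp (2 * Real.pi * t * a) := by
    rw [← Real.exp_add, ← Real.exp_add, h2]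
    congr 1
    linear_combination -ht2
  rw [e1, e2]
  have h3 := sq_div_two_le_exp_add_exp_neg (2 * Real.pi * t * a)
  have h4 : (2 * Real.pi * t * a) ^ 2 / 2 * ‖y‖ ^ 2 = 2 * Real.pi * a ^ 2 := by
    linear_combination (2 * Real.pi * a ^ 2) * ht2
  -- The loss e⁻¹ is absorbed because e ≤ π.
  have h5 : (1 : ℝ) ≤ Real.pi * Real.exp (-1) := by
    have := Real.exp_one_lt_d9
    rw [Real.exp_neg, ← div_eq_mul_inv, le_div_iff₀ (Real.exp_pos _)]
    linarith [Real.pi_gt_three]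
  have hw := Real.exp_pos (-Real.pi * ‖v‖ ^ 2)
  set w := Real.exp (-Real.pi * ‖v‖ ^ 2)
  set P := Real.exp (2 * Real.pi * t * a)
  set N := Real.exp (-(2 * Real.pi * t * a))
  have h6 : 2 * Real.pi * a ^ 2 ≤ (P + N) * ‖y‖ ^ 2 := by
    rw [← h4]; gcongr
  have h7 : a ^ 2 ≤ Real.exp (-1) * (‖y‖ ^ 2 / 2 * (P + N)) := by
    calc a ^ 2 ≤ (Real.pi * Real.exp (-1)) * a ^ 2 := le_mul_of_one_le_left (sq_nonneg _) h5
      _ = Real.exp (-1) / 2 * (2 * Real.pi * a ^ 2) := by ring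
      _ ≤ Real.exp (-1) / 2 * ((P + N) * ‖y‖ ^ 2) := by gcongr
      _ = _ := by ring
  calc a ^ 2 * w ≤ (Real.exp (-1) * (‖y‖ ^ 2 / 2 * (P + N))) * w := by gcongr
    _ = _ := by ring

/-- Second moments of the Gaussian measure on a translate of a lattice. -/
lemma gauss_second_moment [DecidableEq ι] {b b' : Module.Basis ι ℝ F}
    (hd : ∀ i j, inner ℝ (b i) (b' j) = if i = j then (1 : ℝ) else 0) (x : ι → ℝ) (y : F) :
    (Summable fun z : ι → ℤ => inner ℝ (cvec b (x + intVec z)) y ^ 2 *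
      Real.exp (-Real.pi * ‖cvec b (x + intVec z)‖ ^ 2)) ∧
    ∑' z : ι → ℤ, inner ℝ (cvec b (x + intVec z)) y ^ 2 *
      Real.exp (-Real.pi * ‖cvec b (x + intVec z)‖ ^ 2) ≤ ‖y‖ ^ 2 * gaussMass b 0 := by
  obtain ⟨y', hy'⟩ := exists_gauss_sq_le y
  have s1 := summable_gauss_shift b (cvec b x + y')
  have s2 := summable_gauss_shift b (cvec b x - y')
  have hle : ∀ z : ι → ℤ, inner ℝ (cvec b (x + intVec z)) y ^ 2 *
      Real.exp (-Real.pi * ‖cvec b (x + intVec z)‖ ^ 2) ≤ ‖y‖ ^ 2 / 2 *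
      (Real.exp (-Real.pi * ‖cvec b x + y' + cvec b (intVec z)‖ ^ 2) +
        Real.exp (-Real.pi * ‖cvec b x - y' + cvec b (intVec z)‖ ^ 2)) := by
    intro z
    refine (hy' _).trans (le_of_eq ?_)
    rw [map_add, add_right_comm, sub_add_eq_add_sub]
  have s3 := (s1.add s2).mul_left (‖y‖ ^ 2 / 2)
  have s4 := Summable.of_nonneg_of_le (fun z => mul_nonneg (sq_nonneg _) (Real.exp_pos _).le) hle s3
  refine ⟨s4, (s4.tsum_le_tsum hle s3).trans ?_⟩
  rw [tsum_mul_left, s1.tsum_add s2, gaussMass_eq, gaussMass_eq]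
  have h1 := gaussMass_le hd (b.equivFun (cvec b x + y'))
  have h2 := gaussMass_le hd (b.equivFun (cvec b x - y'))
  have : 0 ≤ ‖y‖ ^ 2 := by positivity
  nlinarith

lemma summable_gaussMass (b : Module.Basis ι ℝ F) (x : ι → ℝ) :
    Summable fun z : ι → ℤ => Real.exp (-Real.pi * ‖cvec b (x + intVec z)‖ ^ 2) := by
  simpa only [map_add] using summable_gauss_shift b (cvec b x)

/-- A coset of the dual lattice whose character is close to `1` at the short vectors of the lattice
contains a short vector. -/
theorem exists_short_coset_vector [DecidableEq ι] {b b' : Module.Basis ι ℝ F}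
    (hd : ∀ i j, inner ℝ (b i) (b' j) = if i = j then (1 : ℝ) else 0) (θ : ι → ℝ)
    {σ τ : Type*} [Fintype σ] [Fintype τ] (u : σ → F) (y : τ → F) {S : ℝ} (hS : 0 < S)
    (hu : ∑ s, ‖u s‖ ^ 2 ≤ 1 / 10) (hy : ∑ r, ‖y r‖ ^ 2 ≤ S)
    (hcos : ∀ z : ι → ℤ, ∑ s, inner ℝ (cvec b (intVec z)) (u s) ^ 2 ≤ 1 →
      7 / 10 ≤ Real.cos (2 * Real.pi * ∑ i, (z i : ℝ) * θ i)) :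
    ∃ z : ι → ℤ, ∑ r, inner ℝ (cvec b' (θ + intVec z)) (y r) ^ 2 ≤ 3 * S := by
  have hd' : ∀ i j, inner ℝ (b' i) (b j) = if i = j then (1 : ℝ) else 0 := by
    intro i j
    rw [real_inner_comm, hd]
    simp [eq_comm]
  obtain ⟨C, hC, hP⟩ := gaussian_poisson hd'
  -- The ratio of these masses is the Gaussian average of the character over the lattice of `b`. The
  -- character is at least 7/10 where Q ≤ 1 and at least -1 elsewhere, so it dominates 7/10 - 17/10
  -- Q; as Q has mean at most 1/10, the average is at least 0.53.
  have hhalf : gaussMass b' 0 / 2 ≤ gaussMass b' θ := by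
    have h0 := hP 0
    have h1 := hP θ
    have hw : ∀ z : ι → ℤ, cvec b (0 + intVec z) = cvec b (intVec z) := fun z => by rw [zero_add]
    have hm := fun s => gauss_second_moment hd 0 (u s)
    simp only [hw] at hm
    have hms := summable_sum (s := Finset.univ) fun s _ => (hm s).1
    have hsum := hasSum_sum (s := Finset.univ) fun s _ => (hm s).1.hasSum
    have hb0 : HasSum (fun z : ι → ℤ => Real.exp (-Real.pi * ‖cvec b (intVec z)‖ ^ 2))
        (gaussMass b 0) := by
      have := (summable_gaussMass b 0).hasSum
      simpa only [hw, gaussMass] using this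
    have hbC : C * gaussMass b 0 = gaussMass b' 0 := by
      refine (hb0.mul_left C).unique ?_
      simpa [gaussMass] using h0
    have hle : C * (7 / 10 * gaussMass b 0 - 17 / 10 * ∑ s, ∑' z : ι → ℤ,
        inner ℝ (cvec b (intVec z)) (u s) ^ 2 * Real.exp (-Real.pi * ‖cvec b (intVec z)‖ ^ 2)) ≤
        gaussMass b' θ := by
      refine hasSum_le (fun z => ?_) (((hb0.mul_left (7 / 10)).sub (hsum.mul_left (17 / 10))).mul_left C) h1
      rw [mul_assoc]
      refine mul_le_mul_of_nonneg_left ?_ hC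
      rw [← Finset.sum_mul]
      set Q := ∑ s, inner ℝ (cvec b (intVec z)) (u s) ^ 2 with hQ
      have hwz := Real.exp_pos (-Real.pi * ‖cvec b (intVec z)‖ ^ 2)
      have : 7 / 10 - 17 / 10 * Q ≤ Real.cos (2 * Real.pi * ∑ i, (z i : ℝ) * θ i) := by
        have hQ0 : 0 ≤ Q := Finset.sum_nonneg fun s _ => sq_nonneg _
        rcases le_or_gt Q 1 with h | h
        · linarith [hcos z h]
        · linarith [Real.neg_one_le_cos (2 * Real.pi * ∑ i, (z i : ℝ) * θ i)]
      nlinarith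
    have hms2 : ∑ s, ∑' z : ι → ℤ, inner ℝ (cvec b (intVec z)) (u s) ^ 2 *
        Real.exp (-Real.pi * ‖cvec b (intVec z)‖ ^ 2) ≤ 1 / 10 * gaussMass b 0 := by
      refine (Finset.sum_le_sum fun s _ => (hm s).2).trans ?_
      rw [← Finset.sum_mul]
      exact mul_le_mul_of_nonneg_right hu (gaussMass_zero_pos b).le
    rw [← hbC]
    nlinarith [gaussMass_zero_pos b, mul_nonneg hC (gaussMass_zero_pos b).le,
      mul_le_mul_of_nonneg_left hms2 hC]
  -- Otherwise the second moment over the coset would exceed 3S times half the mass of the dual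
  -- lattice, while `gauss_second_moment` bounds it by S times that mass.
  by_contra! hcon
  have hm := fun r => gauss_second_moment hd' θ (y r)
  have hsum := hasSum_sum (s := Finset.univ) fun r _ => (hm r).1.hasSum
  have hle : 3 * S * gaussMass b' θ ≤ ∑ r, ∑' z : ι → ℤ, inner ℝ (cvec b' (θ + intVec z)) (y r) ^ 2 *
      Real.exp (-Real.pi * ‖cvec b' (θ + intVec z)‖ ^ 2) := by
    refine hasSum_le (fun z => ?_) ((summable_gaussMass b' θ).hasSum.mul_left (3 * S)) hsum
    rw [← Finset.sum_mul]
    exact mul_le_mul_of_nonneg_right (hcon z).le (Real.exp_pos _).le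
  have hle2 : ∑ r, ∑' z : ι → ℤ, inner ℝ (cvec b' (θ + intVec z)) (y r) ^ 2 *
      Real.exp (-Real.pi * ‖cvec b' (θ + intVec z)‖ ^ 2) ≤ S * gaussMass b' 0 := by
    refine (Finset.sum_le_sum fun r _ => (hm r).2).trans ?_
    rw [← Finset.sum_mul]
    exact mul_le_mul_of_nonneg_right hy (gaussMass_zero_pos b').le
  nlinarith [gaussMass_zero_pos b', mul_pos hS (gaussMass_zero_pos b')]

end Gauss

/-! ### Lifting characters of ℤᵏ to bounded functionals -/

section Lift

lemma sum_range_inv_sq_le (N : ℕ) : ∑ i ∈ Finset.range N, ((i : ℝ) + 1)⁻¹ ^ 2 ≤ 2 := by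
  have h : ∀ N : ℕ, ∑ i ∈ Finset.range (N + 1), ((i : ℝ) + 1)⁻¹ ^ 2 ≤ 2 - ((N : ℝ) + 1)⁻¹ := by
    intro N
    induction N with
    | zero => norm_num
    | succ N ih =>
      rw [Finset.sum_range_succ]
      have : ((N + 1 : ℕ) + 1 : ℝ)⁻¹ ^ 2 ≤ ((N : ℝ) + 1)⁻¹ - ((N + 1 : ℕ) + 1 : ℝ)⁻¹ := by
        push_cast
        rw [inv_sub_inv (by positivity) (by positivity), inv_pow, inv_eq_one_div]
        rw [div_le_div_iff₀ (by positivity) (by positivity)]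
        nlinarith [(Nat.cast_nonneg N : (0 : ℝ) ≤ N)]
      linarith
  cases N with
  | zero => norm_num
  | succ N => exact (h N).trans (by have : (0 : ℝ) ≤ ((N : ℝ) + 1)⁻¹ := by positivity
                                    linarith)

lemma sum_fin_inv_sq_le (N : ℕ) : ∑ i : Fin N, (((i : ℕ) : ℝ) + 1)⁻¹ ^ 2 ≤ 2 := by
  rw [Fin.sum_univ_eq_sum_range (fun i : ℕ => ((i : ℝ) + 1)⁻¹ ^ 2)]
  exact sum_range_inv_sq_le N

lemma exists_dual_basis {ι F : Type*} [Fintype ι] [DecidableEq ι] [NormedAddCommGroup F]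
    [InnerProductSpace ℝ F] (b : Module.Basis ι ℝ F) :
    ∃ b' : Module.Basis ι ℝ F, ∀ i j, inner ℝ (b i) (b' j) = if i = j then (1 : ℝ) else 0 := by
  have hB : (innerₗ F : LinearMap.BilinForm ℝ F).Nondegenerate := by
    refine ⟨fun x hx => ?_, fun x hx => ?_⟩
    · exact inner_self_eq_zero.1 (hx x)
    · exact inner_self_eq_zero.1 (hx x)
  refine ⟨LinearMap.BilinForm.dualBasis _ hB b, fun i j => ?_⟩
  have := LinearMap.BilinForm.apply_dualBasis_left hB b j i
  rw [real_inner_comm]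
  exact this

/-- The linear map with coordinates `w i (∑ j, u j * a j i)` and `t * u j`. -/
noncomputable def weightedMap {k N : ℕ} (a : Fin k → Fin N → ℝ) (w : Fin N → ℝ) (t : ℝ) :
    (Fin k → ℝ) →ₗ[ℝ] EuclideanSpace ℝ (Fin N ⊕ Fin k) where
  toFun u := WithLp.toLp 2 (Sum.elim (fun i => w i * ∑ j, u j * a j i) (fun j => t * u j))
  map_add' u v := by
    ext s
    rcases s with i | j
    · simp [add_mul, Finset.sum_add_distrib, mul_add]
    · simp [mul_add]
  map_smul' c u := by
    ext s
    rcases s with i | j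
    · simp only [Pi.smul_apply, smul_eq_mul, Sum.elim_inl, RingHom.id_apply, PiLp.smul_apply]
      rw [mul_left_comm, Finset.mul_sum _ _ c]
      simp only [mul_assoc]
    · simp [mul_left_comm]

lemma weightedMap_inl {k N : ℕ} (a : Fin k → Fin N → ℝ) (w : Fin N → ℝ) (t : ℝ) (u : Fin k → ℝ)
    (i : Fin N) : weightedMap a w t u (Sum.inl i) = w i * ∑ j, u j * a j i := rfl

lemma weightedMap_inr {k N : ℕ} (a : Fin k → Fin N → ℝ) (w : Fin N → ℝ) (t : ℝ) (u : Fin k → ℝ)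
    (j : Fin k) : weightedMap a w t u (Sum.inr j) = t * u j := rfl

lemma weightedMap_norm_sq {k N : ℕ} (a : Fin k → Fin N → ℝ) (w : Fin N → ℝ) (t : ℝ)
    (u : Fin k → ℝ) : ‖weightedMap a w t u‖ ^ 2 =
      ∑ i, (w i * ∑ j, u j * a j i) ^ 2 + ∑ j, (t * u j) ^ 2 := by
  rw [EuclideanSpace.norm_sq_eq, Fintype.sum_sum_type]
  simp only [Real.norm_eq_abs, sq_abs, weightedMap_inl, weightedMap_inr]

lemma weightedMap_injective {k N : ℕ} (a : Fin k → Fin N → ℝ) (w : Fin N → ℝ) {t : ℝ}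
    (ht : t ≠ 0) : Function.Injective (weightedMap a w t) := by
  intro u v h
  funext j
  have := congrArg (fun x : EuclideanSpace ℝ (Fin N ⊕ Fin k) => x (Sum.inr j)) h
  simpa [weightedMap_inr, ht] using this

/-- The double angle formula gives cos² x ≥ 1/2, and 1/√2 > 7/10. -/
lemma seven_tenths_le_cos {x : ℝ} (h1 : 0 ≤ Real.cos x) (h2 : 0 ≤ Real.cos (2 * x)) :
    7 / 10 ≤ Real.cos x := by
  rw [Real.cos_two_mul] at h2
  nlinarith

/-- This bounds the squared Hilbert–Schmidt norm of Φ Ψ⁻¹ in `exists_bounded_lift`: the weights of Φ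
and Ψ have quotients 25/(i+1) and 25/k, whence 625 · (2 + 1). The hypothesis on `q` is Bessel's
inequality for an orthonormal family. -/
lemma sum_weighted_sq_le {k N : ℕ} (hk : 1 ≤ k) {ρ : Type*} [Fintype ρ]
    (q : ρ → Fin N ⊕ Fin k → ℝ) (hq : ∀ s, ∑ r, q r s ^ 2 ≤ 1) :
    ∑ r, 625 * (∑ i : Fin N, (((i : ℕ) : ℝ) + 1)⁻¹ ^ 2 * q r (Sum.inl i) ^ 2 +
      ∑ j : Fin k, (k : ℝ)⁻¹ ^ 2 * q r (Sum.inr j) ^ 2) ≤ 1875 := by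
  have hk0 : (0 : ℝ) < k := by exact_mod_cast hk
  have hk1 : (1 : ℝ) ≤ k := by exact_mod_cast hk
  rw [← Finset.mul_sum, Finset.sum_add_distrib, Finset.sum_comm,
    Finset.sum_comm (t := (Finset.univ : Finset (Fin k)))]
  simp only [← Finset.mul_sum]
  have h2 : ∑ i : Fin N, (((i : ℕ) : ℝ) + 1)⁻¹ ^ 2 * ∑ r, q r (Sum.inl i) ^ 2 ≤ 2 := by
    refine le_trans (Finset.sum_le_sum fun i _ => ?_) (sum_fin_inv_sq_le N)
    exact mul_le_of_le_one_right (by positivity) (hq _)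
  have h4 : ∑ j : Fin k, ∑ r, q r (Sum.inr j) ^ 2 ≤ k := by
    refine (Finset.sum_le_sum fun j _ => hq _).trans ?_
    simp
  have h3 : (k : ℝ)⁻¹ ^ 2 * ∑ j : Fin k, ∑ r, q r (Sum.inr j) ^ 2 ≤ 1 := by
    calc _ ≤ (k : ℝ)⁻¹ ^ 2 * k := by gcongr
      _ = (k : ℝ)⁻¹ := by field_simp
      _ ≤ 1 := inv_le_one_of_one_le₀ hk1
  linarith

set_option maxHeartbeats 1000000 in
/-- If the character of `ℤᵏ` with phases `θ` has nonnegative real part at all integer vectors at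
which a rapidly decreasing family of functionals is small, then it lifts to a linear functional
controlled by these functionals. -/
theorem exists_bounded_lift (k N : ℕ) (hk : 1 ≤ k) (a : Fin k → Fin N → ℝ) (θ : Fin k → ℝ)
    (hθ : ∀ z : Fin k → ℤ,
      ∑ i, |∑ j, (z j : ℝ) * a j i| + ((k : ℝ) ^ 5)⁻¹ * ∑ j, |(z j : ℝ)| < 1 →
        0 ≤ Real.cos (2 * Real.pi * ∑ j, (z j : ℝ) * θ j)) :
    ∃ z : Fin k → ℤ, ∀ u : Fin k → ℝ, (∑ j, (θ j + z j) * u j) ^ 2 ≤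
      5625 * (∑ i : Fin N, (((i : ℕ) : ℝ) + 1) ^ 6 * (∑ j, u j * a j i) ^ 2 +
        ((k : ℝ) ^ 4)⁻¹ * ∑ j, u j ^ 2) := by
  have hk0 : (0 : ℝ) < k := by exact_mod_cast hk
  have hk1 : (1 : ℝ) ≤ k := by exact_mod_cast hk
  -- Φ embeds ℤᵏ as a lattice on which the Gaussian argument runs; Ψ has the larger weights and
  -- defines the final form. Each step from the hypothesis on `θ` to Φ and from Φ to Ψ costs a
  -- factor i+1 to be Hilbert–Schmidt. The coordinates with weight k⁻³ or k⁻² make the maps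
  -- injective.
  set Φ := weightedMap a (fun i => 25 * (((i : ℕ) : ℝ) + 1) ^ 2) (25 * ((k : ℝ) ^ 3)⁻¹) with hΦ
  set Ψ := weightedMap a (fun i => (((i : ℕ) : ℝ) + 1) ^ 3) (((k : ℝ) ^ 2)⁻¹) with hΨ
  have hΦi : Function.Injective Φ := weightedMap_injective a _ (by positivity)
  have hΨi : Function.Injective Ψ := weightedMap_injective a _ (by positivity)
  set F := LinearMap.range Φ with hF
  set e : (Fin k → ℝ) ≃ₗ[ℝ] F := LinearEquiv.ofInjective Φ hΦi with he
  set b : Module.Basis (Fin k) ℝ F := Module.Basis.ofEquivFun e.symm with hb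
  have hbe : ∀ u, cvec b u = e u := by
    intro u
    apply b.equivFun.injective
    rw [LinearEquiv.apply_symm_apply, hb, Module.Basis.equivFun_ofEquivFun,
      LinearEquiv.symm_apply_apply]
  have hbΦ : ∀ u, ((cvec b u : F) : EuclideanSpace ℝ (Fin N ⊕ Fin k)) = Φ u := fun u => by
    rw [hbe]; rfl
  obtain ⟨b', hd⟩ := exists_dual_basis b
  set o := stdOrthonormalBasis ℝ (LinearMap.range Ψ) with ho
  have hov : ∀ r, ∃ v, Ψ v = (o r : EuclideanSpace ℝ (Fin N ⊕ Fin k)) := fun r => (o r).2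
  choose v hv using hov
  set ε : Fin N ⊕ Fin k → EuclideanSpace ℝ (Fin N ⊕ Fin k) := fun s =>
    EuclideanSpace.single s 1 with hε
  -- The squares sum to at most (2 + 1)/36 = 1/12, below the 1/10 required of the test vectors.
  set c : Fin N ⊕ Fin k → ℝ := Sum.elim (fun i => 6⁻¹ * (((i : ℕ) : ℝ) + 1)⁻¹)
    (fun _ => 6⁻¹ * (k : ℝ)⁻¹) with hc
  set us : Fin N ⊕ Fin k → F := fun s => F.orthogonalProjectionOnto (c s • ε s) with hus
  have hinner : ∀ s (x : F), inner ℝ x (us s) = c s * (x : EuclideanSpace ℝ (Fin N ⊕ Fin k)) s := by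
    intro s x
    rw [hus]
    simp only [Submodule.inner_orthogonalProjectionOnto_eq_of_mem_left]
    simp [hε, inner_smul_right, EuclideanSpace.inner_single_right]
  have hun : ∑ s, ‖us s‖ ^ 2 ≤ 1 / 10 := by
    have h1 : ∀ s, ‖us s‖ ^ 2 ≤ c s ^ 2 := by
      intro s
      have h2 : ‖us s‖ ≤ ‖c s • ε s‖ := Submodule.norm_orthogonalProjectionOnto_apply_le _ _
      have h3 : ‖c s • ε s‖ = |c s| := by simp [hε, norm_smul]
      rw [h3] at h2
      rw [← sq_abs (c s)]
      gcongr
    refine (Finset.sum_le_sum fun s _ => h1 s).trans ?_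
    rw [Fintype.sum_sum_type]
    simp only [hc, Sum.elim_inl, Sum.elim_inr, mul_pow, ← Finset.mul_sum]
    have h4 := sum_fin_inv_sq_le N
    have h5 : ∑ _j : Fin k, ((k : ℝ)⁻¹) ^ 2 ≤ 1 := by
      rw [Finset.sum_const, Finset.card_univ, Fintype.card_fin, nsmul_eq_mul, sq, ← mul_assoc,
        mul_inv_cancel₀ hk0.ne', one_mul]
      exact inv_le_one_of_one_le₀ hk1
    nlinarith
  have hcos : ∀ z : Fin k → ℤ, ∑ s, inner ℝ (cvec b (intVec z)) (us s) ^ 2 ≤ 1 →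
      7 / 10 ≤ Real.cos (2 * Real.pi * ∑ i, (z i : ℝ) * θ i) := by
    intro z hz
    simp only [hinner, hbΦ] at hz
    rw [Fintype.sum_sum_type] at hz
    simp only [hΦ, weightedMap_inl, weightedMap_inr, hc, Sum.elim_inl, Sum.elim_inr, intVec] at hz
    set A : Fin N → ℝ := fun i => ∑ j, (z j : ℝ) * a j i with hA
    have e1 : ∑ i : Fin N, (6⁻¹ * (((i : ℕ) : ℝ) + 1)⁻¹ * (25 * (((i : ℕ) : ℝ) + 1) ^ 2 * A i)) ^ 2
        = (25 / 6) ^ 2 * ∑ i : Fin N, ((((i : ℕ) : ℝ) + 1) * |A i|) ^ 2 := by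
      rw [Finset.mul_sum]
      refine Finset.sum_congr rfl fun i _ => ?_
      rw [mul_pow (((i : ℕ) : ℝ) + 1), sq_abs]
      have : (((i : ℕ) : ℝ) + 1) ≠ 0 := by positivity
      field_simp
    have e2 : ∑ j : Fin k, (6⁻¹ * (k : ℝ)⁻¹ * (25 * ((k : ℝ) ^ 3)⁻¹ * (z j : ℝ))) ^ 2
        = (25 / 6) ^ 2 * (((k : ℝ) ^ 8)⁻¹ * ∑ j, |(z j : ℝ)| ^ 2) := by
      rw [Finset.mul_sum, Finset.mul_sum]
      refine Finset.sum_congr rfl fun i _ => ?_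
      rw [sq_abs]
      field_simp
    rw [e1, e2] at hz
    set X := ∑ i : Fin N, ((((i : ℕ) : ℝ) + 1) * |A i|) ^ 2 with hX
    set Y := ∑ j, |(z j : ℝ)| ^ 2 with hY
    have f1 : (∑ i, |A i|) ^ 2 ≤ 2 * X := by
      have h1 := Finset.sum_mul_sq_le_sq_mul_sq Finset.univ
        (fun i : Fin N => (((i : ℕ) : ℝ) + 1)⁻¹) (fun i => (((i : ℕ) : ℝ) + 1) * |A i|)
      have h2 : ∀ i : Fin N, (((i : ℕ) : ℝ) + 1)⁻¹ * ((((i : ℕ) : ℝ) + 1) * |A i|) = |A i| := by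
        intro i
        have : (((i : ℕ) : ℝ) + 1) ≠ 0 := by positivity
        field_simp
      simp only [h2] at h1
      refine h1.trans ?_
      exact mul_le_mul_of_nonneg_right (sum_fin_inv_sq_le N) (Finset.sum_nonneg fun _ _ => sq_nonneg _)
    have f2 : (((k : ℝ) ^ 5)⁻¹ * ∑ j, |(z j : ℝ)|) ^ 2 ≤ ((k : ℝ) ^ 8)⁻¹ * Y := by
      have h1 := sq_sum_le_card_mul_sum_sq (s := Finset.univ) (f := fun j => |(z j : ℝ)|)
      rw [Finset.card_univ, Fintype.card_fin] at h1
      have hY0 : 0 ≤ Y := Finset.sum_nonneg fun _ _ => sq_nonneg _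
      calc (((k : ℝ) ^ 5)⁻¹ * ∑ j, |(z j : ℝ)|) ^ 2 ≤ (((k : ℝ) ^ 5)⁻¹) ^ 2 * (k * Y) := by
            rw [mul_pow]; gcongr
        _ = (k : ℝ)⁻¹ * (((k : ℝ) ^ 8)⁻¹ * Y) := by field_simp
        _ ≤ 1 * (((k : ℝ) ^ 8)⁻¹ * Y) := by
            gcongr
            exact inv_le_one_of_one_le₀ hk1
        _ = _ := one_mul _
    set p := ∑ i, |A i| with hp
    set q := ((k : ℝ) ^ 5)⁻¹ * ∑ j, |(z j : ℝ)| with hq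
    have hp0 : 0 ≤ p := Finset.sum_nonneg fun _ _ => abs_nonneg _
    have hq0 : 0 ≤ q := mul_nonneg (by positivity) (Finset.sum_nonneg fun _ _ => abs_nonneg _)
    -- From (p+q)² ≤ 2p² + 2q² ≤ 4 · (6/25)² < 1/4. The bound 1/2 rather than 1 leaves room to apply
    -- the hypothesis to 2z as well.
    have hpq : p + q < 1 / 2 := by
      have hX0 : 0 ≤ X := Finset.sum_nonneg fun _ _ => sq_nonneg _
      nlinarith [sq_nonneg (p - q)]
    have c1 := hθ z (by linarith)
    have c2 := hθ (2 * z) (by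
      have h1 : ∀ i, ∑ j, ((2 * z) j : ℤ) * a j i = 2 * A i := by
        intro i
        rw [hA]
        simp [Finset.mul_sum, mul_assoc]
      have h2 : ∑ j, |(((2 * z) j : ℤ) : ℝ)| = 2 * ∑ j, |(z j : ℝ)| := by
        simp [Finset.mul_sum, abs_mul]
      simp only [h1, h2, abs_mul, ← Finset.mul_sum]
      rw [abs_two]
      linarith)
    refine seven_tenths_le_cos c1 ?_
    convert c2 using 2
    simp only [Pi.mul_apply, Pi.ofNat_apply, Int.cast_mul, Int.cast_ofNat, Finset.mul_sum]
    refine Finset.sum_congr rfl fun j _ => ?_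
    ring
  have hyn : ∑ r, ‖cvec b (v r)‖ ^ 2 ≤ 1875 := by
    have hon : Orthonormal ℝ (fun r => (o r : EuclideanSpace ℝ (Fin N ⊕ Fin k))) :=
      o.orthonormal.comp_linearIsometry (LinearMap.range Ψ).subtypeₗᵢ
    have hbes : ∀ s, ∑ r, (o r : EuclideanSpace ℝ (Fin N ⊕ Fin k)) s ^ 2 ≤ 1 := by
      intro s
      have := hon.sum_inner_products_le (ε s) (s := Finset.univ)
      simpa [hε, EuclideanSpace.inner_single_right] using this
    have h1 : ∀ r, ‖cvec b (v r)‖ ^ 2 = 625 * (∑ i : Fin N, (((i : ℕ) : ℝ) + 1)⁻¹ ^ 2 *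
        (o r : EuclideanSpace ℝ (Fin N ⊕ Fin k)) (Sum.inl i) ^ 2 +
        ∑ j : Fin k, (k : ℝ)⁻¹ ^ 2 * (o r : EuclideanSpace ℝ (Fin N ⊕ Fin k)) (Sum.inr j) ^ 2) := by
      intro r
      rw [show ‖cvec b (v r)‖ = ‖Φ (v r)‖ by rw [← hbΦ]; rfl, hΦ, weightedMap_norm_sq, mul_add, Finset.mul_sum, Finset.mul_sum]
      simp only [← hv, hΨ, weightedMap_inl, weightedMap_inr]
      congr 1
      · refine Finset.sum_congr rfl fun i _ => ?_
        have : (((i : ℕ) : ℝ) + 1) ≠ 0 := by positivity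
        field_simp
        ring
      · refine Finset.sum_congr rfl fun j _ => ?_
        field_simp
        ring
    simp only [h1]
    exact sum_weighted_sq_le hk _ hbes
  obtain ⟨z, hz⟩ := exists_short_coset_vector hd θ us (fun r => cvec b (v r)) (by norm_num) hun hyn hcos
  refine ⟨z, fun u => ?_⟩
  have hin : ∀ w : Fin k → ℝ, inner ℝ (cvec b' (θ + intVec z)) (cvec b w) = ∑ j, (θ j + z j) * w j := by
    intro w
    rw [real_inner_comm, inner_cvec hd]
    rfl
  simp only [hin] at hz
  set cf := fun r => inner ℝ (o r) (⟨Ψ u, u, rfl⟩ : LinearMap.range Ψ) with hcf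
  have hu : u = ∑ r, cf r • v r := by
    apply hΨi
    rw [map_sum]
    simp only [map_smul, hv]
    have := congrArg Subtype.val (o.sum_repr' (⟨Ψ u, u, rfl⟩ : LinearMap.range Ψ))
    simpa only [AddSubmonoidClass.coe_finsetSum, Submodule.coe_smul] using this.symm
  have hcn : ∑ r, cf r ^ 2 = ‖Ψ u‖ ^ 2 := by
    have := o.sum_sq_norm_inner_right (⟨Ψ u, u, rfl⟩ : LinearMap.range Ψ)
    simpa [hcf] using this
  have hΨn : ‖Ψ u‖ ^ 2 = ∑ i : Fin N, (((i : ℕ) : ℝ) + 1) ^ 6 * (∑ j, u j * a j i) ^ 2 +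
        ((k : ℝ) ^ 4)⁻¹ * ∑ j, u j ^ 2 := by
    rw [hΨ, weightedMap_norm_sq, Finset.mul_sum]
    congr 1
    · exact Finset.sum_congr rfl fun i _ => by ring
    · exact Finset.sum_congr rfl fun i _ => by field_simp
  -- Expanding u along the Ψ-orthonormal vectors and applying Cauchy–Schwarz turns the bound 3 ·
  -- 1875 = 5625 on the sum of squares into a bound by ‖Ψ u‖².
  have hlin : ∑ j, (θ j + z j) * u j = ∑ r, cf r * ∑ j, (θ j + z j) * v r j := by
    conv_lhs => rw [hu]
    simp only [Finset.sum_apply, Pi.smul_apply, smul_eq_mul, Finset.mul_sum]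
    rw [Finset.sum_comm]
    refine Finset.sum_congr rfl fun r _ => Finset.sum_congr rfl fun j _ => ?_
    ring
  rw [hlin, ← hΨn, ← hcn]
  refine (Finset.sum_mul_sq_le_sq_mul_sq _ _ _).trans ?_
  rw [mul_comm]
  refine mul_le_mul_of_nonneg_right (hz.trans (by norm_num)) (Finset.sum_nonneg fun _ _ => sq_nonneg _)

end Lift

/-! ### Auerbach bases -/

section Auerbach

/-- Cramer's rule: all other terms of the expansion of x repeat a basis vector and vanish. -/
lemma alternating_update_basis {ι Z : Type*} [Fintype ι] [DecidableEq ι] [AddCommGroup Z]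
    [Module ℝ Z] (f : Z [⋀^ι]→ₗ[ℝ] ℝ) (B : Module.Basis ι ℝ Z) (x : Z) (i : ι) :
    f (Function.update B i x) = B.repr x i * f B := by
  conv_lhs => rw [← B.sum_repr x]
  rw [AlternatingMap.map_update_sum]
  simp only [AlternatingMap.map_update_smul, smul_eq_mul]
  rw [Finset.sum_eq_single i]
  · rw [Function.update_eq_self]
  · intro j _ hj
    rw [AlternatingMap.map_update_self _ _ hj.symm, mul_zero]
  · simp

/-- Every finite-dimensional normed space has an Auerbach basis. -/
theorem exists_auerbach_basis (Z : Type*) [NormedAddCommGroup Z] [NormedSpace ℝ Z]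
    [FiniteDimensional ℝ Z] : ∃ v : Module.Basis (Fin (Module.finrank ℝ Z)) ℝ Z,
      (∀ i, ‖v i‖ ≤ 1) ∧ ∀ x i, |v.repr x i| ≤ ‖x‖ := by
  set n := Module.finrank ℝ Z
  set b := Module.finBasis ℝ Z
  have hK : IsCompact (Set.univ.pi fun _ : Fin n => Metric.closedBall (0 : Z) 1) :=
    isCompact_univ_pi fun _ => isCompact_closedBall _ _
  have hc : Continuous fun v : Fin n → Z => |b.det v| := by
    refine continuous_abs.comp ?_
    change Continuous fun v : Fin n → Z => (b.toMatrix v).det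
    refine Continuous.matrix_det ?_
    refine continuous_matrix fun i j => ?_
    simp only [Module.Basis.toMatrix_apply]
    exact (LinearMap.continuous_of_finiteDimensional (b.coord i)).comp (continuous_apply j)
  -- A maximiser of the volume: replacing one vector by a point of the unit ball multiplies the
  -- determinant by a coordinate, which therefore has absolute value at most 1.
  obtain ⟨v, hv, hmax⟩ := hK.exists_isMaxOn ⟨0, fun _ _ => by simp⟩ hc.continuousOn
  have hdet : b.det v ≠ 0 := by
    have h0 := hmax (show (fun i => ‖b i‖⁻¹ • b i) ∈ _ from fun i _ => by
      simp [norm_smul, inv_mul_cancel₀ (norm_ne_zero_iff.2 (b.ne_zero i))])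
    simp only [Set.mem_ofPred_eq] at h0
    rw [AlternatingMap.map_smul_univ, b.det_self] at h0
    have : 0 < |(∏ i, ‖b i‖⁻¹) • (1 : ℝ)| := by
      rw [abs_pos, smul_eq_mul, mul_one]
      exact Finset.prod_ne_zero_iff.2 fun i _ => inv_ne_zero (norm_ne_zero_iff.2 (b.ne_zero i))
    intro h
    rw [h, abs_zero] at h0
    linarith
  obtain ⟨hli, hsp⟩ := (Module.Basis.is_basis_iff_det b).2 (isUnit_iff_ne_zero.2 hdet)
  set B := Module.Basis.mk hli hsp.ge with hB
  have hBv : ⇑B = v := Module.Basis.coe_mk _ _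
  refine ⟨B, fun i => ?_, fun x i => ?_⟩
  · rw [hBv]
    simpa using hv i (Set.mem_univ i)
  · have key : ∀ x, ‖x‖ ≤ 1 → |B.repr x i| ≤ 1 := by
      intro x hx
      have h1 := hmax (show Function.update v i x ∈ _ from fun j _ => by
        rcases eq_or_ne j i with rfl | h
        · simpa using hx
        · simpa [h] using hv j (Set.mem_univ j))
      simp only [Set.mem_ofPred_eq] at h1
      rw [← hBv, alternating_update_basis, abs_mul, hBv] at h1
      exact le_of_mul_le_mul_right (by simpa using h1) (abs_pos.2 hdet)
    rcases eq_or_ne x 0 with rfl | hx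
    · simp
    · have := key (‖x‖⁻¹ • x) (by
        rw [norm_smul, norm_inv, norm_norm, inv_mul_cancel₀ (norm_ne_zero_iff.2 hx)])
      rw [map_smul, Finsupp.smul_apply, smul_eq_mul, abs_mul, abs_inv, abs_norm] at this
      rwa [inv_mul_le_iff₀ (norm_pos_iff.2 hx), mul_one] at this

/-- Auerbach families for seminorms on finite-dimensional subspaces. -/
theorem exists_auerbach_family {E : Type*} [AddCommGroup E] [Module ℝ E] (g : Seminorm ℝ E)
    (F : Submodule ℝ E) [FiniteDimensional ℝ F] {r : ℕ} (hr : Module.finrank ℝ F ≤ r) :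
    ∃ e : Fin r → E, (∀ i, g (e i) ≤ 1) ∧ ∀ x ∈ F, ∃ a : Fin r → ℝ,
      (∀ i, |a i| ≤ g x) ∧ g (x - ∑ i, a i • e i) = 0 := by
  -- Vectors of seminorm zero are divided out, an Auerbach basis of the quotient is lifted back, and
  -- the family is padded with zeros to length r.
  let _ : SeminormedAddCommGroup F :=
    AddGroupSeminorm.toSeminormedAddCommGroup (g.comp F.subtype).toAddGroupSeminorm
  have hnorm : ∀ x : F, ‖x‖ = g x := fun x => rfl
  let _ : NormedSpace ℝ F := ⟨fun c x => by
    rw [hnorm, hnorm, Submodule.coe_smul, map_smul_eq_mul]⟩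
  let mk : F →ₗ[ℝ] SeparationQuotient F := SeparationQuotient.mkCLM ℝ F
  have hmk : Function.Surjective mk := SeparationQuotient.surjective_mk
  have hmkn : ∀ x, ‖mk x‖ = g x := fun x => SeparationQuotient.norm_mk x
  have : FiniteDimensional ℝ (SeparationQuotient F) := FiniteDimensional.of_surjective mk hmk
  set n := Module.finrank ℝ (SeparationQuotient F)
  obtain ⟨v, hv1, hv2⟩ : ∃ v : Module.Basis (Fin n) ℝ (SeparationQuotient F),
      (∀ i, ‖v i‖ ≤ 1) ∧ ∀ x i, |v.repr x i| ≤ ‖x‖ := exists_auerbach_basis _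
  have hn : n ≤ r := (LinearMap.finrank_le_finrank_of_surjective hmk).trans hr
  choose w hw using fun i => hmk (v i)
  refine ⟨fun i => if h : (i : ℕ) < n then w ⟨i, h⟩ else 0, fun i => ?_, fun x hx => ?_⟩
  · dsimp only
    split_ifs with h
    · rw [← hmkn, hw]; exact hv1 _
    · simp
  · refine ⟨fun i => if h : (i : ℕ) < n then v.repr (mk ⟨x, hx⟩) ⟨i, h⟩ else 0, fun i => ?_, ?_⟩
    · dsimp only
      split_ifs with h
      · refine (hv2 _ _).trans ?_
        rw [hmkn]
      · simp
    · have hsum : ∑ i : Fin r, (if h : (i : ℕ) < n then v.repr (mk ⟨x, hx⟩) ⟨i, h⟩ else 0) •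
          (if h : (i : ℕ) < n then (w ⟨i, h⟩ : E) else 0) =
          ((∑ i : Fin n, v.repr (mk ⟨x, hx⟩) i • w i : F) : E) := by
        set f : ℕ → E := fun i =>
          if h : i < n then v.repr (mk ⟨x, hx⟩) ⟨i, h⟩ • (w ⟨i, h⟩ : E) else 0 with hf
        have h1 : ∀ i : Fin r, (if h : (i : ℕ) < n then v.repr (mk ⟨x, hx⟩) ⟨i, h⟩ else 0) •
          (if h : (i : ℕ) < n then (w ⟨i, h⟩ : E) else 0) = f i := by
          intro i
          simp only [hf]
          split_ifs <;> simp
        have h2 : ∀ i : Fin n, v.repr (mk ⟨x, hx⟩) i • (w i : E) = f i := by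
          intro i
          simp only [hf, i.2, dif_pos, Fin.eta]
        simp only [h1, AddSubmonoidClass.coe_finsetSum, Submodule.coe_smul, h2]
        rw [Fin.sum_univ_eq_sum_range, Fin.sum_univ_eq_sum_range]
        refine (Finset.sum_subset (Finset.range_subset_range.2 hn) fun i _ hi => ?_).symm
        simp only [hf]
        rw [dif_neg (by simpa using hi)]
      rw [hsum]
      have := hmkn (⟨x, hx⟩ - ∑ i : Fin n, v.repr (mk ⟨x, hx⟩) i • w i)
      rw [map_sub, map_sum] at this
      simp only [map_smul, hw, v.sum_repr, sub_self, norm_zero] at this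
      exact this.symm

end Auerbach

/-! ### Series representations from Kolmogoroff numbers -/

section Series

/-- The index of the first term of the `n`-th block. -/
def blockStart (n : ℕ) : ℕ := 3 * (2 ^ n - 1)

/-- The block to which an index belongs. -/
def blockOf (i : ℕ) : ℕ := Nat.log 2 (i / 3 + 1)

lemma blockStart_succ (n : ℕ) : blockStart (n + 1) = blockStart n + 3 * 2 ^ n := by
  have := Nat.one_le_two_pow (n := n)
  simp only [blockStart, pow_succ]
  omega

lemma blockOf_add (n j : ℕ) (hj : j < 3 * 2 ^ n) : blockOf (blockStart n + j) = n := by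
  have := Nat.one_le_two_pow (n := n)
  have h : blockStart n + j = 3 * (2 ^ n - 1) + j := rfl
  refine Nat.log_eq_of_pow_le_of_lt_pow ?_ ?_
  · omega
  · rw [pow_succ]; omega

lemma lt_six_mul_two_pow_blockOf (i : ℕ) : i + 1 ≤ 6 * 2 ^ blockOf i := by
  have : i / 3 + 1 < 2 ^ (blockOf i + 1) := Nat.lt_pow_succ_log_self (by norm_num) _
  rw [pow_succ] at this
  omega

variable {E : Type*} [AddCommGroup E] [Module ℝ E]

/-- Approximate x by l n ∈ L n and telescope. The difference l (n+1) - l n lies in L n ⊔ L (n+1), of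
dimension below 2ⁿ + 2ⁿ⁺¹ = 3 · 2ⁿ, which is the block length; an Auerbach family there bounds the
coefficients by the size of the difference. The sum starts at 0 because L 0 has dimension less than
1. -/
theorem exists_block_series (g : Seminorm ℝ E) (X : Set E) (t : ℕ → ℝ) (L : ℕ → Submodule ℝ E)
    (hfin : ∀ n, FiniteDimensional ℝ (L n)) (hL : ∀ n, Module.finrank ℝ (L n) < 2 ^ n)
    (hX : ∀ n, ∀ x ∈ X, ∃ l ∈ L n, g (x - l) ≤ t n) :
    ∃ e : ℕ → E, (∀ i, g (e i) ≤ 1) ∧ ∀ x ∈ X, ∃ a : ℕ → ℝ,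
      (∀ i, |a i| ≤ t (blockOf i) + t (blockOf i + 1)) ∧
      ∀ n, g (x - ∑ i ∈ Finset.range (blockStart n), a i • e i) ≤ t n := by
  have haf : ∀ n, ∃ e : ℕ → E, (∀ i, g (e i) ≤ 1) ∧ ∀ x ∈ L n ⊔ L (n + 1), ∃ a : ℕ → ℝ,
      (∀ i, |a i| ≤ g x) ∧ g (x - ∑ i ∈ Finset.range (3 * 2 ^ n), a i • e i) = 0 := by
    intro n
    have hr : Module.finrank ℝ (L n ⊔ L (n + 1) : Submodule ℝ E) ≤ 3 * 2 ^ n := by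
      have h1 := Submodule.finrank_add_le_finrank_add_finrank (L n) (L (n + 1))
      have h2 := hL n
      have h3 := hL (n + 1)
      rw [pow_succ] at h3
      omega
    obtain ⟨e, he, h⟩ := exists_auerbach_family g (L n ⊔ L (n + 1)) hr
    refine ⟨fun i => if h : i < 3 * 2 ^ n then e ⟨i, h⟩ else 0, fun i => ?_, fun x hx => ?_⟩
    · dsimp only
      split_ifs
      · exact he _
      · simp
    · obtain ⟨a, ha, hs⟩ := h x hx
      refine ⟨fun i => if h : i < 3 * 2 ^ n then a ⟨i, h⟩ else 0, fun i => ?_, ?_⟩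
      · dsimp only
        split_ifs
        · exact ha _
        · simp
      · rw [Finset.sum_range]
        simpa using hs
  choose eF heF hF using haf
  refine ⟨fun i => eF (blockOf i) (i - blockStart (blockOf i)), fun i => heF _ _, fun x hx => ?_⟩
  choose l hl hgl using fun n => hX n x hx
  have hd : ∀ n, l (n + 1) - l n ∈ L n ⊔ L (n + 1) := fun n =>
    Submodule.sub_mem _ (Submodule.mem_sup_right (hl _)) (Submodule.mem_sup_left (hl _))
  have hgd : ∀ n, g (l (n + 1) - l n) ≤ t n + t (n + 1) := by
    intro n
    have h1 : l (n + 1) - l n = (x - l n) - (x - l (n + 1)) := by abel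
    rw [h1]
    exact (map_sub_le_add g _ _).trans (add_le_add (hgl n) (hgl (n + 1)))
  choose aF haF hsF using fun n => hF n _ (hd n)
  refine ⟨fun i => aF (blockOf i) (i - blockStart (blockOf i)), fun i => (haF _ _).trans (hgd _), ?_⟩
  have key : ∀ n, g (l n - ∑ i ∈ Finset.range (blockStart n),
      aF (blockOf i) (i - blockStart (blockOf i)) • eF (blockOf i) (i - blockStart (blockOf i))) = 0 := by
    intro n
    induction n with
    | zero =>
      have h0 := hL 0
      have h1 : L 0 = ⊥ := Submodule.finrank_eq_zero.1 (by simpa using h0)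
      have h2 : l 0 = 0 := by
        have := hl 0
        rwa [h1, Submodule.mem_bot] at this
      simp [h2, blockStart]
    | succ n ih =>
      rw [blockStart_succ, Finset.sum_range_add]
      have h1 : ∑ j ∈ Finset.range (3 * 2 ^ n),
          aF (blockOf (blockStart n + j)) (blockStart n + j - blockStart (blockOf (blockStart n + j))) •
          eF (blockOf (blockStart n + j)) (blockStart n + j - blockStart (blockOf (blockStart n + j))) =
          ∑ j ∈ Finset.range (3 * 2 ^ n), aF n j • eF n j := by
        refine Finset.sum_congr rfl fun j hj => ?_
        rw [blockOf_add n j (Finset.mem_range.1 hj), Nat.add_sub_cancel_left]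
      rw [h1]
      refine le_antisymm ?_ (apply_nonneg g _)
      set S := ∑ i ∈ Finset.range (blockStart n),
        aF (blockOf i) (i - blockStart (blockOf i)) • eF (blockOf i) (i - blockStart (blockOf i))
      set D := ∑ j ∈ Finset.range (3 * 2 ^ n), aF n j • eF n j
      have h2 : l (n + 1) - (S + D) = (l n - S) + (l (n + 1) - l n - D) := by abel
      rw [h2]
      refine (map_add_le_add g _ _).trans ?_
      rw [ih, hsF n, add_zero]
  intro n
  set S := ∑ i ∈ Finset.range (blockStart n),
    aF (blockOf i) (i - blockStart (blockOf i)) • eF (blockOf i) (i - blockStart (blockOf i)) with hS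
  have h1 : x - S = (x - l n) + (l n - S) := by abel
  change g (x - S) ≤ t n
  rw [h1]
  refine (map_add_le_add g _ _).trans ?_
  rw [key n, add_zero]
  exact hgl n

lemma zero_mem_of_symm_convex {Y : Set E} (hs : IsSymm Y) (hc : Convex ℝ Y) (hn : Y.Nonempty) :
    (0 : E) ∈ Y := by
  obtain ⟨y, hy⟩ := hn
  have := hc hy (hs y hy) (show (0 : ℝ) ≤ 1 / 2 by norm_num) (show (0 : ℝ) ≤ 1 / 2 by norm_num)
    (by norm_num)
  simpa using this

lemma smul_subset_smul_of_le {Y : Set E} (hc : Convex ℝ Y) (h0 : (0 : E) ∈ Y) {s t : ℝ}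
    (hs : 0 ≤ s) (hst : s ≤ t) : s • Y ⊆ t • Y := by
  rintro _ ⟨y, hy, rfl⟩
  rcases (hs.trans hst).eq_or_lt with h | h
  · have : s = 0 := le_antisymm (h ▸ hst) hs
    subst this
    exact ⟨0, h0, by simp⟩
  · refine ⟨(s / t) • y, ?_, ?_⟩
    · exact hc.smul_mem_of_zero_mem h0 hy ⟨by positivity, (div_le_one h).2 hst⟩
    · simp only [smul_smul]
      rw [mul_div_cancel₀ _ h.ne']

/-- A linear combination of elements of a symmetric convex set lies in the corresponding multiple
of the set. -/
lemma sum_smul_mem {Y : Set E} (hs : IsSymm Y) (hc : Convex ℝ Y) (h0 : (0 : E) ∈ Y) {ι : Type*}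
    (s : Finset ι) (c : ι → ℝ) (y : ι → E) (hy : ∀ i ∈ s, y i ∈ Y) :
    ∑ i ∈ s, c i • y i ∈ (∑ i ∈ s, |c i|) • Y := by
  classical
  induction s using Finset.induction_on with
  | empty => exact ⟨0, h0, by simp⟩
  | insert i s hi ih =>
    rw [Finset.sum_insert hi, Finset.sum_insert hi,
      hc.add_smul (abs_nonneg _) (Finset.sum_nonneg fun _ _ => abs_nonneg _)]
    refine Set.add_mem_add ?_ (ih fun j hj => hy j (Finset.mem_insert_of_mem hj))
    have hyi := hy i (Finset.mem_insert_self _ _)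
    rcases abs_cases (c i) with ⟨h, _⟩ | ⟨h, _⟩
    · rw [h]; exact ⟨_, hyi, rfl⟩
    · rw [h]; exact ⟨-y i, hs _ hyi, by simp⟩

/-- The gauge of a symmetric convex set on its span. -/
lemma exists_gauge_on_span {Y : Set E} (hs : IsSymm Y) (hc : Convex ℝ Y) (h0 : (0 : E) ∈ Y) :
    ∃ g : Seminorm ℝ (Submodule.span ℝ Y),
      (∀ y : Submodule.span ℝ Y, ∀ t : ℝ, 0 ≤ t → (y : E) ∈ t • Y → g y ≤ t) ∧
      ∀ y : Submodule.span ℝ Y, ∀ t : ℝ, g y < t → (y : E) ∈ t • Y := by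
  set Y' : Set (Submodule.span ℝ Y) := Subtype.val ⁻¹' Y with hY'
  have hc' : Convex ℝ Y' := hc.linear_preimage (Submodule.span ℝ Y).subtype
  have h0' : (0 : Submodule.span ℝ Y) ∈ Y' := h0
  have hsm : ∀ (t : ℝ) (y : Submodule.span ℝ Y), (y : E) ∈ t • Y ↔ y ∈ t • Y' := by
    intro t y
    constructor
    · rintro ⟨z, hz, h⟩
      refine ⟨⟨z, Submodule.subset_span hz⟩, hz, Subtype.ext h⟩
    · rintro ⟨z, hz, h⟩
      exact ⟨z, hz, congrArg Subtype.val h⟩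
  have hbal : Balanced ℝ Y' := by
    intro a ha
    rintro _ ⟨y, hy, rfl⟩
    have hm : |a| • (y : E) ∈ Y := hc.smul_mem_of_zero_mem h0 hy ⟨abs_nonneg a, ha⟩
    change a • (y : E) ∈ Y
    rcases abs_cases a with ⟨h, _⟩ | ⟨h, _⟩
    · rwa [h] at hm
    · rw [h] at hm
      simpa using hs _ hm
  have hspan : ∀ x ∈ Submodule.span ℝ Y, ∃ r : ℝ, 0 ≤ r ∧ x ∈ r • Y := by
    intro x hx
    obtain ⟨c, s, hsY, -, rfl⟩ := Submodule.mem_span_iff_exists_finset_subset.1 hx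
    exact ⟨_, Finset.sum_nonneg fun _ _ => abs_nonneg _,
      sum_smul_mem hs hc h0 s c id fun i hi => hsY hi⟩
  have habs : Absorbent ℝ Y' := by
    intro x
    obtain ⟨r, hr, hx⟩ := hspan x x.2
    refine Absorbs.of_norm ⟨r, fun a ha => ?_⟩
    rw [Set.singleton_subset_iff]
    have h1 : x ∈ |a| • Y' := smul_subset_smul_of_le hc' h0' hr ha ((hsm r x).1 hx)
    rcases abs_cases a with ⟨h, _⟩ | ⟨h, _⟩
    · rwa [h] at h1
    · rw [h] at h1
      obtain ⟨y, hy, rfl⟩ := h1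
      exact ⟨-y, hs _ hy, by simp⟩
  refine ⟨gaugeSeminorm hbal hc' habs, fun y t ht hy => ?_, fun y t ht => ?_⟩
  · exact gauge_le_of_mem ht ((hsm t y).1 hy)
  · obtain ⟨b, hb0, hbt, hb⟩ := exists_lt_of_gauge_lt habs (show gauge Y' y < t from ht)
    exact smul_subset_smul_of_le hc h0 hb0.le hbt.le ((hsm b y).2 hb)

lemma exists_of_kolmogorov_lt {k : ℕ} {X Y : Set E} {t : ℝ}
    (h : kolmogorov k X Y < ENNReal.ofReal t) : ∃ s : ℝ, 0 < s ∧ s < t ∧ ∃ L : Submodule ℝ E,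
      Module.rank ℝ L < (k : Cardinal) ∧ X ⊆ s • Y + (L : Set E) := by
  obtain ⟨a, ⟨s, hs, rfl, L, hL, hX⟩, hlt⟩ := sInf_lt_iff.1 h
  exact ⟨s, hs, (ENNReal.ofReal_lt_ofReal_iff_of_nonneg hs.le).1 hlt, L, hL, hX⟩

/-- Sets with rapidly decreasing Kolmogoroff numbers have rapidly decreasing series
representations. -/
theorem exists_series_representation {X Y : Set E} (hs : IsSymm Y) (hc : Convex ℝ Y)
    (h0 : (0 : E) ∈ Y) {c : ℝ} (hcpos : 0 < c) {m : ℕ} (hm : 1 ≤ m)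
    (hd : ∀ k : ℕ, 1 ≤ k → kolmogorov k X Y ≤ rate c m k) :
    ∃ e : ℕ → E, (∀ i, e i ∈ Y) ∧ ∀ x ∈ X, ∃ a : ℕ → ℝ,
      (∀ i : ℕ, |a i| ≤ c * (8 * 6 ^ m) * (((i : ℝ) + 1) ^ m)⁻¹) ∧
      ∀ ε : ℝ, 0 < ε → ∀ᶠ n in atTop,
        x - ∑ i ∈ Finset.range (blockStart n), a i • e i ∈ ε • Y := by
  set V := Submodule.span ℝ Y with hV
  obtain ⟨g, hg1, hg2⟩ : ∃ g : Seminorm ℝ V,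
      (∀ y : V, ∀ t : ℝ, 0 ≤ t → (y : E) ∈ t • Y → g y ≤ t) ∧
      ∀ y : V, ∀ t : ℝ, g y < t → (y : E) ∈ t • Y := exists_gauge_on_span hs hc h0
  -- The factor 2 makes the bound strict, so that the infimum defining the Kolmogoroff number can be
  -- replaced by an actual subspace.
  set t : ℕ → ℝ := fun n => 2 * c * ((2 : ℝ) ^ n)⁻¹ ^ m with ht
  have htpos : ∀ n, 0 < t n := fun n => by positivity
  have hk : ∀ n, ∃ s : ℝ, 0 < s ∧ s < t n ∧ ∃ L : Submodule ℝ E,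
      Module.rank ℝ L < ((2 ^ n : ℕ) : Cardinal) ∧ X ⊆ s • Y + (L : Set E) := by
    intro n
    refine exists_of_kolmogorov_lt ((hd (2 ^ n) Nat.one_le_two_pow).trans_lt ?_)
    rw [rate, ENNReal.ofReal_lt_ofReal_iff (htpos n), zpow_neg, zpow_natCast]
    push_cast
    have : 0 < c * (((2 : ℝ) ^ n) ^ m)⁻¹ := by positivity
    simp only [ht, inv_pow]
    linarith
  choose s hs0 hst L hL hXL using hk
  have hYV : ∀ r : ℝ, ∀ y ∈ r • Y, y ∈ V := by
    rintro r _ ⟨y, hy, rfl⟩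
    exact V.smul_mem r (Submodule.subset_span hy)
  have hXV : ∀ x ∈ X, x ∈ V := by
    intro x hx
    obtain ⟨y, hy, l, hl, rfl⟩ := Set.mem_add.1 (hXL 0 hx)
    have h1 : L 0 = ⊥ := by
      have := hL 0
      rw [pow_zero, Nat.cast_one, Cardinal.lt_one_iff] at this
      exact Submodule.rank_eq_zero.1 this
    have h2 : l = 0 := by
      rw [h1] at hl
      exact hl
    rw [h2, add_zero]
    exact hYV _ _ hy
  set L' : ℕ → Submodule ℝ V := fun n => (L n).comap V.subtype with hL'
  have hrank : ∀ n, Module.rank ℝ (L' n) < ((2 ^ n : ℕ) : Cardinal) := by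
    intro n
    refine lt_of_le_of_lt ?_ (hL n)
    refine LinearMap.rank_le_of_injective (V.subtype.restrict (p := L' n) (q := L n) fun x hx => hx) ?_
    intro x y h
    exact Subtype.ext (Subtype.ext (congrArg (fun v : L n => (v : E)) h))
  have hfin : ∀ n, FiniteDimensional ℝ (L' n) := fun n =>
    Module.rank_lt_aleph0_iff.1 ((hrank n).trans (Cardinal.natCast_lt_aleph0))
  have hfr : ∀ n, Module.finrank ℝ (L' n) < 2 ^ n := by
    intro n
    have := hfin n
    have h := hrank n
    rw [← Module.finrank_eq_rank] at h
    exact_mod_cast h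
  obtain ⟨e, he, hrep⟩ := exists_block_series g (Subtype.val ⁻¹' X) t L' hfin hfr (by
    intro n x hx
    obtain ⟨y, hy, l, hl, h⟩ := Set.mem_add.1 (hXL n hx)
    have hlV : l ∈ V := by
      have : l = (x : E) - y := by rw [← h]; abel
      rw [this]
      exact V.sub_mem x.2 (hYV _ _ hy)
    refine ⟨⟨l, hlV⟩, hl, ?_⟩
    refine hg1 _ _ (htpos n).le (smul_subset_smul_of_le hc h0 (hs0 n).le (hst n).le ?_)
    have : ((x - ⟨l, hlV⟩ : V) : E) = y := by
      rw [Submodule.coe_sub, ← h]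
      simp
    rwa [this])
  -- Gauge at most 1 does not imply membership in Y, but gauge at most 1/2 does; the coefficients
  -- are doubled in return. Together with i + 1 ≤ 6 · 2ⁿ in block n this gives the constant 8 · 6ᵐ.
  refine ⟨fun i => (2⁻¹ : ℝ) • (e i : E), fun i => ?_, fun x hx => ?_⟩
  · have := hg2 ((2⁻¹ : ℝ) • e i) 1 (by
      rw [map_smul_eq_mul, Real.norm_of_nonneg (by norm_num)]
      linarith [he i])
    simpa using this
  · obtain ⟨a, ha, hr⟩ := hrep ⟨x, hXV x hx⟩ hx
    refine ⟨fun i => 2 * a i, fun i => ?_, fun ε hε => ?_⟩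
    · have hmono : t (blockOf i + 1) ≤ t (blockOf i) := by
        simp only [ht]
        gcongr
        · norm_num
        · omega
      have h1 : |2 * a i| ≤ 4 * t (blockOf i) := by
        rw [abs_mul, abs_two]
        linarith [ha i]
      refine h1.trans ?_
      have h2 : ((i : ℝ) + 1) ≤ 6 * 2 ^ blockOf i := by exact_mod_cast lt_six_mul_two_pow_blockOf i
      have h3 : ((2 : ℝ) ^ blockOf i)⁻¹ ≤ 6 * ((i : ℝ) + 1)⁻¹ := by
        rw [← div_eq_mul_inv, inv_le_comm₀ (by positivity) (by positivity), inv_div]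
        rw [div_le_iff₀ (by norm_num)]
        linarith
      calc 4 * t (blockOf i) = 8 * c * ((2 : ℝ) ^ blockOf i)⁻¹ ^ m := by simp only [ht]; ring
        _ ≤ 8 * c * (6 * ((i : ℝ) + 1)⁻¹) ^ m := by gcongr
        _ = _ := by rw [mul_pow, inv_pow]; ring
    · have hlim : Tendsto t atTop (𝓝 0) := by
        have h1 : Tendsto (fun n : ℕ => ((2 : ℝ)⁻¹ ^ m) ^ n) atTop (𝓝 0) :=
          tendsto_pow_atTop_nhds_zero_of_lt_one (by positivity)
            (pow_lt_one₀ (by norm_num) (by norm_num) (by omega))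
        have h2 := h1.const_mul (2 * c)
        rw [mul_zero] at h2
        refine h2.congr fun n => ?_
        simp only [ht, ← inv_pow, ← pow_mul, mul_comm]
      filter_upwards [hlim.eventually_lt_const hε] with n hn
      have := hg2 _ ε ((hr n).trans_lt hn)
      convert this using 1
      simp only [Submodule.coe_sub, AddSubmonoidClass.coe_finsetSum, Submodule.coe_smul, smul_smul]
      congr 1
      refine Finset.sum_congr rfl fun i _ => ?_
      congr 1
      ring

end Series

/-! ### Existence of admissible constants -/

section Hilbert

/-- The Hilbert space of square summable real sequences. -/
abbrev SqSum : Type := lp (fun _ : ℕ => ℝ) 2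

lemma sqSum_norm_le {b : SqSum} {C : ℝ} (hC : 0 ≤ C)
    (h : ∀ n : ℕ, ∑ i ∈ Finset.range n, b i ^ 2 ≤ C ^ 2) : ‖b‖ ≤ C := by
  refine lp.norm_le_of_forall_sum_le (by norm_num) hC fun s => ?_
  obtain ⟨n, hn⟩ := s.exists_nat_subset_range
  simp only [ENNReal.toReal_ofNat, Real.rpow_ofNat, Real.norm_eq_abs, sq_abs]
  exact (Finset.sum_le_sum_of_subset_of_nonneg hn fun _ _ _ => sq_nonneg _).trans (h n)

lemma sum_sq_le_sqSum_norm (b : SqSum) (n : ℕ) :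
    ∑ i ∈ Finset.range n, b i ^ 2 ≤ ‖b‖ ^ 2 := by
  have := lp.sum_rpow_le_norm_rpow (p := 2) (by norm_num) b (Finset.range n)
  simpa only [ENNReal.toReal_ofNat, Real.rpow_ofNat, Real.norm_eq_abs, sq_abs] using this

/-- A real sequence with bounded partial sums of squares, as an element of `SqSum`. -/
lemma exists_sqSum {f : ℕ → ℝ} {C : ℝ} (hC : 0 ≤ C)
    (h : ∀ n : ℕ, ∑ i ∈ Finset.range n, f i ^ 2 ≤ C ^ 2) : ∃ b : SqSum, (∀ i, b i = f i) ∧ ‖b‖ ≤ C := by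
  have hf : Memℓp (E := fun _ : ℕ => ℝ) f 2 := by
    refine memℓp_gen' (C := C ^ 2) fun s => ?_
    obtain ⟨n, hn⟩ := s.exists_nat_subset_range
    simp only [ENNReal.toReal_ofNat, Real.rpow_ofNat, Real.norm_eq_abs, sq_abs]
    exact (Finset.sum_le_sum_of_subset_of_nonneg hn fun _ _ _ => sq_nonneg _).trans (h n)
  exact ⟨⟨f, hf⟩, fun _ => rfl, sqSum_norm_le hC h⟩

/-- Bounded diagonal operators. -/
lemma exists_diagonal (d : ℕ → ℝ) (hd : ∀ i, |d i| ≤ 1) :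
    ∃ D : SqSum →L[ℝ] SqSum, ∀ b i, D b i = d i * b i := by
  have h1 : ∀ b : SqSum, ∃ b' : SqSum, (∀ i, b' i = d i * b i) ∧ ‖b'‖ ≤ ‖b‖ := fun b => by
    refine exists_sqSum (norm_nonneg b) fun n => le_trans ?_ (sum_sq_le_sqSum_norm b n)
    refine Finset.sum_le_sum fun i _ => ?_
    rw [mul_pow, ← sq_abs (d i)]
    exact mul_le_of_le_one_left (sq_nonneg _) (pow_le_one₀ (abs_nonneg _) (hd i))
  choose D hD hn using h1
  refine ⟨LinearMap.mkContinuous { toFun := D, map_add' := fun x y => ?_, map_smul' := fun r x => ?_ } 1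
    fun x => by simpa using hn x, fun b i => hD b i⟩
  · ext i
    simp only [lp.coeFn_add, Pi.add_apply, hD]
    ring
  · ext i
    simp only [lp.coeFn_smul, Pi.smul_apply, hD, RingHom.id_apply, smul_eq_mul]
    ring

variable {H H₂ : Type*} [NormedAddCommGroup H] [InnerProductSpace ℝ H]
  [NormedAddCommGroup H₂] [InnerProductSpace ℝ H₂]

lemma isPreHilbert_comp_norm {V : Type u} [AddCommGroup V] [Module ℝ V] (T : V →ₗ[ℝ] H) :
    IsPreHilbert ((normSeminorm ℝ H).comp T) := by
  intro x y
  have := parallelogram_law_with_norm ℝ (T x) (T y)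
  simp only [Seminorm.comp_apply, coe_normSeminorm, map_add, map_sub, pow_two] at this ⊢
  linarith

/-- The orthogonal projection onto the complement of N. It serves to divide out the ambiguity of
coefficient sequences. -/
lemma exists_contraction_killing [CompleteSpace H] (N : Submodule ℝ H) : ∃ P : H →L[ℝ] H,
    (∀ b ∈ N, P b = 0) ∧ (∀ b, ‖P b‖ ≤ ‖b‖) ∧ ∀ b, b - P b ∈ N.topologicalClosure := by
  refine ⟨Nᗮ.starProjection, fun b hb => (Submodule.starProjection_apply_eq_zero_iff _).2
    (Submodule.le_orthogonal_orthogonal N hb), Submodule.norm_starProjection_apply_le _, fun b => ?_⟩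
  rw [← Submodule.orthogonal_orthogonal_eq_closure]
  exact Submodule.sub_starProjection_mem_orthogonal b

/-- An operator that is small on a subspace of codimension at most `r` is small up to a subspace of
dimension at most `r`, even after restriction to a dense subspace. -/
lemma exists_finrank_le_approx [CompleteSpace H] {V : Type*} [AddCommGroup V] [Module ℝ V]
    (T : V →ₗ[ℝ] H) (S : H →L[ℝ] H₂) {r : ℕ} (F : H →L[ℝ] (Fin r → ℝ)) {ρ : ℝ}
    (hρ : ∀ b, F b = 0 → ‖S b‖ ≤ ρ * ‖b‖) (hρ0 : 0 ≤ ρ) {η : ℝ} (hη : 0 < η) :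
    ∃ L : Submodule ℝ V, Module.rank ℝ L ≤ r ∧
      ∀ x, ‖T x‖ ≤ 1 → ∃ l ∈ L, ‖S (T (x - l))‖ ≤ ρ + η := by
  set K : Submodule ℝ H := (LinearMap.range T).topologicalClosure with hK
  have hKc : CompleteSpace K :=
    (Submodule.isClosed_topologicalClosure _).completeSpace_coe
  set F' : K →L[ℝ] (Fin r → ℝ) := F.comp K.subtypeL with hF'
  set M : Submodule ℝ K := LinearMap.ker F'.toLinearMap with hM
  have hMclosed : IsClosed (M : Set K) := F'.isClosed_ker
  have hMc : CompleteSpace M := hMclosed.completeSpace_coe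
  have hinj : Function.Injective (F'.toLinearMap.comp Mᗮ.subtype) := by
    rw [← LinearMap.ker_eq_bot, Submodule.eq_bot_iff]
    intro w hw
    have hwM : (w : K) ∈ M := hw
    have := Submodule.inner_right_of_mem_orthogonal hwM w.2
    exact Subtype.ext (inner_self_eq_zero.1 this)
  have hfd : FiniteDimensional ℝ Mᗮ := Module.Finite.of_injective _ hinj
  have hfr : Module.finrank ℝ Mᗮ ≤ r := by
    simpa using LinearMap.finrank_le_finrank_of_injective hinj
  set v := stdOrthonormalBasis ℝ Mᗮ with hv
  set N := Module.finrank ℝ Mᗮ with hN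
  -- Replacing the N orthonormal vectors by elements of the range of T then changes the value of S
  -- by at most η.
  set δ : ℝ := η / ((‖S‖ + 1) * (N + 1)) with hδ
  have hδ0 : 0 < δ := by positivity
  have happ : ∀ i, ∃ y : V, ‖((v i : K) : H) - T y‖ < δ := by
    intro i
    have h1 : ((v i : K) : H) ∈ closure (LinearMap.range T : Set H) := (v i : K).2
    obtain ⟨_, ⟨y, rfl⟩, hy⟩ := Metric.mem_closure_iff.1 h1 δ hδ0
    exact ⟨y, by rwa [← dist_eq_norm]⟩
  choose y hy using happ
  refine ⟨Submodule.span ℝ (Set.range y), ?_, fun x hx => ?_⟩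
  · have : FiniteDimensional ℝ (Submodule.span ℝ (Set.range y)) :=
      FiniteDimensional.span_of_finite ℝ (Set.finite_range y)
    rw [← Module.finrank_eq_rank]
    have h1 : Module.finrank ℝ (Submodule.span ℝ (Set.range y)) ≤ _ := finrank_range_le_card y
    rw [Fintype.card_fin] at h1
    exact_mod_cast h1.trans hfr
  · set a : K := ⟨T x, Submodule.le_topologicalClosure _ ⟨x, rfl⟩⟩ with ha
    have hanorm : ‖a‖ ≤ 1 := hx
    obtain ⟨p, hp, w, hw, hpw⟩ := M.exists_add_mem_mem_orthogonal a
    have hpn : ‖p‖ ≤ 1 ∧ ‖w‖ ≤ 1 := by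
      have h1 : ‖a‖ ^ 2 = ‖p‖ ^ 2 + ‖w‖ ^ 2 := by
        rw [hpw, pow_two, pow_two, pow_two]
        exact norm_add_sq_eq_norm_sq_add_norm_sq_of_inner_eq_zero _ _
          (Submodule.inner_right_of_mem_orthogonal hp hw)
      have h2 : ‖a‖ ^ 2 ≤ 1 := pow_le_one₀ (norm_nonneg _) hanorm
      constructor
      · nlinarith [sq_nonneg ‖w‖, norm_nonneg p]
      · nlinarith [sq_nonneg ‖p‖, norm_nonneg w]
    set c : Fin N → ℝ := fun i => inner ℝ (v i) ⟨w, hw⟩ with hc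
    have hcb : ∀ i, |c i| ≤ 1 := by
      intro i
      refine (abs_real_inner_le_norm _ _).trans ?_
      rw [v.orthonormal.1 i, one_mul]
      exact hpn.2
    have hwsum : (w : H) = ∑ i, c i • ((v i : K) : H) := by
      have := congrArg (fun z : Mᗮ => ((z : K) : H)) (v.sum_repr' ⟨w, hw⟩)
      simp only [AddSubmonoidClass.coe_finsetSum, Submodule.coe_smul] at this
      exact this.symm
    refine ⟨∑ i, c i • y i, Submodule.sum_mem _ fun i _ => Submodule.smul_mem _ _
      (Submodule.subset_span ⟨i, rfl⟩), ?_⟩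
    have hT : T (x - ∑ i, c i • y i) = (p : H) + ∑ i, c i • (((v i : K) : H) - T (y i)) := by
      have h1 : T x = (p : H) + (w : H) := congrArg Subtype.val hpw
      rw [map_sub, h1, hwsum, map_sum]
      simp only [map_smul, smul_sub, Finset.sum_sub_distrib]
      abel
    rw [hT, map_add]
    refine (norm_add_le _ _).trans (add_le_add ?_ ?_)
    · refine (hρ _ hp).trans ?_
      exact mul_le_of_le_one_right hρ0 hpn.1
    · refine (S.le_opNorm _).trans ?_
      have h2 : ‖∑ i, c i • (((v i : K) : H) - T (y i))‖ ≤ N * δ := by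
        refine (norm_sum_le _ _).trans ?_
        have : ∀ i ∈ Finset.univ, ‖c i • (((v i : K) : H) - T (y i))‖ ≤ δ := by
          intro i _
          rw [norm_smul]
          calc _ ≤ 1 * δ := mul_le_mul (hcb i) (hy i).le (norm_nonneg _) zero_le_one
            _ = δ := one_mul _
        refine (Finset.sum_le_sum this).trans ?_
        simp
      calc ‖S‖ * _ ≤ (‖S‖ + 1) * ((N + 1) * δ) := by
            gcongr
            · linarith
            · refine h2.trans ?_
              gcongr
              linarith
        _ = η := by rw [hδ]; field_simp

variable {E : Type*} [AddCommGroup E] [Module ℝ E]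

lemma kolmogorov_le_of_forall_gt {k : ℕ} {X Y : Set E} {t : ℝ} (ht : 0 ≤ t)
    (h : ∀ s, t < s → ∃ L : Submodule ℝ E, Module.rank ℝ L < (k : Cardinal) ∧
      X ⊆ s • Y + (L : Set E)) : kolmogorov k X Y ≤ ENNReal.ofReal t := by
  refine ENNReal.le_of_forall_pos_le_add fun ε hε _ => ?_
  have hε' : (0 : ℝ) < ε := hε
  obtain ⟨L, hL, hX⟩ := h (t + ε) (by linarith)
  have h1 : kolmogorov k X Y ≤ ENNReal.ofReal (t + ε) :=
    sInf_le ⟨t + ε, by linarith, rfl, L, hL, hX⟩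
  refine h1.trans_eq ?_
  rw [ENNReal.ofReal_add ht hε'.le, ENNReal.ofReal_coe_nnreal]

/-- The linear relation between vectors and the coefficient sequences of their expansions. -/
lemma exists_expansion_relation {Y : Set E} (hs : IsSymm Y) (hc : Convex ℝ Y) (h0 : (0 : E) ∈ Y)
    (e : ℕ → E) (w : ℕ → ℝ) (σ : ℕ → ℕ) : ∃ R : Submodule ℝ (E × SqSum), ∀ x b, (x, b) ∈ R ↔
      ∀ ε : ℝ, 0 < ε → ∀ᶠ n in atTop,
        x - ∑ i ∈ Finset.range (σ n), (w i * b i) • e i ∈ ε • Y := by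
  refine ⟨{ carrier := {z | ∀ ε : ℝ, 0 < ε → ∀ᶠ n in atTop,
        z.1 - ∑ i ∈ Finset.range (σ n), (w i * z.2 i) • e i ∈ ε • Y}
            add_mem' := ?_, zero_mem' := ?_, smul_mem' := ?_ }, fun x b => Iff.rfl⟩
  · intro y z hy hz ε hε
    filter_upwards [hy (ε / 2) (by linarith), hz (ε / 2) (by linarith)] with n h1 h2
    have h3 := Set.add_mem_add h1 h2
    rw [← hc.add_smul (by linarith) (by linarith), add_halves] at h3
    convert h3 using 1
    simp only [Prod.fst_add, Prod.snd_add, lp.coeFn_add, Pi.add_apply, mul_add, add_smul,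
      Finset.sum_add_distrib]
    abel
  · intro ε _
    refine Eventually.of_forall fun n => ?_
    simpa using ⟨0, h0, smul_zero ε⟩
  · intro r z hz ε hε
    rcases eq_or_ne r 0 with rfl | hr
    · refine Eventually.of_forall fun n => ?_
      simpa using ⟨0, h0, smul_zero ε⟩
    · filter_upwards [hz (ε / |r|) (by positivity)] with n h1
      have h2 : r • (z.1 - ∑ i ∈ Finset.range (σ n), (w i * z.2 i) • e i) ∈ ε • Y := by
        obtain ⟨y, hy, h⟩ := h1
        rw [← h]
        rcases abs_cases r with ⟨h', _⟩ | ⟨h', _⟩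
        · refine ⟨y, hy, ?_⟩
          simp only [smul_smul, h']
          rw [mul_div_cancel₀ _ hr]
        · refine ⟨-y, hs y hy, ?_⟩
          simp only [smul_smul, h', smul_neg]
          rw [mul_div_assoc', mul_comm, div_neg, mul_div_assoc, div_self hr, mul_one, neg_smul]
      convert h2 using 1
      simp only [Prod.smul_fst, Prod.smul_snd, lp.coeFn_smul, Pi.smul_apply, smul_sub, Finset.smul_sum,
        smul_smul, smul_eq_mul]
      congr 1
      refine Finset.sum_congr rfl fun i _ => ?_
      ring_nf

/-- Weights controlling the `ℓ¹`-norm of `i ↦ b i / (i + 1)`. -/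
lemma sum_abs_mul_inv_le (b : SqSum) (n : ℕ) :
    ∑ i ∈ Finset.range n, |((i : ℝ) + 1)⁻¹ * b i| ≤ 2 * ‖b‖ := by
  have h1 := Finset.sum_mul_sq_le_sq_mul_sq (Finset.range n) (fun i : ℕ => ((i : ℝ) + 1)⁻¹)
    fun i => |b i|
  simp only [sq_abs] at h1
  have h2 := sum_range_inv_sq_le n
  have h3 := sum_sq_le_sqSum_norm b n
  have h4 : ∑ i ∈ Finset.range n, |((i : ℝ) + 1)⁻¹ * b i| =
      ∑ i ∈ Finset.range n, ((i : ℝ) + 1)⁻¹ * |b i| := by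
    refine Finset.sum_congr rfl fun i _ => ?_
    rw [abs_mul, abs_of_nonneg (by positivity)]
  rw [h4]
  refine abs_le_of_sq_le_sq' ?_ (by positivity) |>.2
  refine h1.trans ?_
  calc _ ≤ 2 * ‖b‖ ^ 2 := mul_le_mul h2 h3 (Finset.sum_nonneg fun _ _ => sq_nonneg _) (by norm_num)
    _ ≤ _ := by nlinarith [sq_nonneg ‖b‖]

/-- Write the coefficients of x ∈ X as w i * b i with b in the unit ball of ℓ². The weights split as
(i+1)⁻¹ · (i+1)⁻ⁿ: the second factor is the diagonal operator D, responsible for the decay, and the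
first makes the series absolutely convergent. The seminorms are ℓ²-norms of b and of D b modulo the
sequences that represent 0. -/
theorem isHilbertConst (n : ℕ) : IsHilbertConst.{u} (n + 2) (128 * (8 * 6 ^ (n + 2))) := by
  refine ⟨by positivity, fun E _ _ X Y _ hYne hXs hXc hYs hYc c hc hd => ?_⟩
  have h0 := zero_mem_of_symm_convex hYs hYc hYne
  obtain ⟨e, he, hrep⟩ := exists_series_representation hYs hYc h0 hc (by omega) hd
  set K : ℝ := 8 * 6 ^ (n + 2) with hK
  have hKpos : 0 < K := by positivity
  -- Against coefficients of size cK(i+1)^(-(n+2)) this leaves |b i| ≤ (i+1)⁻¹/2, so ‖b‖ ≤ 1.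
  set w : ℕ → ℝ := fun i => 2 * c * K * (((i : ℝ) + 1) ^ (n + 1))⁻¹ with hw
  obtain ⟨R, hR⟩ := exists_expansion_relation hYs hYc h0 e w blockStart
  obtain ⟨D, hD⟩ := exists_diagonal (fun i => (((i : ℝ) + 1) ^ n)⁻¹) fun i => by
    rw [abs_of_nonneg (by positivity)]
    exact inv_le_one_of_one_le₀ (one_le_pow₀ (by linarith [(Nat.cast_nonneg i : (0 : ℝ) ≤ i)]))
  set V := Submodule.span ℝ X with hV
  have hXR : ∀ x ∈ X, ∃ b : SqSum, (x, b) ∈ R ∧ ‖b‖ ≤ 1 := by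
    intro x hx
    obtain ⟨a, ha, hxa⟩ := hrep x hx
    obtain ⟨b, hb, hb1⟩ := exists_sqSum (f := fun i => a i / w i) (C := 1) zero_le_one fun N => by
      have h1 : ∀ i ∈ Finset.range N, (a i / w i) ^ 2 ≤ 1 / 4 * ((i : ℝ) + 1)⁻¹ ^ 2 := by
        intro i _
        have h2 : |a i / w i| ≤ 1 / 2 * ((i : ℝ) + 1)⁻¹ := by
          have hwi : 0 < w i := by positivity
          rw [abs_div, abs_of_pos hwi, div_le_iff₀ hwi]
          refine (ha i).trans_eq ?_
          simp only [hw]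
          field_simp
          ring
        calc _ = |a i / w i| ^ 2 := (sq_abs _).symm
          _ ≤ (1 / 2 * ((i : ℝ) + 1)⁻¹) ^ 2 := by gcongr
          _ = _ := by ring
      refine (Finset.sum_le_sum h1).trans ?_
      rw [← Finset.mul_sum]
      linarith [sum_range_inv_sq_le N]
    refine ⟨b, (hR x b).2 ?_, hb1⟩
    have h3 : ∀ i, w i * b i = a i := fun i => by
      have hwi : 0 < w i := by positivity
      rw [hb, mul_div_cancel₀ _ hwi.ne']
    simpa only [h3] using hxa
  set R' : Submodule ℝ (V × SqSum) := R.comap (V.subtype.prodMap LinearMap.id) with hR'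
  have hsurj : LinearMap.range ((LinearMap.fst ℝ V SqSum).comp R'.subtype) = ⊤ := by
    have hle : V ≤ R.map (LinearMap.fst ℝ E SqSum) := by
      refine Submodule.span_le.2 fun x hx => ?_
      obtain ⟨b, hb, -⟩ := hXR x hx
      exact ⟨(x, b), hb, rfl⟩
    rw [LinearMap.range_eq_top]
    intro x
    obtain ⟨⟨x', b⟩, hb, h⟩ := hle x.2
    have h' : x' = x := h
    subst h'
    exact ⟨⟨(x, b), hb⟩, rfl⟩
  obtain ⟨h, hh⟩ := LinearMap.exists_rightInverse_of_surjective _ hsurj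
  set s : V →ₗ[ℝ] SqSum := (LinearMap.snd ℝ V SqSum).comp (R'.subtype.comp h) with hs
  have hsR : ∀ x : V, ((x : E), s x) ∈ R := by
    intro x
    have h1 : (h x : V × SqSum).1 = x := LinearMap.congr_fun hh x
    have h2 : (((h x : V × SqSum).1 : E), (h x : V × SqSum).2) ∈ R := (h x).2
    rwa [h1] at h2
  -- The sequences representing 0. The section s is an arbitrary linear choice of coefficients, well
  -- determined only modulo N.
  set N : Submodule ℝ SqSum := R.comap (LinearMap.inr ℝ E SqSum) with hN
  have hNmem : ∀ (x : V) b, ((x : E), b) ∈ R → s x - b ∈ N := by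
    intro x b hb
    have := R.sub_mem (hsR x) hb
    change ((0 : E), s x - b) ∈ R
    simpa using this
  obtain ⟨P, hPN, hPle, hPcl⟩ := exists_contraction_killing N
  obtain ⟨Q, hQN', hQle, hQcl⟩ := exists_contraction_killing (N.map D.toLinearMap)
  have hQN : ∀ b ∈ N, Q (D b) = 0 := fun b hb => hQN' _ ⟨b, hb, rfl⟩
  have hQP : ∀ b, Q (D (P b)) = Q (D b) := by
    intro b
    have h1 := hPcl b
    have h2 : N.topologicalClosure ≤ LinearMap.ker (Q.comp D).toLinearMap :=
      Submodule.topologicalClosure_minimal _ hQN (Q.comp D).isClosed_ker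
    have h3 : Q (D (b - P b)) = 0 := h2 h1
    rw [map_sub, map_sub, sub_eq_zero] at h3
    exact h3.symm
  set T : V →ₗ[ℝ] SqSum := P.toLinearMap.comp s with hT
  -- If q(x) ≤ 1, some representing sequence b of x has ‖D b‖ ≤ 2/κ, so its weighted coefficients
  -- have absolute sum at most 2cK · 2 · 2/κ = 1/2. The remainder of the series supplies the other
  -- half of Y.
  set κ : ℝ := 16 * c * K with hκ
  have hκpos : 0 < κ := by positivity
  set S : SqSum →L[ℝ] SqSum := κ • (Q.comp D) with hS
  refine ⟨(normSeminorm ℝ SqSum).comp T, (normSeminorm ℝ SqSum).comp (S.toLinearMap.comp T),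
    isPreHilbert_comp_norm _, isPreHilbert_comp_norm _, ?_, ?_, ?_⟩
  · intro x hx
    refine ⟨⟨x, Submodule.subset_span hx⟩, ?_, rfl⟩
    obtain ⟨b, hb, hb1⟩ := hXR x hx
    rw [Seminorm.mem_closedBall_zero]
    have h1 := hPN _ (hNmem ⟨x, Submodule.subset_span hx⟩ b hb)
    rw [map_sub, sub_eq_zero] at h1
    change ‖P (s _)‖ ≤ 1
    rw [h1]
    exact (hPle b).trans hb1
  · rintro _ ⟨x, hx, rfl⟩
    rw [Seminorm.mem_closedBall_zero] at hx
    have hx' : ‖κ • Q (D (P (s x)))‖ ≤ 1 := hx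
    rw [hQP, norm_smul, Real.norm_of_nonneg hκpos.le] at hx'
    have h1 := hQcl (D (s x))
    obtain ⟨_, ⟨b, hb, rfl⟩, hbd⟩ := Metric.mem_closure_iff.1
      (show D (s x) - Q (D (s x)) ∈ closure (N.map D.toLinearMap : Set SqSum) from h1) κ⁻¹ (by positivity)
    have h2 : ‖D (s x - b)‖ ≤ 2 * κ⁻¹ := by
      have h3 : D (s x - b) = Q (D (s x)) + (D (s x) - Q (D (s x)) - D b) := by
        rw [map_sub]; abel
      rw [dist_eq_norm] at hbd
      have h4 : ‖Q (D (s x))‖ ≤ κ⁻¹ := by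
        rw [← one_div, le_div_iff₀ hκpos, mul_comm]
        exact hx'
      rw [h3]
      refine (norm_add_le _ _).trans ?_
      have h5 : ‖D (s x) - Q (D (s x)) - D b‖ < κ⁻¹ := hbd
      linarith
    have h3 : ((x : E), s x - b) ∈ R := by
      have h4 : ((0 : E), b) ∈ R := hb
      simpa using R.sub_mem (hsR x) h4
    obtain ⟨k, hk⟩ := ((hR _ _).1 h3 (1 / 2) (by norm_num)).exists
    have h5 := sum_smul_mem hYs hYc h0 (Finset.range (blockStart k)) (fun i => w i * (s x - b) i) e
      fun i _ => he i
    have h6 : ∑ i ∈ Finset.range (blockStart k), |w i * (s x - b) i| ≤ 1 / 2 := by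
      have h7 : ∀ i, |w i * (s x - b) i| = 2 * c * K * |((i : ℝ) + 1)⁻¹ * D (s x - b) i| := by
        intro i
        have h8 : w i * (s x - b) i = 2 * c * K * (((i : ℝ) + 1)⁻¹ * D (s x - b) i) := by
          rw [hD]
          simp only [hw, pow_succ, mul_inv]
          ring
        rw [h8, abs_mul, abs_of_nonneg (show 0 ≤ 2 * c * K by positivity)]
      simp only [h7, ← Finset.mul_sum]
      have h8 := sum_abs_mul_inv_le (D (s x - b)) (blockStart k)
      calc _ ≤ 2 * c * K * (2 * (2 * κ⁻¹)) := by gcongr; exact h8.trans (by linarith)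
        _ = 1 / 2 := by rw [hκ]; field_simp; norm_num
    have h7 := Set.add_mem_add hk (smul_subset_smul_of_le hYc h0
      (Finset.sum_nonneg fun _ _ => abs_nonneg _) h6 h5)
    rw [← hYc.add_smul (by norm_num) (by norm_num), add_halves, one_smul, sub_add_cancel] at h7
    exact h7
  · intro k hk
    have hexp : rate (c * (128 * K)) (((n + 2 : ℕ) : ℤ) - 2) k =
        ENNReal.ofReal (8 * κ * ((k : ℝ) ^ n)⁻¹) := by
      have : ((n + 2 : ℕ) : ℤ) - 2 = (n : ℤ) := by push_cast; ring
      rw [rate, this, zpow_neg, zpow_natCast, hκ]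
      congr 1
      ring
    rw [hexp]
    refine kolmogorov_le_of_forall_gt (by positivity) fun t ht => ?_
    have hk0 : (0 : ℝ) < k := by exact_mod_cast hk
    have hlt : κ * ((k : ℝ) ^ n)⁻¹ < t := lt_of_le_of_lt (by
      have : 0 < κ * ((k : ℝ) ^ n)⁻¹ := by positivity
      linarith) ht
    have htpos : 0 < t := lt_of_le_of_lt (by positivity) hlt
    -- Killing the first k - 1 coordinates keeps the dimension below k, and the surviving indices
    -- satisfy i + 1 ≥ k, where D is at most k⁻ⁿ.
    obtain ⟨L, hL, hL2⟩ := exists_finrank_le_approx T S (r := k - 1)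
      (ContinuousLinearMap.pi fun i : Fin (k - 1) => lp.evalCLM ℝ (fun _ : ℕ => ℝ) 2 i)
      (ρ := κ * ((k : ℝ) ^ n)⁻¹) (fun b hb => by
        have hb' : ∀ i, i + 1 < k → b i = 0 := fun i hi =>
          congrFun hb ⟨i, by omega⟩
        have h1 : ‖D b‖ ≤ ((k : ℝ) ^ n)⁻¹ * ‖b‖ := by
          refine sqSum_norm_le (by positivity) fun N => ?_
          have h2 : ∀ i ∈ Finset.range N, D b i ^ 2 ≤ ((k : ℝ) ^ n)⁻¹ ^ 2 * b i ^ 2 := by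
            intro i _
            rw [hD, mul_pow]
            rcases lt_or_ge (i + 1) k with hi | hi
            · simp [hb' i hi]
            · have : (k : ℝ) ≤ (i : ℝ) + 1 := by exact_mod_cast hi
              gcongr
          refine (Finset.sum_le_sum h2).trans ?_
          rw [← Finset.mul_sum, mul_pow]
          gcongr
          exact sum_sq_le_sqSum_norm b N
        change ‖κ • Q (D b)‖ ≤ _
        rw [norm_smul, Real.norm_of_nonneg hκpos.le, mul_assoc κ]
        exact mul_le_mul_of_nonneg_left ((hQle _).trans h1) hκpos.le) (by positivity)
      (η := t - κ * ((k : ℝ) ^ n)⁻¹) (by linarith)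
    refine ⟨L, lt_of_le_of_lt hL ?_, fun x hx => ?_⟩
    · exact_mod_cast (show k - 1 < k by omega)
    · rw [Seminorm.mem_closedBall_zero] at hx
      obtain ⟨l, hl, hxl⟩ := hL2 x hx
      refine Set.mem_add.2 ⟨x - l, ⟨t⁻¹ • (x - l), ?_, ?_⟩, l, hl, by abel⟩
      · rw [Seminorm.mem_closedBall_zero, map_smul_eq_mul, Real.norm_of_nonneg (by positivity),
          inv_mul_le_iff₀ htpos, mul_one]
        change ‖S (T (x - l))‖ ≤ t
        linarith
      · simp only [smul_smul]
        rw [mul_inv_cancel₀ htpos.ne', one_smul]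

end Hilbert

/-! ### Angles of characters -/

section Angle

variable {G : Type u} [AddCommGroup G]

/-- The representative in `(-1/2, 1/2]` of the value of a character with values in `ℝ/ℤ`. -/
noncomputable def angle (χ : AddChar G Circle) (w : G) : ℝ :=
  Complex.arg (χ w : Circle) / (2 * Real.pi)

lemma exp_angle (χ : AddChar G Circle) (w : G) :
    Circle.exp (2 * Real.pi * angle χ w) = χ w := by
  rw [angle, mul_div_cancel₀ _ (by positivity), Circle.exp_arg]

lemma abs_angle_le (χ : AddChar G Circle) (w : G) : |angle χ w| ≤ 1 / 2 := by
  rw [angle, abs_div, abs_of_pos (by positivity : 0 < 2 * Real.pi), div_le_iff₀ (by positivity)]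
  have := Complex.abs_arg_le_pi (χ w : Circle)
  linarith

lemma re_circle_exp (t : ℝ) : ((Circle.exp t : Circle) : ℂ).re = Real.cos t := by
  rw [Circle.coe_exp, Complex.exp_ofReal_mul_I_re]

lemma char_sum_zsmul (χ : AddChar G Circle) {ι : Type*} (s : Finset ι) (n : ι → ℤ) (w : ι → G) :
    χ (∑ j ∈ s, n j • w j) = Circle.exp (2 * Real.pi * ∑ j ∈ s, (n j : ℝ) * angle χ (w j)) := by
  classical
  induction s using Finset.induction_on with
  | empty => simp
  | insert j s hj ih =>
    rw [Finset.sum_insert hj, Finset.sum_insert hj, AddChar.map_add_eq_mul, ih, mul_add,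
      Circle.exp_add, AddChar.map_zsmul_eq_zpow, ← exp_angle χ (w j), ← Circle.exp_zsmul,
      zsmul_eq_mul, mul_left_comm]

lemma angle_eq_of_char_eq {χ : AddChar G Circle} {w : G} {t : ℝ} (ht : |t| < 1 / 2)
    (h : χ w = Circle.exp (2 * Real.pi * t)) : angle χ w = t := by
  have := abs_lt.1 ht
  have hpi := Real.pi_pos
  rw [angle, h, Circle.arg_exp (by nlinarith) (by nlinarith)]
  field_simp

/-- The cosine of 2πt is negative for 1/4 < |t| < 3/4, so a crude bound on t improves itself. -/
lemma abs_le_of_cos_nonneg {t : ℝ} (ht : |t| < 3 / 4) (h : 0 ≤ Real.cos (2 * Real.pi * t)) :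
    |t| ≤ 1 / 4 := by
  by_contra! h1
  have hpi := Real.pi_pos
  rw [← Real.cos_abs, abs_mul, abs_of_pos (by positivity : 0 < 2 * Real.pi)] at h
  exact absurd h (not_le.2 (Real.cos_neg_of_pi_div_two_lt_of_lt (by nlinarith) (by nlinarith)))

lemma cos_nonneg_of_abs_le {t : ℝ} (ht : |t| ≤ 1 / 4) : 0 ≤ Real.cos (2 * Real.pi * t) := by
  have := abs_le.1 ht
  have hpi := Real.pi_pos
  exact Real.cos_nonneg_of_neg_pi_div_two_le_of_le (by nlinarith) (by nlinarith)

lemma re_char_nonneg_iff (χ : AddChar G Circle) (w : G) :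
    0 ≤ ((χ w : Circle) : ℂ).re ↔ |angle χ w| ≤ 1 / 4 := by
  rw [← exp_angle, re_circle_exp]
  exact ⟨abs_le_of_cos_nonneg ((abs_angle_le χ w).trans_lt (by norm_num)), cos_nonneg_of_abs_le⟩

/-- The candidate (a+1)·angle is at most 1/4 + 1/4, too small to wrap around the circle, so it is
the true angle. -/
lemma angle_nsmul_succ {χ : AddChar G Circle} {w : G} {a : ℕ} (h1 : |angle χ w| ≤ 1 / 4)
    (ha : |a * angle χ w| ≤ 1 / 4) (h : |angle χ ((a + 1) • w)| ≤ 1 / 4) :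
    angle χ ((a + 1) • w) = (a + 1) * angle χ w ∧ |(a + 1) * angle χ w| ≤ 1 / 4 := by
  have hc : χ ((a + 1) • w) = Circle.exp (2 * Real.pi * ((a + 1) * angle χ w)) := by
    have := char_sum_zsmul χ {()} (fun _ => ((a + 1 : ℕ) : ℤ)) fun _ => w
    simpa [← natCast_zsmul] using this
  have h2 : |(a + 1) * angle χ w| ≤ 1 / 4 := by
    refine abs_le_of_cos_nonneg ?_ ?_
    · rw [add_mul, one_mul]
      exact (abs_add_le _ _).trans_lt (by linarith)
    · rw [← re_circle_exp, ← hc]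
      exact (re_char_nonneg_iff _ _).2 h
  exact ⟨angle_eq_of_char_eq (h2.trans_lt (by norm_num)) hc, h2⟩

lemma angle_nsmul {χ : AddChar G Circle} {w : G} {a : ℕ}
    (h : ∀ j ≤ a, |angle χ (j • w)| ≤ 1 / 4) :
    angle χ (a • w) = a * angle χ w ∧ |a * angle χ w| ≤ 1 / 4 := by
  induction a with
  | zero => simp [angle]
  | succ a ih =>
    have h1 := h 1 (by omega)
    rw [one_smul] at h1
    have := angle_nsmul_succ h1 (ih fun j hj => h j (by omega)).2 (h (a + 1) le_rfl)
    exact_mod_cast this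

lemma abs_angle_le_eighth {χ : AddChar G Circle} {w : G} (h1 : |angle χ w| ≤ 1 / 4)
    (h2 : |angle χ (2 • w)| ≤ 1 / 4) : |angle χ w| ≤ 1 / 8 := by
  have := (angle_nsmul_succ (a := 1) h1 (by simpa using h1) h2).2
  rw [abs_mul] at this
  norm_num at this
  linarith

lemma angle_neg {χ : AddChar G Circle} {w : G} (h : |angle χ w| ≤ 1 / 4) :
    angle χ (-w) = -angle χ w := by
  refine angle_eq_of_char_eq (by rw [abs_neg]; linarith) ?_
  rw [AddChar.map_neg_eq_inv, mul_neg, Circle.exp_neg, exp_angle]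

variable [TopologicalSpace G]

lemma mem_of_forall_polar {U : Set G} (hU : IsQuasiConvex U) {w : G}
    (h : ∀ χ ∈ polar U, |angle χ.1 w| ≤ 1 / 4) : w ∈ U := by
  rw [hU]
  exact fun χ hχ => (re_char_nonneg_iff _ _).2 (h χ hχ)

lemma abs_angle_le_of_mem {U : Set G} {w : G} (hw : w ∈ U) {χ : DualGroup G} (h : χ ∈ polar U) :
    |angle χ.1 w| ≤ 1 / 4 := (re_char_nonneg_iff _ _).1 (h w hw)

lemma IsQuasiConvex.neg_mem {U : Set G} (hU : IsQuasiConvex U) {w : G} (hw : w ∈ U) : -w ∈ U :=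
  mem_of_forall_polar hU fun χ hχ => by
    rw [angle_neg (abs_angle_le_of_mem hw hχ), abs_neg]
    exact abs_angle_le_of_mem hw hχ

lemma polar_anti {U V : Set G} (h : V ⊆ U) : polar U ⊆ polar V := fun _ hχ x hx => hχ x (h hx)

end Angle

/-! ### Pigeonhole arguments -/

section Pigeonhole

/-- Split at r. The first r terms are controlled by δ; beyond, (i+1)⁶ · (i+1)⁻¹⁸ = (i+1)⁻¹⁰ ·
(i+1)⁻² leaves a summable factor. -/
lemma sum_pow_six_mul_sq_le {N r : ℕ} {D : ℕ → ℝ} {M δ : ℝ}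
    (hM : ∀ i : ℕ, |D i| ≤ M * (((i : ℝ) + 1) ^ 9)⁻¹) (hδ : ∀ i < r, |D i| ≤ δ) :
    ∑ i ∈ Finset.range N, ((i : ℝ) + 1) ^ 6 * D i ^ 2 ≤
      (r : ℝ) ^ 7 * δ ^ 2 + 2 * M ^ 2 * (((r : ℝ) + 1) ^ 10)⁻¹ := by
  have h1 : ∀ i ∈ Finset.range N, ((i : ℝ) + 1) ^ 6 * D i ^ 2 ≤
      (if i < r then (r : ℝ) ^ 6 * δ ^ 2 else 0) +
        M ^ 2 * (((r : ℝ) + 1) ^ 10)⁻¹ * ((i : ℝ) + 1)⁻¹ ^ 2 := by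
    intro i _
    rw [← sq_abs (D i)]
    split_ifs with hi
    · have h2 : ((i : ℝ) + 1) ≤ r := by exact_mod_cast hi
      have h3 := hδ i hi
      have : ((i : ℝ) + 1) ^ 6 * |D i| ^ 2 ≤ (r : ℝ) ^ 6 * δ ^ 2 := by gcongr
      have : 0 ≤ M ^ 2 * (((r : ℝ) + 1) ^ 10)⁻¹ * ((i : ℝ) + 1)⁻¹ ^ 2 := by positivity
      linarith
    · have h2 : (r : ℝ) + 1 ≤ (i : ℝ) + 1 := by
        have : (r : ℝ) ≤ i := by exact_mod_cast not_lt.1 hi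
        linarith
      rw [zero_add]
      calc ((i : ℝ) + 1) ^ 6 * |D i| ^ 2
          ≤ ((i : ℝ) + 1) ^ 6 * (M * (((i : ℝ) + 1) ^ 9)⁻¹) ^ 2 := by
            gcongr
            exact hM i
        _ = M ^ 2 * (((i : ℝ) + 1) ^ 10)⁻¹ * ((i : ℝ) + 1)⁻¹ ^ 2 := by field_simp
        _ ≤ _ := by gcongr
  have hr : ∑ i ∈ Finset.range N, (if i < r then (r : ℝ) ^ 6 * δ ^ 2 else 0) ≤ (r : ℝ) ^ 7 * δ ^ 2 := by
    rw [← Finset.sum_filter, Finset.sum_const, nsmul_eq_mul]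
    have : ((Finset.range N).filter (· < r)).card ≤ r := by
      refine (Finset.card_le_card (t := Finset.range r) fun i hi => ?_).trans_eq (Finset.card_range r)
      exact Finset.mem_range.2 (Finset.mem_filter.1 hi).2
    have : (((Finset.range N).filter (· < r)).card : ℝ) ≤ r := by exact_mod_cast this
    calc _ ≤ (r : ℝ) * ((r : ℝ) ^ 6 * δ ^ 2) := by gcongr
      _ = _ := by ring
  refine (Finset.sum_le_sum h1).trans ?_
  rw [Finset.sum_add_distrib, ← Finset.mul_sum]
  refine add_le_add hr ?_
  calc _ ≤ M ^ 2 * (((r : ℝ) + 1) ^ 10)⁻¹ * 2 := by gcongr; exact sum_range_inv_sq_le N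
    _ = _ := by ring

lemma abs_sub_le_of_floor_eq {x y δ : ℝ} (hδ : 0 < δ) (h : ⌊x / δ⌋ = ⌊y / δ⌋) : |x - y| ≤ δ := by
  have := (Int.abs_sub_lt_one_of_floor_eq_floor h).le
  rwa [← sub_div, abs_div, abs_of_pos hδ, div_le_one hδ] at this

lemma floor_mem_Icc {x : ℝ} {B : ℕ} (h : |x| ≤ B) : ⌊x⌋ ∈ Finset.Icc (-(B : ℤ)) B := by
  rw [Finset.mem_Icc]
  have := abs_le.1 h
  exact ⟨Int.le_floor.2 (by push_cast; linarith), Int.floor_le_iff.2 (by push_cast; linarith)⟩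

/-- The boxes of coordinate floors. -/
noncomputable def floorBoxes (r B : ℕ) : Finset (Fin r → ℤ) :=
  Fintype.piFinset fun _ => Finset.Icc (-(B : ℤ)) B

lemma card_floorBoxes (r B : ℕ) : (floorBoxes r B).card = (2 * B + 1) ^ r := by
  simp only [floorBoxes, Fintype.card_piFinset, Int.card_Icc, Finset.prod_const, Finset.card_univ,
    Fintype.card_fin]
  congr 1
  omega

/-- Among families of rapidly decreasing sequences, a positive proportion lies in a small set. -/
lemma exists_large_class (K : ℝ) : ∃ N₀ : ℕ, ∀ (k N : ℕ) (a : Fin k → ℕ → ℝ),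
    (∀ j i, |a j i| ≤ K * (((i : ℝ) + 1) ^ 9)⁻¹) → ∃ I : Finset (Fin k), k ≤ N₀ * I.card ∧
      ∀ j ∈ I, ∀ l ∈ I, ∑ i ∈ Finset.range N, ((i : ℝ) + 1) ^ 6 * (a j i - a l i) ^ 2 ≤ 1 / 20000 := by
  -- The head contributes at most 1/160000 and the tail at most 1/50000, together below 1/20000.
  -- That target is chosen for the rigidity of the integers z_j in `exists_almost_dependent`.
  obtain ⟨r, hr⟩ := exists_nat_ge (400000 * K ^ 2)
  set δ : ℝ := (400 * ((r : ℝ) + 1) ^ 4)⁻¹ with hδ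
  have hδ0 : 0 < δ := by positivity
  obtain ⟨B, hB⟩ := exists_nat_ge (|K| / δ)
  refine ⟨(2 * B + 1) ^ r, fun k N a ha => ?_⟩
  have haK : ∀ j i, |a j i / δ| ≤ B := fun j i => by
    refine le_trans ?_ hB
    rw [abs_div, abs_of_pos hδ0]
    refine div_le_div_of_nonneg_right ((ha j i).trans ?_) hδ0.le
    have : (((i : ℝ) + 1) ^ 9)⁻¹ ≤ 1 := inv_le_one_of_one_le₀ (one_le_pow₀ (by linarith [(Nat.cast_nonneg i : (0:ℝ) ≤ i)]))
    calc _ ≤ |K| * (((i : ℝ) + 1) ^ 9)⁻¹ := by gcongr; exact le_abs_self K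
      _ ≤ |K| * 1 := by gcongr
      _ = _ := mul_one _
  set f : Fin k → Fin r → ℤ := fun j i => ⌊a j i / δ⌋ with hf
  have hmaps : ∀ j ∈ (Finset.univ : Finset (Fin k)), f j ∈ floorBoxes r B := fun j _ =>
    Fintype.mem_piFinset.2 fun i => floor_mem_Icc (haK j i)
  have hne : (floorBoxes r B).Nonempty := by
    rw [← Finset.card_pos, card_floorBoxes]
    positivity
  have hcard : ((2 * B + 1) ^ r : ℕ) ≠ 0 := by positivity
  obtain ⟨y, -, hy⟩ := Finset.exists_le_card_fiber_of_nsmul_le_card_of_maps_to (M := ℚ)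
    (b := (k : ℚ) / ((2 * B + 1) ^ r : ℕ)) hmaps hne (by
      rw [card_floorBoxes, Finset.card_univ, Fintype.card_fin, nsmul_eq_mul, mul_div_cancel₀]
      exact_mod_cast hcard)
  refine ⟨Finset.univ.filter fun j => f j = y, ?_, fun j hj l hl => ?_⟩
  · rw [div_le_iff₀ (by exact_mod_cast Nat.pos_of_ne_zero hcard)] at hy
    rw [mul_comm]
    exact_mod_cast hy
  · have h1 : f j = f l := (Finset.mem_filter.1 hj).2.trans (Finset.mem_filter.1 hl).2.symm
    refine (sum_pow_six_mul_sq_le (r := r) (M := 2 * K) (δ := δ) (fun i => ?_) fun i hi => ?_).trans ?_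
    · refine (abs_sub _ _).trans ?_
      linarith [ha j i, ha l i]
    · exact abs_sub_le_of_floor_eq hδ0 (congrFun h1 ⟨i, hi⟩)
    · have h2 : (r : ℝ) ^ 7 * δ ^ 2 ≤ 1 / 160000 := by
        have h3 : (r : ℝ) ^ 7 ≤ ((r : ℝ) + 1) ^ 8 := by
          calc (r : ℝ) ^ 7 ≤ ((r : ℝ) + 1) ^ 7 := by gcongr; linarith
            _ ≤ _ := pow_le_pow_right₀ (by linarith [(Nat.cast_nonneg r : (0:ℝ) ≤ r)]) (by norm_num)
        calc _ ≤ ((r : ℝ) + 1) ^ 8 * δ ^ 2 := by gcongr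
          _ = _ := by rw [hδ]; field_simp; norm_num
      have h4 : 2 * (2 * K) ^ 2 * (((r : ℝ) + 1) ^ 10)⁻¹ ≤ 1 / 50000 := by
        rw [← div_eq_mul_inv, div_le_iff₀ (by positivity)]
        have : (r : ℝ) + 1 ≤ ((r : ℝ) + 1) ^ 10 :=
          le_self_pow₀ (by linarith [(Nat.cast_nonneg r : (0:ℝ) ≤ r)]) (by norm_num)
        linarith
      linarith

/-- The left side is exp(O(√k log k)), the right side at least 2^(k/N₀). Raising both to the power
4N₀ avoids the division. -/
lemma exists_pow_lt_two_pow (N₀ D : ℕ) : ∃ k₀ : ℕ, ∀ k, k₀ ≤ k → ∀ M : ℕ, k ≤ N₀ * M →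
    (D * k ^ 4) ^ (Nat.sqrt k + 1) * (k + 1) < 2 ^ M := by
  have h1 : ∀ᶠ t : ℕ in atTop, ((D + 1) * t ^ 8) ^ (4 * N₀) ≤ 2 ^ t := by
    have h2 := tendsto_pow_const_mul_const_pow_of_abs_lt_one (8 * (4 * N₀)) (r := (1 / 2 : ℝ))
      (by rw [abs_of_pos] <;> norm_num)
    have h3 := h2.const_mul (((D : ℝ) + 1) ^ (4 * N₀))
    rw [mul_zero] at h3
    filter_upwards [h3.eventually_lt_const one_pos] with t ht
    rw [one_div, inv_pow, ← mul_assoc, ← div_eq_mul_inv, div_lt_one (by positivity), pow_mul (t : ℝ),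
      ← mul_pow] at ht
    exact_mod_cast ht.le
  obtain ⟨t₀, ht₀⟩ := eventually_atTop.1 h1
  refine ⟨(t₀ + 3) ^ 2, fun k hk M hM => ?_⟩
  set s := Nat.sqrt k with hs
  have hs1 : s ^ 2 ≤ k := Nat.sqrt_le' k
  have hs2 : k < (s + 1) ^ 2 := Nat.lt_succ_sqrt' k
  have hs3 : t₀ + 3 ≤ s := Nat.le_sqrt'.2 hk
  have h4 := ht₀ (s + 1) (by omega)
  set q := (D + 1) * (s + 1) ^ 8 with hq
  have hk4 : k ^ 4 ≤ (s + 1) ^ 8 := by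
    calc k ^ 4 ≤ ((s + 1) ^ 2) ^ 4 := by gcongr
      _ = _ := by ring
  have hle : (D * k ^ 4) ^ (s + 1) * (k + 1) ≤ q ^ (s + 2) := by
    have h5 : D * k ^ 4 ≤ q := by rw [hq]; gcongr; omega
    have h6 : k + 1 ≤ q := by
      calc k + 1 ≤ (s + 1) ^ 2 := hs2
        _ ≤ (s + 1) ^ 8 := Nat.pow_le_pow_right (by omega) (by norm_num)
        _ ≤ q := Nat.le_mul_of_pos_left _ (by omega)
    calc _ ≤ q ^ (s + 1) * q := by gcongr
      _ = _ := by ring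
  refine hle.trans_lt (lt_of_pow_lt_pow_left₀ (4 * N₀) (Nat.zero_le _) ?_)
  calc (q ^ (s + 2)) ^ (4 * N₀) = (q ^ (4 * N₀)) ^ (s + 2) := by rw [← pow_mul, ← pow_mul, mul_comm]
    _ ≤ (2 ^ (s + 1)) ^ (s + 2) := by gcongr
    _ = 2 ^ ((s + 1) * (s + 2)) := by rw [← pow_mul]
    _ < 2 ^ (4 * k) := Nat.pow_lt_pow_right (by norm_num) (by nlinarith)
    _ ≤ 2 ^ (M * (4 * N₀)) := Nat.pow_le_pow_right (by norm_num) (by nlinarith)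
    _ = _ := by rw [pow_mul]

/-- Rapidly decreasing vectors in a large family satisfy an approximate linear relation with
coefficients in `{-1, 0, 1}` of sum zero. -/
lemma exists_small_combination (K : ℝ) (N₀ : ℕ) : ∃ k₀ : ℕ, ∃ C : ℝ, 0 < C ∧
    ∀ k, k₀ ≤ k → 1 ≤ k → ∀ (N : ℕ) (a : Fin k → ℕ → ℝ),
      (∀ j i, |a j i| ≤ K * (((i : ℝ) + 1) ^ 9)⁻¹) → ∀ I : Finset (Fin k), k ≤ N₀ * I.card →
      ∃ n : Fin k → ℤ, n ≠ 0 ∧ (∀ j, |n j| ≤ 1) ∧ (∀ j ∉ I, n j = 0) ∧ ∑ j, n j = 0 ∧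
        ∑ i ∈ Finset.range N, ((i : ℝ) + 1) ^ 6 * (∑ j, (n j : ℝ) * a j i) ^ 2 +
          ((k : ℝ) ^ 4)⁻¹ * ∑ j, (n j : ℝ) ^ 2 ≤ C * ((k : ℝ) ^ 2)⁻¹ := by
  obtain ⟨K', hK'⟩ := exists_nat_ge |K|
  obtain ⟨k₀, hk₀⟩ := exists_pow_lt_two_pow N₀ (2 * (K' + 1) + 1)
  refine ⟨k₀, 257 + 2 * K ^ 2, by positivity, fun k hk hk1 N a ha I hI => ?_⟩
  have hkpos : (0 : ℝ) < k := by exact_mod_cast hk1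
  have hk1' : (1 : ℝ) ≤ k := by exact_mod_cast hk1
  -- About √k coordinates are matched to precision k⁻³: few enough for the 2^|I| subsets to
  -- outnumber the boxes, enough for the tail to be O(k⁻²). The head gives 256 k⁻², the tail 2K² k⁻²
  -- and the last term k⁻².
  set r := Nat.sqrt k + 1 with hr
  set δ : ℝ := ((k : ℝ) ^ 3)⁻¹ with hδ
  have hδ0 : 0 < δ := by positivity
  have haK : ∀ j i, |a j i| ≤ |K| * (((i : ℝ) + 1) ^ 9)⁻¹ := fun j i =>
    (ha j i).trans (by gcongr; exact le_abs_self K)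
  have hsumle : ∀ (J : Finset (Fin k)) i, |∑ j ∈ J, a j i| ≤ k * (|K| * (((i : ℝ) + 1) ^ 9)⁻¹) := by
    intro J i
    refine (Finset.abs_sum_le_sum_abs _ _).trans ?_
    refine (Finset.sum_le_sum fun j _ => haK j i).trans ?_
    rw [Finset.sum_const, nsmul_eq_mul]
    have : J.card ≤ k := by simpa using Finset.card_le_univ J
    gcongr
  set B := (K' + 1) * k ^ 4 with hB
  set f : Finset (Fin k) → (Fin r → ℤ) × ℕ :=
    fun J => (fun i => ⌊(∑ j ∈ J, a j i) / δ⌋, J.card) with hf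
  -- The cardinality is part of the pigeonhole key, so that the difference of the two indicator
  -- functions has sum zero.
  obtain ⟨J, hJ, J', hJ', hne, hfe⟩ := Finset.exists_ne_map_eq_of_card_lt_of_maps_to
    (s := I.powerset) (t := floorBoxes r B ×ˢ Finset.range (k + 1)) (f := f) (by
      rw [Finset.card_product, card_floorBoxes, Finset.card_range, Finset.card_powerset]
      refine lt_of_le_of_lt ?_ (hk₀ k hk _ hI)
      have h1 : 1 ≤ k ^ 4 := Nat.one_le_pow _ _ hk1
      have : 2 * B + 1 ≤ (2 * (K' + 1) + 1) * k ^ 4 := by rw [hB]; nlinarith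
      gcongr) (by
      intro J _
      refine Finset.mem_coe.2 (Finset.mem_product.2
        ⟨Fintype.mem_piFinset.2 fun i => floor_mem_Icc ?_, Finset.mem_range.2 ?_⟩)
      · rw [abs_div, abs_of_pos hδ0, hδ, div_inv_eq_mul, hB]
        have h1 : (((((i : ℕ) : ℝ) + 1)) ^ 9)⁻¹ ≤ 1 := inv_le_one_of_one_le₀
          (one_le_pow₀ (by linarith [(Nat.cast_nonneg (i : ℕ) : (0:ℝ) ≤ (i : ℕ))]))
        push_cast
        calc _ ≤ (k * (|K| * ((((i : ℕ) : ℝ) + 1) ^ 9)⁻¹)) * (k : ℝ) ^ 3 := by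
              gcongr; exact hsumle J i
          _ ≤ (k * ((K' + 1) * 1)) * (k : ℝ) ^ 3 := by gcongr; linarith
          _ = _ := by ring
      · have : J.card ≤ k := by simpa using Finset.card_le_univ J
        simpa [hf] using Nat.lt_succ_of_le this)
  have hJI := Finset.mem_powerset.1 hJ
  have hJI' := Finset.mem_powerset.1 hJ'
  set n : Fin k → ℤ := fun j => (if j ∈ J then 1 else 0) - (if j ∈ J' then 1 else 0) with hn
  have hnr : ∀ g : Fin k → ℝ, ∑ j, (n j : ℝ) * g j = ∑ j ∈ J, g j - ∑ j ∈ J', g j := by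
    intro g
    simp only [hn]
    push_cast
    simp only [sub_mul, Finset.sum_sub_distrib, ite_mul, one_mul, zero_mul, Finset.sum_ite_mem,
      Finset.univ_inter]
  have hn1 : ∀ j, |n j| ≤ 1 := fun j => by
    simp only [hn]
    split_ifs <;> simp
  refine ⟨n, fun h => hne ?_, hn1, fun j hj => ?_, ?_, ?_⟩
  · ext j
    have := congrFun h j
    simp only [hn, Pi.zero_apply] at this
    split_ifs at this <;> simp_all
  · have h1 : j ∉ J := fun h => hj (hJI h)
    have h2 : j ∉ J' := fun h => hj (hJI' h)
    simp [hn, h1, h2]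
  · have h1 := hnr fun _ => 1
    have h2 : J.card = J'.card := congrArg Prod.snd hfe
    simp only [mul_one, Finset.sum_const, nsmul_eq_mul, h2, sub_self] at h1
    exact_mod_cast h1
  · have h1 := sum_pow_six_mul_sq_le (N := N) (r := r) (D := fun i => ∑ j, (n j : ℝ) * a j i) (M := k * |K|)
      (δ := δ) (fun i => by
        refine (Finset.abs_sum_le_sum_abs _ _).trans ?_
        have : ∀ j ∈ (Finset.univ : Finset (Fin k)), |(n j : ℝ) * a j i| ≤ |K| * (((i : ℝ) + 1) ^ 9)⁻¹ := by
          intro j _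
          have h2 : |(n j : ℝ)| ≤ 1 := by exact_mod_cast hn1 j
          rw [abs_mul]
          calc _ ≤ 1 * (|K| * (((i : ℝ) + 1) ^ 9)⁻¹) := by gcongr; exact haK j i
            _ = _ := one_mul _
        refine (Finset.sum_le_sum this).trans_eq ?_
        simp [mul_assoc]) (fun i hi => by
        rw [hnr]
        exact abs_sub_le_of_floor_eq hδ0 (congrFun (congrArg Prod.fst hfe) ⟨i, hi⟩))
    have hr2 : (k : ℝ) ≤ ((r : ℝ)) ^ 2 := by exact_mod_cast (Nat.lt_succ_sqrt' k).le
    have hr1 : (1 : ℝ) ≤ r := by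
      have : 1 ≤ r := by omega
      exact_mod_cast this
    have hr4 : (r : ℝ) ^ 2 ≤ 4 * k := by
      have h2 : Nat.sqrt k ^ 2 ≤ k := Nat.sqrt_le' k
      have h3 : 1 ≤ Nat.sqrt k := Nat.le_sqrt'.2 (by simpa using hk1)
      have : r ^ 2 ≤ 4 * k := by rw [hr]; nlinarith
      exact_mod_cast this
    have h2 : (r : ℝ) ^ 7 * δ ^ 2 ≤ 256 * ((k : ℝ) ^ 2)⁻¹ := by
      calc (r : ℝ) ^ 7 * δ ^ 2 ≤ (r : ℝ) ^ 8 * δ ^ 2 := by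
            gcongr
            norm_num
        _ = ((r : ℝ) ^ 2) ^ 4 * δ ^ 2 := by ring
        _ ≤ (4 * k) ^ 4 * δ ^ 2 := by gcongr
        _ = _ := by rw [hδ]; field_simp; norm_num
    have h3 : 2 * (k * |K|) ^ 2 * (((r : ℝ) + 1) ^ 10)⁻¹ ≤ 2 * K ^ 2 * ((k : ℝ) ^ 2)⁻¹ := by
      have h4 : (k : ℝ) ^ 4 ≤ ((r : ℝ) + 1) ^ 10 := by
        calc (k : ℝ) ^ 4 ≤ (k : ℝ) ^ 5 := pow_le_pow_right₀ hk1' (by norm_num)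
          _ ≤ ((r : ℝ) ^ 2) ^ 5 := by gcongr
          _ = (r : ℝ) ^ 10 := by ring
          _ ≤ _ := by gcongr; linarith
      calc _ ≤ 2 * (k * |K|) ^ 2 * ((k : ℝ) ^ 4)⁻¹ := by gcongr
        _ = _ := by rw [mul_pow, sq_abs]; field_simp
    have h4 : ((k : ℝ) ^ 4)⁻¹ * ∑ j, (n j : ℝ) ^ 2 ≤ ((k : ℝ) ^ 2)⁻¹ := by
      have h5 : ∑ j, (n j : ℝ) ^ 2 ≤ k := by
        have : ∀ j ∈ (Finset.univ : Finset (Fin k)), (n j : ℝ) ^ 2 ≤ 1 := fun j _ => by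
          rw [← sq_abs]
          exact pow_le_one₀ (abs_nonneg _) (by exact_mod_cast hn1 j)
        refine (Finset.sum_le_sum this).trans_eq ?_
        simp
      calc _ ≤ ((k : ℝ) ^ 4)⁻¹ * (k : ℝ) ^ 2 := by
            gcongr
            exact h5.trans (le_self_pow₀ hk1' (by norm_num))
        _ = _ := by field_simp
    calc _ ≤ _ := add_le_add h1 h4
      _ ≤ 256 * ((k : ℝ) ^ 2)⁻¹ + 2 * K ^ 2 * ((k : ℝ) ^ 2)⁻¹ + ((k : ℝ) ^ 2)⁻¹ := by linarith
      _ = _ := by ring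

end Pigeonhole

/-! ### Approximate dependence of small elements -/

section Dependence

variable {G : Type u} [AddCommGroup G] [TopologicalSpace G]

lemma nonempty_of_kolmogorov_le {E : Type*} [AddCommGroup E] [Module ℝ E] {X Y : Set E}
    (hX : X.Nonempty) {c : ℝ} (hc : 0 ≤ c) {m : ℤ} (h : kolmogorov 1 X Y ≤ rate c m 1) :
    Y.Nonempty := by
  obtain ⟨s, -, -, L, -, hs⟩ := exists_of_kolmogorov_lt (t := c + 1) (h.trans_lt (by
    rw [rate, Nat.cast_one, one_zpow, mul_one]
    exact (ENNReal.ofReal_lt_ofReal_iff (by linarith)).2 (by linarith)))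
  obtain ⟨x, hx⟩ := hX
  obtain ⟨_, ⟨y, hy, -⟩, -⟩ := Set.mem_add.1 (hs hx)
  exact ⟨y, hy⟩

/-- Characters in the polar of `U` lift, on a finite set with small diameters relative to `U`, to
functionals that are bounded by a quadratic form not depending on the character. -/
theorem exists_lift_bounded_by_form {U : Set G} {c : ℝ} (hc : 0 < c) {k : ℕ} (hk : 1 ≤ k)
    (w : Fin k → G) (h : DiamLE (Set.range w) U (rate c 9)) :
    ∃ (N : ℕ) (a : Fin k → ℕ → ℝ), (∀ j i, |a j i| ≤ c * (8 * 6 ^ 9) * (((i : ℝ) + 1) ^ 9)⁻¹) ∧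
      ∀ χ ∈ polar U, ∃ z : Fin k → ℤ, ∀ u : Fin k → ℝ,
        (∑ j, (angle χ.1 (w j) + z j) * u j) ^ 2 ≤
          5625 * (∑ i ∈ Finset.range N, ((i : ℝ) + 1) ^ 6 * (∑ j, u j * a j i) ^ 2 +
            ((k : ℝ) ^ 4)⁻¹ * ∑ j, u j ^ 2) := by
  obtain ⟨E, _, _, X, Y, -, -, hYs, hYc, hd, H, φ, hX, hY⟩ := h
  have hlift : ∀ j, ∃ x : H, (x : E) ∈ X ∧ φ x = w j := fun j => by
    obtain ⟨x, hx, h⟩ := hX ⟨j, rfl⟩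
    exact ⟨x, hx, h⟩
  choose x hxX hxw using hlift
  have h0 : (0 : E) ∈ Y := zero_mem_of_symm_convex hYs hYc
    (nonempty_of_kolmogorov_le ⟨_, hxX ⟨0, hk⟩⟩ hc.le (hd 1 le_rfl))
  obtain ⟨e, he, hrep⟩ := exists_series_representation (m := 9) hYs hYc h0 hc (by norm_num)
    (by simpa using hd)
  choose a ha hrem using fun j => hrep _ (hxX j)
  have hkpos : (0 : ℝ) < k := by exact_mod_cast hk
  -- One truncation serves all k vectors. The remainders in k⁻⁵ Y account for the second term in the
  -- hypothesis of `exists_bounded_lift`.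
  obtain ⟨n, hn⟩ := (eventually_all.2 fun j => hrem j ((k : ℝ) ^ 5)⁻¹ (by positivity)).exists
  refine ⟨blockStart n, a, ha, fun χ hχ => ?_⟩
  obtain ⟨z, hz⟩ := exists_bounded_lift k (blockStart n) hk (fun j i => a j i)
    (fun j => angle χ.1 (w j)) (fun z hz => by
      have hsum : ∑ j, (z j : ℝ) • (x j : E) =
          ∑ i ∈ Finset.range (blockStart n), (∑ j, (z j : ℝ) * a j i) • e i +
          ∑ j, (z j : ℝ) • ((x j : E) - ∑ i ∈ Finset.range (blockStart n), a j i • e i) := by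
        simp only [smul_sub, Finset.sum_sub_distrib, Finset.smul_sum, Finset.sum_smul, smul_smul]
        rw [Finset.sum_comm]
        abel
      have hmem1 := sum_smul_mem hYs hYc h0 (Finset.range (blockStart n))
        (fun i => ∑ j, (z j : ℝ) * a j i) e fun i _ => he i
      have hmem2 : ∑ j, (z j : ℝ) • ((x j : E) - ∑ i ∈ Finset.range (blockStart n), a j i • e i) ∈
          (((k : ℝ) ^ 5)⁻¹ * ∑ j, |(z j : ℝ)|) • Y := by
        choose y hy hye using hn
        have h2 := sum_smul_mem hYs hYc h0 Finset.univ (fun j => ((k : ℝ) ^ 5)⁻¹ * (z j : ℝ)) y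
          fun j _ => hy j
        have h3 : ∀ j, |((k : ℝ) ^ 5)⁻¹ * (z j : ℝ)| = ((k : ℝ) ^ 5)⁻¹ * |(z j : ℝ)| := fun j => by
          rw [abs_mul, abs_of_pos (by positivity)]
        simp only [h3, ← Finset.mul_sum] at h2
        convert h2 using 1
        refine Finset.sum_congr rfl fun j _ => ?_
        rw [← hye j]
        simp only [smul_smul]
        rw [mul_comm]
      have hmem : ∑ j, (z j : ℝ) • (x j : E) ∈ Y := by
        rw [hsum]
        have h2 := Set.add_mem_add hmem1 hmem2
        rw [← hYc.add_smul (Finset.sum_nonneg fun _ _ => abs_nonneg _)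
          (mul_nonneg (by positivity) (Finset.sum_nonneg fun _ _ => abs_nonneg _))] at h2
        rw [Finset.sum_range] at h2
        have := smul_subset_smul_of_le hYc h0 (add_nonneg
          (Finset.sum_nonneg fun _ _ => abs_nonneg _)
          (mul_nonneg (by positivity) (Finset.sum_nonneg fun _ _ => abs_nonneg _))) hz.le h2
        rwa [one_smul] at this
      have hcoe : ((∑ j, z j • x j : H) : E) = ∑ j, (z j : ℝ) • (x j : E) := by
        rw [AddSubmonoidClass.coe_finsetSum]
        refine Finset.sum_congr rfl fun j _ => ?_
        rw [AddSubgroup.coe_zsmul, Int.cast_smul_eq_zsmul]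
      have hU : φ (∑ j, z j • x j) ∈ U := hY ⟨_, by
        rw [Set.mem_ofPred_eq, hcoe]
        exact hmem, rfl⟩
      have h4 := hχ _ hU
      rw [map_sum] at h4
      simp only [map_zsmul, hxw] at h4
      rwa [char_sum_zsmul, re_circle_exp] at h4)
  refine ⟨z, fun u => (hz u).trans_eq ?_⟩
  rw [Finset.sum_range]

/-- If all finite subsets of `W` have rapidly decreasing diameters relative to `U`, then any `k`
elements of `W` with small angles are dependent up to an error of order `1 / k`. -/
theorem exists_almost_dependent {U W : Set G} {c : ℝ}
    (h : ∀ F : Set G, F.Finite → F ⊆ W → DiamLE F U (rate c 9))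
    (hW : ∀ w ∈ W, ∀ χ ∈ polar U, |angle χ.1 w| ≤ 1 / 8) :
    ∃ C : ℝ, 0 < C ∧ ∀ k : ℕ, 1 ≤ k → ∀ w : Fin k → G, (∀ j, w j ∈ W) →
      ∃ n : Fin k → ℤ, n ≠ 0 ∧ (∀ j, |n j| ≤ 1) ∧
        ∀ χ ∈ polar U, |∑ j, (n j : ℝ) * angle χ.1 (w j)| ≤ C * (k : ℝ)⁻¹ := by
  set c' : ℝ := |c| + 1 with hc'
  have hc'pos : 0 < c' := by positivity
  set K : ℝ := c' * (8 * 6 ^ 9) with hK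
  obtain ⟨N₀, hN₀⟩ := exists_large_class K
  obtain ⟨k₀, C, hC, hk₀⟩ := exists_small_combination K N₀
  -- The first summand is √(5625 C), from large k; the second makes the bound trivial for k < k₀ +
  -- 15, where a single element suffices.
  refine ⟨75 * √C + (k₀ + 15), by positivity, fun k hk w hw => ?_⟩
  have hkpos : (0 : ℝ) < k := by exact_mod_cast hk
  rcases lt_or_ge k (k₀ + 15) with hlt | hge
  · refine ⟨Pi.single ⟨0, hk⟩ 1, by simp, fun j => ?_, fun χ hχ => ?_⟩
    · rw [Pi.single_apply]
      split_ifs <;> simp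
    · have h1 : ∑ j, ((Pi.single (⟨0, hk⟩ : Fin k) (1 : ℤ) : Fin k → ℤ) j : ℝ) * angle χ.1 (w j) =
          angle χ.1 (w ⟨0, hk⟩) := by
        rw [Finset.sum_eq_single ⟨0, hk⟩] <;> simp +contextual
      rw [h1]
      refine (hW _ (hw _) χ hχ).trans ?_
      rw [← div_eq_mul_inv, le_div_iff₀ hkpos]
      have h2 : (k : ℝ) ≤ k₀ + 15 := by exact_mod_cast hlt.le
      have := Real.sqrt_nonneg C
      linarith
  · have hd : DiamLE (Set.range w) U (rate c' 9) := by
      obtain ⟨E, i1, i2, X, Y, hXs, hXc, hYs, hYc, hd, r⟩ :=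
        h _ (Set.finite_range w) (Set.range_subset_iff.2 hw)
      refine ⟨E, i1, i2, X, Y, hXs, hXc, hYs, hYc, fun k hk => (hd k hk).trans ?_, r⟩
      refine ENNReal.ofReal_le_ofReal ?_
      gcongr
      linarith [le_abs_self c]
    obtain ⟨N, a, ha, hlift⟩ := exists_lift_bounded_by_form hc'pos hk w hd
    obtain ⟨I, hIcard, hI⟩ := hN₀ k N a ha
    obtain ⟨n, hn0, hn1, hnI, hnsum, hnB⟩ := hk₀ k (by omega) hk N a ha I hIcard
    refine ⟨n, hn0, hn1, fun χ hχ => ?_⟩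
    obtain ⟨z, hz⟩ := hlift χ hχ
    -- The form at the difference of two unit vectors is at most 5625 · (1/20000 + 1/25000) < 0.74².
    -- With two angles of at most 1/8 the integers differ by at most 0.99, hence not at all.
    have hzI : ∀ j ∈ I, ∀ l ∈ I, z j = z l := by
      intro j hj l hl
      have h1 := hz (Pi.single j 1 - Pi.single l 1)
      have h2 : ∀ f : Fin k → ℝ, ∑ i, f i * (Pi.single j (1 : ℝ) - Pi.single l 1 : Fin k → ℝ) i =
          f j - f l := fun f => by
        simp [mul_sub, Finset.sum_sub_distrib, Pi.single_apply]
      have h3 : ∑ i, ((Pi.single j (1 : ℝ) - Pi.single l 1 : Fin k → ℝ) i) ^ 2 ≤ 2 := by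
        have h4 : ∀ i, ((Pi.single j (1 : ℝ) - Pi.single l 1 : Fin k → ℝ) i) ^ 2 ≤
            (Pi.single j (1 : ℝ) : Fin k → ℝ) i + (Pi.single l (1 : ℝ) : Fin k → ℝ) i := fun i => by
          simp only [Pi.sub_apply, Pi.single_apply]
          split_ifs <;> norm_num
        refine (Finset.sum_le_sum fun i _ => h4 i).trans ?_
        rw [Finset.sum_add_distrib]
        simp only [Finset.sum_pi_single', Finset.mem_univ, if_true]
        norm_num
      rw [h2] at h1
      simp only [mul_comm _ (a _ _), h2] at h1
      have h5 := hI j hj l hl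
      have h6 : ((k : ℝ) ^ 4)⁻¹ * 2 ≤ 1 / 25000 := by
        have h7 : (15 : ℝ) ≤ k := by
          have : 15 ≤ k := by omega
          exact_mod_cast this
        have h8 : (15 : ℝ) ^ 4 ≤ (k : ℝ) ^ 4 := by gcongr
        rw [inv_mul_le_iff₀ (by positivity)]
        norm_num at h8 ⊢
        linarith
      have h7 : ((k : ℝ) ^ 4)⁻¹ * ∑ i, ((Pi.single j (1 : ℝ) - Pi.single l 1 : Fin k → ℝ) i) ^ 2 ≤
          ((k : ℝ) ^ 4)⁻¹ * 2 := by gcongr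
      have h8 : |angle χ.1 (w j) + z j - (angle χ.1 (w l) + z l)| ≤ 74 / 100 := by
        refine abs_le_of_sq_le_sq ?_ (by norm_num)
        linarith
      have h9 : |((z j - z l : ℤ) : ℝ)| < 1 := by
        have h10 := abs_le.1 (hW _ (hw j) χ hχ)
        have h11 := abs_le.1 (hW _ (hw l) χ hχ)
        have h12 := abs_le.1 h8
        push_cast
        rw [abs_lt]
        constructor <;> linarith
      have h10 : |z j - z l| < 1 := by exact_mod_cast h9
      exact sub_eq_zero.1 (Int.abs_lt_one_iff.1 h10)
    have hzsum : ∑ j, (z j : ℝ) * n j = 0 := by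
      rcases I.eq_empty_or_nonempty with rfl | ⟨l, hl⟩
      · exact Finset.sum_eq_zero fun j _ => by rw [hnI j (Finset.notMem_empty j)]; simp
      · have : ∀ j ∈ (Finset.univ : Finset (Fin k)), (z j : ℝ) * n j = (z l : ℝ) * n j := fun j _ => by
          by_cases hj : j ∈ I
          · rw [hzI j hj l hl]
          · rw [hnI j hj]; simp
        rw [Finset.sum_congr rfl this, ← Finset.mul_sum]
        have : ∑ j, (n j : ℝ) = 0 := by exact_mod_cast hnsum
        rw [this, mul_zero]
    have h1 := hz fun j => n j
    simp only [add_mul, Finset.sum_add_distrib, hzsum, add_zero] at h1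
    have h2 : (∑ j, (n j : ℝ) * angle χ.1 (w j)) ^ 2 ≤ (75 * √C * (k : ℝ)⁻¹) ^ 2 := by
      simp only [mul_comm ((n _ : ℝ)) (angle _ _)]
      refine h1.trans ?_
      calc _ ≤ 5625 * (C * ((k : ℝ) ^ 2)⁻¹) := by gcongr
        _ = _ := by rw [mul_pow, mul_pow, Real.sq_sqrt hC.le]; ring
    refine (abs_le_of_sq_le_sq h2 (by positivity)).trans ?_
    gcongr
    linarith [(Nat.cast_nonneg k₀ : (0 : ℝ) ≤ k₀)]

end Dependence

/-! ### Calculus of Kolmogoroff decay -/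

section Decay

variable {E : Type*} [AddCommGroup E] [Module ℝ E]

/-- The Kolmogoroff numbers of `X` relative to `Y` are of order `k ^ (-M)`. -/
def DecaysTo (X Y : Set E) (M : ℕ) : Prop :=
  ∃ K : ℝ, 0 < K ∧ ∀ k : ℕ, 1 ≤ k → ∃ L : Submodule ℝ E, Module.rank ℝ L < (k : Cardinal) ∧
    X ⊆ (K * ((k : ℝ) ^ M)⁻¹) • Y + (L : Set E)

lemma rank_bot_lt {k : ℕ} (hk : 1 ≤ k) :
    Module.rank ℝ (⊥ : Submodule ℝ E) < (k : Cardinal) := by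
  rw [rank_bot]
  exact_mod_cast hk

lemma rank_sup_lt {L L' : Submodule ℝ E} {l k : ℕ} (hl : Module.rank ℝ L < (l : Cardinal))
    (hl' : Module.rank ℝ L' < (l : Cardinal)) (h : 2 * l ≤ k + 1) :
    Module.rank ℝ (L ⊔ L' : Submodule ℝ E) < (k : Cardinal) := by
  obtain ⟨a, ha⟩ := Cardinal.lt_aleph0.1 (hl.trans Cardinal.natCast_lt_aleph0)
  obtain ⟨b, hb⟩ := Cardinal.lt_aleph0.1 (hl'.trans Cardinal.natCast_lt_aleph0)
  refine (Submodule.rank_add_le_rank_add_rank L L').trans_lt ?_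
  rw [ha] at hl ⊢
  rw [hb] at hl' ⊢
  have h1 : a < l := by exact_mod_cast hl
  have h2 : b < l := by exact_mod_cast hl'
  exact_mod_cast (show a + b < k by omega)

/-- Two subspaces of dimension below l = ⌊(k+1)/2⌋ span one of dimension below k; replacing k by k/2
costs the factor 2^(M+M'). -/
lemma DecaysTo.trans {X Y Z : Set E} {M M' : ℕ} (hZ : Convex ℝ Z) (h0 : (0 : E) ∈ Z)
    (h : DecaysTo X Y M) (h' : DecaysTo Y Z M') : DecaysTo X Z (M + M') := by
  obtain ⟨K, hK, hX⟩ := h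
  obtain ⟨K', hK', hY⟩ := h'
  refine ⟨K * K' * 2 ^ (M + M'), by positivity, fun k hk => ?_⟩
  set l := (k + 1) / 2 with hl
  have hl1 : 1 ≤ l := by omega
  obtain ⟨L, hL, hXL⟩ := hX l hl1
  obtain ⟨L', hL', hYL⟩ := hY l hl1
  refine ⟨L ⊔ L', rank_sup_lt hL hL' (by omega), fun x hx => ?_⟩
  obtain ⟨_, ⟨y, hy, rfl⟩, v, hv, rfl⟩ := Set.mem_add.1 (hXL hx)
  obtain ⟨_, ⟨z, hz, rfl⟩, v', hv', rfl⟩ := Set.mem_add.1 (hYL hy)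
  set α := K * ((l : ℝ) ^ M)⁻¹ with hα
  set α' := K' * ((l : ℝ) ^ M')⁻¹ with hα'
  have hlpos : (0 : ℝ) < l := by exact_mod_cast hl1
  have hkpos : (0 : ℝ) < k := by exact_mod_cast hk
  have hkl : (k : ℝ) / 2 ≤ l := by
    rw [div_le_iff₀ (by norm_num)]
    exact_mod_cast (show k ≤ l * 2 by omega)
  have hle : α * α' ≤ K * K' * 2 ^ (M + M') * ((k : ℝ) ^ (M + M'))⁻¹ := by
    calc α * α' = K * K' * ((l : ℝ) ^ (M + M'))⁻¹ := by rw [hα, hα', pow_add, mul_inv]; ring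
      _ ≤ K * K' * (((k : ℝ) / 2) ^ (M + M'))⁻¹ := by gcongr
      _ = _ := by rw [div_pow, inv_div]; ring
  refine Set.mem_add.2 ⟨(α * α') • z, smul_subset_smul_of_le hZ h0 (by positivity) hle ⟨z, hz, rfl⟩,
    α • v' + v, ?_, ?_⟩
  · exact Submodule.add_mem _ (Submodule.mem_sup_right (L'.smul_mem _ hv')) (Submodule.mem_sup_left hv)
  · simp only [smul_add, smul_smul]
    abel

/-- If among any `k` elements of `S` one is, modulo `Y`, a combination of the preceding ones, then
`S` is contained in `Y + L` for a subspace `L` of dimension less than `k`. -/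
lemma exists_subspace_of_dependent {S Y : Set E} {k : ℕ}
    (h : ∀ w : Fin k → E, (∀ j, w j ∈ S) →
      ∃ j, w j ∈ Y + (Submodule.span ℝ (w '' Set.Iio j) : Set E)) :
    ∃ L : Submodule ℝ E, Module.rank ℝ L < (k : Cardinal) ∧ S ⊆ Y + (L : Set E) := by
  classical
  by_contra! hcon
  -- Greedy choice: while fewer than k vectors are selected, their span has dimension below k, so
  -- some element of S escapes it modulo Y.
  have key : ∀ m ≤ k, ∃ w : ℕ → E, ∀ j < m, w j ∈ S ∧
      w j ∉ Y + (Submodule.span ℝ (w '' Set.Iio j) : Set E) := by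
    intro m
    induction m with
    | zero => exact fun _ => ⟨fun _ => 0, fun j hj => absurd hj (Nat.not_lt_zero j)⟩
    | succ m ih =>
      intro hm
      obtain ⟨w, hw⟩ := ih (by omega)
      have hr : Module.rank ℝ (Submodule.span ℝ (w '' Set.Iio m)) < (k : Cardinal) := by
        have h1 : w '' Set.Iio m = ((Finset.range m).image w : Set E) := by
          ext x
          simp
        rw [h1]
        refine (rank_span_finset_le _).trans_lt ?_
        have h2 : ((Finset.range m).image w).card ≤ m := by
          simpa using Finset.card_image_le (s := Finset.range m) (f := w)
        exact_mod_cast (show _ < k by omega)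
      obtain ⟨x, hx, hxn⟩ := Set.not_subset.1 (hcon _ hr)
      have himg : ∀ j ≤ m, Function.update w m x '' Set.Iio j = w '' Set.Iio j := fun j hj =>
        Set.image_congr fun i hi => Function.update_of_ne (by
          have : i < j := hi
          omega) _ _
      refine ⟨Function.update w m x, fun j hj => ?_⟩
      rw [himg j (by omega)]
      rcases Nat.lt_succ_iff_lt_or_eq.1 hj with hjm | rfl
      · rw [Function.update_of_ne hjm.ne]
        exact hw j hjm
      · rw [Function.update_self]
        exact ⟨hx, hxn⟩
  obtain ⟨w, hw⟩ := key k le_rfl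
  obtain ⟨j, hj⟩ := h (fun j => w j) fun j => (hw j j.2).1
  refine (hw j j.2).2 (Set.add_subset_add_left (SetLike.coe_subset_coe.2 (Submodule.span_mono ?_)) hj)
  rintro _ ⟨i, hi, rfl⟩
  exact ⟨i, hi, rfl⟩

end Decay

/-! ### Convex hulls of angle vectors -/

section AngleHull

variable {G : Type u} [AddCommGroup G] [TopologicalSpace G]

/-- The angles of the elements of the polar of `U` at a point. -/
noncomputable def angles (U : Set G) (w : G) : polar U → ℝ := fun χ => angle χ.1.1 w

/-- The linear extension of `angles` to formal combinations. -/
noncomputable def anglesLin (U : Set G) : (G →₀ ℝ) →ₗ[ℝ] (polar U → ℝ) :=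
  Finsupp.linearCombination ℝ (angles U)

/-- Formal combinations whose angles lie in the convex hull of the angles of elements of `W`. -/
noncomputable def angleHull (U W : Set G) : Set (G →₀ ℝ) :=
  anglesLin U ⁻¹' convexHull ℝ (angles U '' W)

lemma anglesLin_single (U : Set G) (w : G) (r : ℝ) :
    anglesLin U (Finsupp.single w r) = r • angles U w := Finsupp.linearCombination_single ..

lemma convex_angleHull (U W : Set G) : Convex ℝ (angleHull U W) :=
  (convex_convexHull ℝ _).linear_preimage _

lemma angleHull_mono (U : Set G) {W W' : Set G} (h : W ⊆ W') : angleHull U W ⊆ angleHull U W' :=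
  Set.preimage_mono (convexHull_mono (Set.image_mono h))

lemma mem_angleHull_of_angles {U W : Set G} {x : G →₀ ℝ} {w : G} (hw : w ∈ W)
    (h : anglesLin U x = angles U w) : x ∈ angleHull U W := by
  rw [angleHull, Set.mem_preimage, h]
  exact subset_convexHull ℝ _ ⟨w, hw, rfl⟩

lemma zero_mem_angleHull {U W : Set G} (h : (0 : G) ∈ W) : (0 : G →₀ ℝ) ∈ angleHull U W := by
  refine mem_angleHull_of_angles h ?_
  ext χ
  simp [angles, angle]

lemma isSymm_angleHull {U W : Set G} (hW : IsQuasiConvex W) (hWU : W ⊆ U) :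
    IsSymm (angleHull U W) := by
  have h1 : -(angles U '' W) = angles U '' W := by
    have h2 : ∀ w ∈ W, angles U (-w) = -angles U w := fun w hw => by
      ext χ
      exact angle_neg (abs_angle_le_of_mem (hWU hw) χ.2)
    ext f
    constructor
    · rintro ⟨w, hw, h⟩
      exact ⟨-w, hW.neg_mem hw, by rw [h2 w hw, h, neg_neg]⟩
    · rintro ⟨w, hw, rfl⟩
      exact ⟨-w, hW.neg_mem hw, h2 w hw⟩
  intro x hx
  rw [angleHull, Set.mem_preimage, map_neg, ← h1, convexHull_neg, Set.neg_mem_neg]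
  exact hx

/-- The right side is convex and angle hulls are preimages under `anglesLin`, so a formal
combination may be corrected by any element of the kernel. Point masses therefore suffice. -/
lemma angleHull_subset_of_single_mem {U W V : Set G} {ε : ℝ} (hε : 0 < ε)
    {L : Submodule ℝ (G →₀ ℝ)}
    (h : (fun w => Finsupp.single w (1 : ℝ)) '' W ⊆ ε • angleHull U V + (L : Set (G →₀ ℝ))) :
    angleHull U W ⊆ ε • angleHull U V + (L : Set (G →₀ ℝ)) := by
  intro x hx
  have h1 : angles U '' W = anglesLin U '' ((fun w => Finsupp.single w (1 : ℝ)) '' W) := by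
    rw [Set.image_image]
    simp only [anglesLin_single, one_smul]
  rw [angleHull, Set.mem_preimage, h1, ← LinearMap.image_convexHull] at hx
  obtain ⟨y, hy, hyx⟩ := hx
  have h2 := convexHull_min h (((convex_angleHull U V).smul ε).add L.convex) hy
  obtain ⟨_, ⟨v, hv, rfl⟩, l, hl, rfl⟩ := Set.mem_add.1 h2
  refine Set.mem_add.2 ⟨ε • (v + ε⁻¹ • (x - (ε • v + l))), ⟨_, ?_, rfl⟩, l, hl, ?_⟩
  · have h3 : anglesLin U (v + ε⁻¹ • (x - (ε • v + l))) = anglesLin U v := by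
      rw [map_add, map_smul, map_sub]
      change anglesLin U (ε • v + l) = _ at hyx
      rw [hyx, sub_self, smul_zero, add_zero]
    rw [angleHull, Set.mem_preimage, h3]
    exact hv
  · rw [smul_add, smul_smul, mul_inv_cancel₀ hε.ne', one_smul]
    abel

/-- The group element J · ∑ n_j w_j lies in W by quasi-convexity, and its angles do not wrap around;
division by J then takes place in the vector space. -/
lemma sum_smul_single_mem_angleHull {U W : Set G} (hW : IsQuasiConvex W) (hWU : W ⊆ U) {ι : Type*}
    [Fintype ι] (n : ι → ℤ) (w : ι → G) {J : ℕ} (hJ : 0 < J)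
    (h : ∀ χ ∈ polar W, J * |∑ j, (n j : ℝ) * angle χ.1 (w j)| ≤ 1 / 4) :
    ∑ j, (n j : ℝ) • Finsupp.single (w j) (1 : ℝ) ∈ (J : ℝ)⁻¹ • angleHull U W := by
  have hJ' : (0 : ℝ) < J := by exact_mod_cast hJ
  set v := ∑ j, ((J : ℤ) * n j) • w j with hv
  have hangle : ∀ χ ∈ polar W, angle χ.1 v = J * ∑ j, (n j : ℝ) * angle χ.1 (w j) ∧
      |angle χ.1 v| ≤ 1 / 4 := by
    intro χ hχ
    have h1 := char_sum_zsmul χ.1 Finset.univ (fun j => (J : ℤ) * n j) w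
    have h2 : ∑ j, (((J : ℤ) * n j : ℤ) : ℝ) * angle χ.1 (w j) =
        J * ∑ j, (n j : ℝ) * angle χ.1 (w j) := by
      rw [Finset.mul_sum]
      push_cast
      simp only [mul_assoc]
    rw [h2] at h1
    have h3 : |J * ∑ j, (n j : ℝ) * angle χ.1 (w j)| ≤ 1 / 4 := by
      rw [abs_mul, abs_of_pos hJ']
      exact h χ hχ
    have h4 := angle_eq_of_char_eq (h3.trans_lt (by norm_num)) h1
    exact ⟨h4, h4 ▸ h3⟩
  have hvW : v ∈ W := mem_of_forall_polar hW fun χ hχ => (hangle χ hχ).2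
  refine ⟨(J : ℝ) • ∑ j, (n j : ℝ) • Finsupp.single (w j) (1 : ℝ), mem_angleHull_of_angles hvW ?_, ?_⟩
  · ext χ
    rw [map_smul, map_sum]
    simp only [map_smul, anglesLin_single, one_smul, Pi.smul_apply, Finset.sum_apply, smul_eq_mul]
    exact (hangle χ.1 (polar_anti hWU χ.2)).1.symm
  · simp only [smul_smul]
    rw [inv_mul_cancel₀ hJ'.ne', one_smul]

/-- Approximate dependence yields decay of order `1 / k`. -/
theorem decaysTo_angleHull {U V W : Set G} (hV : IsQuasiConvex V) (hVU : V ⊆ U) (hWV : W ⊆ V)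
    (h0 : (0 : G) ∈ V)
    {C : ℝ} (hC : 0 < C) (h : ∀ k : ℕ, 1 ≤ k → ∀ w : Fin k → G, (∀ j, w j ∈ W) →
      ∃ n : Fin k → ℤ, n ≠ 0 ∧ (∀ j, |n j| ≤ 1) ∧
        ∀ χ ∈ polar V, |∑ j, (n j : ℝ) * angle χ.1 (w j)| ≤ C * (k : ℝ)⁻¹) :
    DecaysTo (angleHull U W) (angleHull U V) 1 := by
  have hcV := convex_angleHull U V
  have h0V : (0 : G →₀ ℝ) ∈ angleHull U V := zero_mem_angleHull h0
  have hsV := isSymm_angleHull hV hVU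
  refine ⟨8 * C, by positivity, fun k hk => ?_⟩
  have hkpos : (0 : ℝ) < k := by exact_mod_cast hk
  rw [pow_one]
  rcases lt_or_ge (k : ℝ) (4 * C) with hlt | hge
  · refine ⟨⊥, rank_bot_lt hk, fun x hx => Set.mem_add.2 ⟨x, ?_, 0, Submodule.zero_mem _, add_zero x⟩⟩
    have h1 : (1 : ℝ) ≤ 8 * C * (k : ℝ)⁻¹ := by
      rw [← div_eq_mul_inv, le_div_iff₀ hkpos]
      linarith
    exact smul_subset_smul_of_le hcV h0V zero_le_one h1 (by rw [one_smul]; exact angleHull_mono U hWV hx)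
  · set J := ⌊(k : ℝ) / (4 * C)⌋₊ with hJ
    have hJ1 : 1 ≤ J := Nat.le_floor (by rw [Nat.cast_one, le_div_iff₀ (by positivity)]; linarith)
    have hJ1' : (1 : ℝ) ≤ J := by exact_mod_cast hJ1
    have hJle : (J : ℝ) * (C * (k : ℝ)⁻¹) ≤ 1 / 4 := by
      have h1 : (J : ℝ) ≤ k / (4 * C) := Nat.floor_le (by positivity)
      calc (J : ℝ) * (C * (k : ℝ)⁻¹) ≤ k / (4 * C) * (C * (k : ℝ)⁻¹) := by gcongr
        _ = 1 / 4 := by field_simp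
    have hJinv : (J : ℝ)⁻¹ ≤ 8 * C * (k : ℝ)⁻¹ := by
      have h1 : (k : ℝ) / (4 * C) < J + 1 := Nat.lt_floor_add_one _
      rw [div_lt_iff₀ (by positivity)] at h1
      rw [← div_eq_mul_inv, inv_le_comm₀ (by positivity) (by positivity), inv_div,
        div_le_iff₀ (by positivity)]
      nlinarith
    set ε := 8 * C * (k : ℝ)⁻¹ with hε
    have hεpos : 0 < ε := by positivity
    obtain ⟨L, hL, hLW⟩ := exists_subspace_of_dependent
      (S := (fun w => Finsupp.single w (1 : ℝ)) '' W) (Y := ε • angleHull U V) (k := k) (by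
        intro e he
        choose w hw hwe using he
        obtain ⟨n, hn0, hn1, hn⟩ := h k hk w hw
        have hmem := sum_smul_single_mem_angleHull hV hVU n w hJ1 fun χ hχ =>
          (mul_le_mul_of_nonneg_left (hn χ hχ) (by positivity)).trans hJle
        simp only [hwe] at hmem
        have hmem' := smul_subset_smul_of_le hcV h0V (by positivity) hJinv hmem
        obtain ⟨j₁, hj₁⟩ := Function.ne_iff.1 hn0
        set s := Finset.univ.filter fun j => n j ≠ 0 with hs
        have hsne : s.Nonempty := ⟨j₁, Finset.mem_filter.2 ⟨Finset.mem_univ _, hj₁⟩⟩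
        -- At the last nonzero coefficient, which is ±1, the relation can be solved for e j in terms
        -- of earlier vectors without rescaling the error.
        set j := s.max' hsne with hj
        have hjn : n j ≠ 0 := (Finset.mem_filter.1 (s.max'_mem hsne)).2
        have hjl : ∀ i, j < i → n i = 0 := fun i hi => by
          by_contra hne
          exact absurd (s.le_max' i (Finset.mem_filter.2 ⟨Finset.mem_univ _, hne⟩)) (not_le.2 hi)
        refine ⟨j, ?_⟩
        have hspan : ∑ i ∈ Finset.univ.erase j, (n i : ℝ) • e i ∈
            Submodule.span ℝ (e '' Set.Iio j) := by
          refine Submodule.sum_mem _ fun i hi => ?_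
          rcases lt_or_ge i j with hij | hij
          · exact Submodule.smul_mem _ _ (Submodule.subset_span ⟨i, hij, rfl⟩)
          · rw [hjl i (lt_of_le_of_ne hij (Finset.ne_of_mem_erase hi).symm)]
            simp
        have hsplit := Finset.add_sum_erase Finset.univ (fun i => (n i : ℝ) • e i) (Finset.mem_univ j)
        have hcase : n j = 1 ∨ n j = -1 := by
          have := abs_le.1 (hn1 j)
          omega
        rcases hcase with hc | hc
        · rw [hc, Int.cast_one, one_smul] at hsplit
          refine Set.mem_add.2 ⟨_, hmem', _, Submodule.neg_mem _ hspan, ?_⟩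
          rw [← hsplit]
          abel
        · rw [hc, Int.cast_neg, Int.cast_one, neg_one_smul] at hsplit
          obtain ⟨v, hv, hve⟩ := hmem'
          refine Set.mem_add.2 ⟨ε • (-v), ⟨_, hsV v hv, rfl⟩, _, hspan, ?_⟩
          change ε • v = _ at hve
          rw [smul_neg, hve, ← hsplit]
          abel)
    exact ⟨L, hL, angleHull_subset_of_single_mem hεpos hLW⟩

end AngleHull

/-! ### The nuclearity criterion -/

section Nuclear

variable {G : Type u} [AddCommGroup G] [TopologicalSpace G]

/-- Kolmogoroff numbers of angle hulls bound the diameters of neighbourhoods. -/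
lemma diamLE_of_angleHull_subset {U W W' : Set G} (hU : IsQuasiConvex U)
    (hW : IsQuasiConvex W) (hWU : W ⊆ U)
    {m : ℕ} {K c : ℝ} (h : ∀ k : ℕ, 1 ≤ k → ∃ L : Submodule ℝ (G →₀ ℝ),
      Module.rank ℝ L < (k : Cardinal) ∧
        angleHull U W ⊆ (K * ((k : ℝ) ^ m)⁻¹) • angleHull U U + (L : Set (G →₀ ℝ)))
    (hK : 0 < K) {a : ℕ} (ha : 0 < a) (haK : K ≤ a * c)
    (hW' : ∀ w ∈ W', ∀ j ≤ a, j • w ∈ W) : DiamLE W' U (rate c m) := by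
  have ha' : (0 : ℝ) < a := by exact_mod_cast ha
  have hsW := isSymm_angleHull hW hWU
  have hsU := isSymm_angleHull hU subset_rfl
  set f : (G →₀ ℤ) →+ (G →₀ ℝ) := Finsupp.mapRange.addMonoidHom (Int.castAddHom ℝ) with hf
  have hinj : Function.Injective f :=
    Finsupp.mapRange_injective _ (map_zero _) Int.cast_injective
  set ψ : (G →₀ ℤ) →+ G := Finsupp.liftAddHom fun g => zmultiplesHom G g with hψ
  set φ : f.range →+ G := ψ.comp (AddMonoidHom.ofInjective hinj).symm.toAddMonoidHom with hφ
  have hφf : ∀ x : G →₀ ℤ, φ (f.rangeRestrict x) = ψ x := fun x => by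
    have : (AddMonoidHom.ofInjective hinj).symm (f.rangeRestrict x) = x := by
      rw [AddEquiv.symm_apply_eq]
      rfl
    exact congrArg ψ this
  have hψs : ∀ x : G →₀ ℤ, ψ x = ∑ g ∈ x.support, x g • g := fun x => rfl
  have hang : ∀ (x : G →₀ ℤ) (χ : polar U),
      anglesLin U (f x) χ = ∑ g ∈ x.support, (x g : ℝ) * angle χ.1.1 g := by
    intro x χ
    have h1 : anglesLin U (f x) = ∑ g ∈ x.support, (x g : ℝ) • angles U g := by
      rw [anglesLin, Finsupp.linearCombination_apply, hf]
      exact Finsupp.sum_mapRange_index (hf := map_zero _) fun g => zero_smul _ _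
    rw [h1, Finset.sum_apply]
    rfl
  -- The subgroup consists of the formal combinations with integer coefficients, and the
  -- homomorphism evaluates them in G. On it the hull of U maps into U, since the linear angle is
  -- the true phase modulo 1.
  refine ⟨G →₀ ℝ, inferInstance, inferInstance, (a : ℝ)⁻¹ • angleHull U W, angleHull U U, ?_,
    (convex_angleHull U W).smul _, hsU, convex_angleHull U U, fun k hk => ?_, f.range, φ, ?_, ?_⟩
  · rintro _ ⟨x, hx, rfl⟩
    exact ⟨-x, hsW x hx, smul_neg _ _⟩
  · obtain ⟨L, hL, hLW⟩ := h k hk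
    have hkpos : (0 : ℝ) < k := by exact_mod_cast hk
    have hmem : kolmogorov k ((a : ℝ)⁻¹ • angleHull U W) (angleHull U U) ≤
        ENNReal.ofReal ((a : ℝ)⁻¹ * (K * ((k : ℝ) ^ m)⁻¹)) := by
      refine sInf_le ⟨_, by positivity, rfl, L, hL, ?_⟩
      rintro _ ⟨x, hx, rfl⟩
      obtain ⟨_, ⟨y, hy, rfl⟩, l, hl, rfl⟩ := Set.mem_add.1 (hLW hx)
      refine Set.mem_add.2 ⟨_, ⟨y, hy, rfl⟩, (a : ℝ)⁻¹ • l, L.smul_mem _ hl, ?_⟩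
      simp only [smul_add, smul_smul]
    refine hmem.trans (ENNReal.ofReal_le_ofReal ?_)
    rw [zpow_neg, zpow_natCast, ← mul_assoc]
    gcongr
    rw [inv_mul_le_iff₀ ha']
    exact haK
  · intro w hw
    have hfw : f (Finsupp.single w 1) = Finsupp.single w (1 : ℝ) := by
      simp [hf]
    refine ⟨f.rangeRestrict (Finsupp.single w 1), ?_, ?_⟩
    · change f (Finsupp.single w 1) ∈ (a : ℝ)⁻¹ • angleHull U W
      rw [hfw]
      refine ⟨(a : ℝ) • Finsupp.single w (1 : ℝ), mem_angleHull_of_angles (hW' w hw a le_rfl) ?_, ?_⟩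
      · ext χ
        rw [map_smul, anglesLin_single, one_smul]
        exact (angle_nsmul fun j hj => abs_angle_le_of_mem (hWU (hW' w hw j hj)) χ.2).1.symm
      · simp only [smul_smul]
        rw [inv_mul_cancel₀ ha'.ne', one_smul]
    · rw [hφf, hψs, Finsupp.support_single _ one_ne_zero]
      simp
  · rintro _ ⟨y, hx, rfl⟩
    obtain ⟨x, rfl⟩ := f.rangeRestrict_surjective y
    rw [hφf]
    refine mem_of_forall_polar hU fun χ hχ => ?_
    have hxU : anglesLin U (f x) ∈ convexHull ℝ (angles U '' U) := hx
    have hsub : convexHull ℝ (angles U '' U) ⊆ {p | |p ⟨χ, hχ⟩| ≤ 1 / 4} := by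
      refine convexHull_min ?_ ?_
      · rintro _ ⟨w, hw, rfl⟩
        exact abs_angle_le_of_mem hw hχ
      · have h1 : {p : polar U → ℝ | |p ⟨χ, hχ⟩| ≤ 1 / 4} =
            (LinearMap.proj (R := ℝ) (φ := fun _ : polar U => ℝ) ⟨χ, hχ⟩) ⁻¹' Set.Icc (-(1 / 4)) (1 / 4) := by
          ext p
          simp [abs_le]
        rw [h1]
        exact (convex_Icc _ _).linear_preimage _
    have h1 : |anglesLin U (f x) ⟨χ, hχ⟩| ≤ 1 / 4 := hsub hxU
    rw [← re_char_nonneg_iff, hψs, char_sum_zsmul, re_circle_exp]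
    rw [hang] at h1
    exact cos_nonneg_of_abs_le h1

/-- Each step applies the hypothesis to the neighbourhood V already found and gains one power of k.
All hulls use the characters from the polar of U, so that the decay rates compose in one space. -/
lemma exists_chain [IsTopologicalAddGroup G] (hqc : IsLocallyQuasiConvex G)
    (h : ∀ U ∈ 𝓝 (0 : G), IsQuasiConvex U → ∃ W ∈ 𝓝 (0 : G), ∃ c : ℝ,
      ∀ F : Set G, F.Finite → F ⊆ W → DiamLE F U (rate c 9))
    {U : Set G} (hU0 : U ∈ 𝓝 (0 : G)) (hU : IsQuasiConvex U) (M : ℕ) :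
    ∃ W ∈ 𝓝 (0 : G), IsQuasiConvex W ∧ W ⊆ U ∧ DecaysTo (angleHull U W) (angleHull U U) M := by
  have h0U := mem_of_mem_nhds hU0
  induction M with
  | zero =>
    refine ⟨U, hU0, hU, subset_rfl, 1, one_pos, fun k hk => ⟨⊥, rank_bot_lt hk, fun x hx => ?_⟩⟩
    exact Set.mem_add.2 ⟨x, by simpa using hx, 0, Submodule.zero_mem _, add_zero x⟩
  | succ M ih =>
    obtain ⟨V, hV0, hV, hVU, hVd⟩ := ih
    obtain ⟨W, hW0, c, hc⟩ := h V hV0 hV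
    have h2 : Tendsto (fun w : G => 2 • w) (𝓝 0) (𝓝 0) := by
      have := (continuous_nsmul (M := G) 2).tendsto 0
      rwa [smul_zero] at this
    -- Requiring 2w ∈ V as well halves the angle bound from 1/4 to 1/8, as needed for the rigidity
    -- of the integers.
    obtain ⟨W', hW'0, hW'sub, hW'⟩ := hqc _ (inter_mem (inter_mem hW0 hV0) (h2 hV0))
    have hang : ∀ w ∈ W', ∀ χ ∈ polar V, |angle χ.1 w| ≤ 1 / 8 := fun w hw χ hχ =>
      abs_angle_le_eighth (abs_angle_le_of_mem (hW'sub hw).1.2 hχ)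
        (abs_angle_le_of_mem (show 2 • w ∈ V from (hW'sub hw).2) hχ)
    obtain ⟨C, hC, hdep⟩ := exists_almost_dependent (U := V) (W := W') (c := c)
      (fun F hF hFW => hc F hF fun x hx => (hW'sub (hFW hx)).1.1) hang
    have hstep := decaysTo_angleHull hV hVU (fun x hx => (hW'sub hx).1.2) (mem_of_mem_nhds hV0) hC hdep
    refine ⟨W', hW'0, hW', fun x hx => hVU (hW'sub hx).1.2, ?_⟩
    rw [add_comm]
    exact hstep.trans (convex_angleHull U U) (zero_mem_angleHull h0U) hVd

/-- If every quasi-convex neighbourhood has a neighbourhood all of whose finite subsets have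
uniformly rapidly decreasing diameters, the group is nuclear. -/
theorem isNuclearGroup_of_finite_sets [IsTopologicalAddGroup G] [T2Space G]
    (hqc : IsLocallyQuasiConvex G)
    (h : ∀ U ∈ 𝓝 (0 : G), IsQuasiConvex U → ∃ W ∈ 𝓝 (0 : G), ∃ c : ℝ,
      ∀ F : Set G, F.Finite → F ⊆ W → DiamLE F U (rate c 9)) : IsNuclearGroup G := by
  refine ⟨inferInstance, fun m c hc U₀ hU₀ => ?_⟩
  obtain ⟨U, hU0, hUU₀, hU⟩ := hqc U₀ hU₀
  obtain ⟨W, hW0, hW, hWU, K, hK, hd⟩ := exists_chain hqc h hU0 hU m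
  -- If all multiples of w up to a + 1 lie in W, the hull may be scaled by (a+1)⁻¹, which brings the
  -- constant K below c.
  obtain ⟨a, ha⟩ := exists_nat_ge (K / c)
  refine ⟨{w | ∀ j ≤ a + 1, j • w ∈ W}, ?_, ?_⟩
  · have h1 : ∀ᶠ w in 𝓝 (0 : G), ∀ j ∈ Finset.range (a + 2), j • w ∈ W := by
      refine (Finset.eventually_all _).2 fun j _ => ?_
      have h2 := (continuous_nsmul (M := G) j).tendsto 0
      rw [smul_zero] at h2
      exact h2 hW0
    filter_upwards [h1] with w hw j hj
    exact hw j (Finset.mem_range.2 (by omega))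
  · have h1 : DiamLE {w | ∀ j ≤ a + 1, j • w ∈ W} U (rate c m) := by
      refine diamLE_of_angleHull_subset hU hW hWU hd hK (a := a + 1) (by omega) ?_
        fun w hw => hw
      rw [div_le_iff₀ hc] at ha
      push_cast
      nlinarith
    obtain ⟨E, i1, i2, X, Y, hXs, hXc, hYs, hYc, hd, H, φ, h2, h3⟩ := h1
    exact ⟨E, i1, i2, X, Y, hXs, hXc, hYs, hYc, hd, H, φ, h2, h3.trans hUU₀⟩

end Nuclear

/-! ### The null sequence and the theorem -/

section NullSequence

variable {G : Type u} [AddCommGroup G]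

lemma DiamLE.mono_left {A A' B : Set G} {s : ℕ → ℝ≥0∞} (h : DiamLE A B s) (hA : A' ⊆ A) :
    DiamLE A' B s := by
  obtain ⟨E, i1, i2, X, Y, hXs, hXc, hYs, hYc, hd, H, φ, h2, h3⟩ := h
  exact ⟨E, i1, i2, X, Y, hXs, hXc, hYs, hYc, hd, H, φ, hA.trans h2, h3⟩

lemma DiamLE.mono_rate {A B : Set G} {c c' : ℝ} {m : ℤ} (h : DiamLE A B (rate c m)) (hc : c ≤ c') :
    DiamLE A B (rate c' m) := by
  obtain ⟨E, i1, i2, X, Y, hXs, hXc, hYs, hYc, hd, r⟩ := h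
  refine ⟨E, i1, i2, X, Y, hXs, hXc, hYs, hYc, fun k hk => (hd k hk).trans ?_, r⟩
  refine ENNReal.ofReal_le_ofReal ?_
  gcongr

variable [TopologicalSpace G] [IsTopologicalAddGroup G] [TopologicalSpace.MetrizableSpace G]

/-- In a non-nuclear group some null sequence has diameters that are not rapidly decreasing. -/
theorem exists_null_sequence (hqc : IsLocallyQuasiConvex G) (hG : ¬ IsNuclearGroup G) :
    ∃ (g : ℕ → G) (U : Set G), Tendsto g atTop (𝓝 0) ∧ U ∈ 𝓝 (0 : G) ∧ IsQuasiConvex U ∧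
      ∀ (c : ℝ) (n₀ : ℕ), ¬ DiamLE (symmTail g n₀) U (rate c 9) := by
  have hcon : ∃ U ∈ 𝓝 (0 : G), IsQuasiConvex U ∧ ∀ W ∈ 𝓝 (0 : G), ∀ c : ℝ,
      ∃ F : Set G, F.Finite ∧ F ⊆ W ∧ ¬ DiamLE F U (rate c 9) := by
    by_contra! h
    exact hG (isNuclearGroup_of_finite_sets hqc h)
  obtain ⟨U, hU0, hU, hF⟩ := hcon
  obtain ⟨W, hW⟩ := (𝓝 (0 : G)).exists_antitone_basis
  choose F hFfin hFW hFd using fun n : ℕ => hF (W n) (hW.mem n) n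
  set l : ℕ → List G := fun n => (hFfin n).toFinset.toList with hl
  have hlF : ∀ n x, x ∈ l n ↔ x ∈ F n := fun n x => by simp [hl]
  -- The index pairs the number of the finite set with a position in its list; positions past the
  -- end are filled with 0. Only finitely many genuine entries come from the first n sets, so g
  -- tends to 0.
  set g : ℕ → G := fun m => (l m.unpair.1).getD m.unpair.2 0 with hg
  refine ⟨g, U, ?_, hU0, hU, fun c n₀ hd => ?_⟩
  · refine hW.tendsto_right_iff.2 fun n _ => ?_
    rw [← Nat.cofinite_eq_atTop, eventually_cofinite]
    refine ((Set.finite_Iio n).biUnion fun i _ =>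
      (Set.finite_Iio (l i).length).image (Nat.pair i)).subset fun m hm => ?_
    have hlt : m.unpair.2 < (l m.unpair.1).length := by
      by_contra hge
      refine hm ?_
      have h1 : g m = 0 := List.getD_eq_default _ _ (not_lt.1 hge)
      rw [h1]
      exact mem_of_mem_nhds (hW.mem n)
    have hmem : g m ∈ F m.unpair.1 := by
      rw [← hlF]
      simp only [hg, List.getD_eq_getElem _ _ hlt]
      exact List.getElem_mem hlt
    simp only [Set.mem_iUnion]
    refine ⟨m.unpair.1, ?_, m.unpair.2, hlt, Nat.pair_unpair m⟩
    by_contra hge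
    exact hm (hW.antitone (not_lt.1 hge) (hFW _ hmem))
  · obtain ⟨n₁, hn₁⟩ := exists_nat_ge c
    -- The pair (n, i) has index at least n ≥ n₀, so the tail contains all of F n, while c ≤ n
    -- contradicts the choice of F n.
    set n := max n₀ n₁ with hn
    refine hFd n ((hd.mono_left fun x hx => ?_).mono_rate
      (hn₁.trans (by exact_mod_cast le_max_right n₀ n₁)))
    obtain ⟨i, hi, hix⟩ := List.getElem_of_mem ((hlF n x).2 hx)
    refine Or.inl ⟨Nat.pair n i, (le_max_left _ _).trans (Nat.left_le_pair n i), Or.inl ?_⟩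
    simp only [hg, Nat.unpair_pair, List.getD_eq_getElem _ _ hi, hix]

end NullSequence
end NuclearGroups

theorem mainTheorem5 {G : Type u} [AddCommGroup G] [TopologicalSpace G] [IsTopologicalAddGroup G]
    [TopologicalSpace.MetrizableSpace G]
    (hqc : NuclearGroups.IsLocallyQuasiConvex G)
    (hG : ¬ NuclearGroups.IsNuclearGroup G) :
    (∃ c₅ : ℝ, NuclearGroups.IsHilbertConst.{u} 5 c₅) ∧
    (∃ c₉ : ℝ, NuclearGroups.IsHilbertConst.{u} 9 c₉) ∧
    ∃ (g : ℕ → G) (U : Set G),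
      Tendsto g atTop (𝓝 0) ∧ U ∈ 𝓝 (0 : G) ∧ NuclearGroups.IsQuasiConvex U ∧
      ∀ c₅ c₉ : ℝ, NuclearGroups.IsHilbertConst.{u} 5 c₅ → NuclearGroups.IsHilbertConst.{u} 9 c₉ →
        ∀ c : ℝ, 0 ≤ c → c < (945 : ℝ) ^ ((1 : ℝ) / 4) / (32 * Real.pi ^ 4 * c₅ * c₉) →
          ∀ n₀ : ℕ, ¬ NuclearGroups.DiamLE (NuclearGroups.symmTail g n₀) U
            (NuclearGroups.rate c 9) := by
  obtain ⟨g, U, hg, hU0, hU, h⟩ := NuclearGroups.exists_null_sequence hqc hG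
  -- `isHilbertConst n` treats decay of order n + 2, hence the arguments 3 and 7.
  exact ⟨⟨_, NuclearGroups.isHilbertConst 3⟩, ⟨_, NuclearGroups.isHilbertConst 7⟩, g, U, hg, hU0, hU,
    fun _ _ _ _ c _ _ n₀ => h c n₀⟩
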